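/- Let $R$ be a (Noetherian) regular domain with field of fractions $K$, and let $x_1,\dots,x_d\in R$ be a generalized regular system of parameters, i.e. $x_1,\dots,x_d$ is a regular sequence in every order and $R/(x_{i_1},\dots,x_{i_s})$ is a regular domain for all $i_1,\dots,i_s\in\{1,\dots,d\}$. For $e\in\mathbb N^d$ write $x^e=x_1^{e_1}\cdots x_d^{e_d}$. An ideal of $R$ is called monomial if it is generated by elements $x^e$. For a valuation $v$ of $K$ that is non-negative on $R$, with Noetherian valuation ring $R_v$, take $v$ normalized ($v(r)=m$ if $rR_v$ is the $m$-th power of the maximal ideal of $R_v$; $v(0)=\infty$), put $v(\mathfrak a)=\min\{v(a): a\in\mathfrak a\}$ for ideals $\mathfrak a$ of $R$ or of $R_v$, and let $J_{R_v/R}$ be the Jacobian ideal, the $0$-th Fitting ideal of the module of Kähler differentials $\Omega_{R_v/R}$. The adjoint of an ideal $I$ of $R$ is $$\operatorname{adj} I=\bigcap_v\{r\in R : v(r)\ge v(I)-v(J_{R_v/R})\},$$ where $v$ varies over all valuations of $K$ that are non-negative on $R$ and whose ring $R_v$ is a localization of a finitely generated $R$-algebra. If $I$ is generated by $x^{a_1},\dots,x^{a_s}$,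 its Newton polyhedron is $$\mathrm{NP}(I)=\Big\{u\in\mathbb Q_{\ge0}^d : u\ge\sum_i c_ia_i \text{ componentwise for some } c_i\in\mathbb Q_{\ge0},\ \sum_i c_i=1\Big\},$$ with interior $\mathrm{NP}^\circ(I)$ (in $\mathbb Q^d$). For $I\ne0$, let $\mathcal{RV}(I)$ be the set of Rees valuations of $I$, i.e. the unique minimal finite set of normalized discrete valuations of $K$, non-negative on $R$, such that for all $n\ge1$ the integral closure of $I^n$ is $\{r\in R: v(r)\ge n\,v(I)\text{ for all }v\in\mathcal{RV}(I)\}$. **Theorem 4.1.** Let $I$ be a monomial ideal and let $n\ge1$. Then $I^n$ is generated by finitely many monomials, $\operatorname{adj}(I^n)$ is monomial, and for $\mathrm{NP}(I^n)$ computed from any finite set of monomial generators of $I^n$, $$\operatorname{adj}(I^n)=\big(\{x^e : e\in\mathbb N^d,\ e+(1,\dots,1)\in\mathrm{NP}^\circ(I^n)\}\big).$$ If moreover $I\ne0$, then $\mathcal{RV}(I)$ exists, and $$\operatorname{adj}(I^n)=\bigcap_{v\in\mathcal{RV}(I)}\big(\{x^e : v(x^e)\ge v(I^n)-v(x_1\cdots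 x_d)+1\}\big)=\bigcap_{v\in\mathcal{RV}(I)}\big(\{x^e : v(x^e)\ge v(I^n)-v(J_{R_v/R})\}\big),$$ where $(\cdot)$ denotes the ideal generated by a set and an empty intersection is $R$; and $v(x_1\cdots x_d)-1=v(J_{R_v/R})$ for every $v\in\mathcal{RV}(I)$. -/

import Mathlib

open scoped KaehlerDifferential

noncomputable section

/-! ### Generalized regular systems of parameters and monomial ideals -/

/-- `x₁, …, x_d` is a generalized regular system of parameters of `R`: it is a regular sequence in
every order, and the quotient by any subset of the `xᵢ` is a regular domain. -/
structure IsGeneralizedRSP {R : Type*} [CommRing R] {d : ℕ} (x : Fin d → R) : Prop where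
  isRegular_perm : ∀ σ : Equiv.Perm (Fin d),
    RingTheory.Sequence.IsRegular R (List.ofFn fun i => x (σ i))
  isDomain_quotient : ∀ s : Set (Fin d), IsDomain (R ⧸ Ideal.span (x '' s))
  isRegularRing_quotient : ∀ s : Set (Fin d), IsRegularRing (R ⧸ Ideal.span (x '' s))

/-- The monomial `x^e = x₁^{e₁} ⋯ x_d^{e_d}`. -/
def xMonomial {R : Type*} [CommRing R] {d : ℕ} (x : Fin d → R) (e : Fin d → ℕ) : R :=
  ∏ i, x i ^ e i

/-- The ideal generated by the monomials `x^e` with `e ∈ E`. -/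
def monomialIdeal {R : Type*} [CommRing R] {d : ℕ} (x : Fin d → R) (E : Set (Fin d → ℕ)) :
    Ideal R :=
  Ideal.span (xMonomial x '' E)

/-- `I` is a monomial ideal in `x₁, …, x_d`. -/
def IsMonomialIdeal {R : Type*} [CommRing R] {d : ℕ} (x : Fin d → R) (I : Ideal R) : Prop :=
  ∃ E : Set (Fin d → ℕ), I = monomialIdeal x E

/-- The Newton polyhedron in `ℚ^d` of the ideal generated by the monomials with exponents in the
finite set `A`: all `u ≥ 0` with `u ≥ ∑ c_a a` for some rational `c_a ≥ 0` with `∑ c_a = 1`. -/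
def newtonPolyhedron {d : ℕ} (A : Finset (Fin d → ℕ)) : Set (Fin d → ℚ) :=
  {u | (∀ i, 0 ≤ u i) ∧ ∃ c : (Fin d → ℕ) → ℚ, (∀ a ∈ A, 0 ≤ c a) ∧ ∑ a ∈ A, c a = 1 ∧
    ∀ i, ∑ a ∈ A, c a * (a i : ℚ) ≤ u i}

/-! ### Integral closure of ideals -/

/-- `r` is in the integral closure of the ideal `I`: it satisfies an equation
`r^k + a₁ r^(k-1) + ⋯ + a_k = 0` with `k ≥ 1` and `aᵢ ∈ I^i`. -/
def IsIntegralOverIdeal {R : Type*} [CommRing R] (I : Ideal R) (r : R) : Prop :=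
  ∃ (k : ℕ) (a : ℕ → R), 1 ≤ k ∧ (∀ i ∈ Finset.Icc 1 k, a i ∈ I ^ i) ∧
    r ^ k + ∑ i ∈ Finset.Icc 1 k, a i * r ^ (k - i) = 0

/-! ### The Jacobian ideal -/

/-- The `0`-th Fitting ideal of a finitely generated `A`-module `M`: it is generated by the
determinants of square matrices whose rows are relations between the members of a finite generating
family. The ideal obtained from one generating family does not depend on that family, so
all of them may be used at once. -/
def fittingIdealZero (A M : Type*) [CommRing A] [AddCommGroup M] [Module A M] : Ideal A :=
  Ideal.span {a : A | ∃ (n : ℕ) (m : Fin n → M) (P : Matrix (Fin n) (Fin n) A),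
    Submodule.span A (Set.range m) = ⊤ ∧ (∀ i, ∑ j, P i j • m j = 0) ∧ a = P.det}

/-- The Jacobian ideal `J_{A/R}`: the `0`-th Fitting ideal of the module of Kähler differentials. -/
def jacobianIdeal (R A : Type*) [CommRing R] [CommRing A] [Algebra R A] : Ideal A :=
  fittingIdealZero A (Ω[A⁄R])

/-! ### Normalized valuations -/

/-- A valuation ring of the field `K` which contains (the image of) `R`. It stands for the
equivalence class of the valuations on `K` that have it as their ring and are therefore
non-negative on `R`. -/
structure ValuationOver (R K : Type*) [CommRing R] [Field K] [Algebra R K]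
    extends Subalgebra R K where
  mem_or_inv_mem' : ∀ z : K, z ∈ carrier ∨ z⁻¹ ∈ carrier

namespace ValuationOver

variable {R K : Type*} [CommRing R] [Field K] [Algebra R K]

/-- The valuation ring `R_v`, as an `R`-subalgebra of `K`. -/
abbrev ring (v : ValuationOver R K) : Subalgebra R K := v.toSubalgebra

/-- The valuation ring `R_v`, as a valuation subring of `K`. -/
def toValuationSubring (v : ValuationOver R K) : ValuationSubring K where
  toSubring := v.ring.toSubring
  mem_or_inv_mem' := v.mem_or_inv_mem'

instance isLocalRing (v : ValuationOver R K) : IsLocalRing v.ring :=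
  inferInstanceAs (IsLocalRing v.toValuationSubring)

/-- The normalized valuation: `v a` is the largest `n` such that `a` is in the `n`-th power of the
maximal ideal of `R_v`. If `R_v` is a discrete valuation ring, then `a R_v` equals that power for
`a ≠ 0`, and `v 0 = ∞`; if `R_v = K`, then `v a = 0` for `a ≠ 0`, and `v 0 = ∞`. -/
def val (v : ValuationOver R K) (a : v.ring) : ℕ∞ :=
  ⨆ n : {n : ℕ // a ∈ IsLocalRing.maximalIdeal v.ring ^ n}, ((n : ℕ) : ℕ∞)

/-- The value `v r` of an element `r` of `R`. -/
def baseVal (v : ValuationOver R K) (r : R) : ℕ∞ := v.val (algebraMap R v.ring r)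

/-- The value `v I = min {v r | r ∈ I}` of an ideal `I` of `R`. -/
def idealVal (v : ValuationOver R K) (I : Ideal R) : ℕ∞ := ⨅ r : I, v.baseVal (r : R)

/-- The value `v (J_{R_v/R}) = min {v a | a ∈ J_{R_v/R}}` of the Jacobian ideal of `R_v`
over `R`. -/
def jacobianVal (v : ValuationOver R K) : ℕ∞ := ⨅ a : jacobianIdeal R v.ring, v.val (a : v.ring)

theorem le_val_iff (v : ValuationOver R K) (a : v.ring) (n : ℕ) :
    (n : ℕ∞) ≤ v.val a ↔ a ∈ IsLocalRing.maximalIdeal v.ring ^ n := by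
  constructor
  · intro h
    cases n with
    | zero => simp
    | succ k =>
      have h' : (k : ℕ∞) < v.val a := lt_of_lt_of_le (by exact_mod_cast Nat.lt_succ_self k) h
      obtain ⟨⟨m, hm⟩, hkm⟩ := lt_iSup_iff.mp h'
      have hkm' : k < m := by exact_mod_cast hkm
      exact Ideal.pow_le_pow_right hkm' hm
  · intro h
    exact le_iSup (fun n : {n : ℕ // a ∈ IsLocalRing.maximalIdeal v.ring ^ n} =>
      ((n : ℕ) : ℕ∞)) ⟨n, h⟩

theorem min_val_le_val_add (v : ValuationOver R K) (a b : v.ring) :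
    min (v.val a) (v.val b) ≤ v.val (a + b) := by
  refine ENat.forall_natCast_le_iff_le.mp fun n hn => ?_
  rw [le_min_iff, le_val_iff, le_val_iff] at hn
  rw [le_val_iff]
  exact Ideal.add_mem _ hn.1 hn.2

theorem val_le_val_mul (v : ValuationOver R K) (a b : v.ring) : v.val b ≤ v.val (a * b) := by
  refine ENat.forall_natCast_le_iff_le.mp fun n hn => ?_
  rw [le_val_iff] at hn ⊢
  exact Ideal.mul_mem_left _ _ hn

theorem val_zero (v : ValuationOver R K) : v.val 0 = ⊤ :=
  top_le_iff.mp (ENat.forall_natCast_le_iff_le.mp fun n _ => by rw [le_val_iff]; exact zero_mem _)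

/-- `v` is admitted in the definition of adjoints: `R_v` is a localization of a finitely generated
`R`-algebra. -/
def IsEssFiniteType (v : ValuationOver R K) : Prop := Algebra.EssFiniteType R v.ring

end ValuationOver

/-! ### Adjoint ideals -/

/-- The adjoint of `I`: all `r ∈ R` with `v r ≥ v I - v (J_{R_v/R})` for every valuation `v` of the
fraction field `K` which is non-negative on `R` and whose ring is a localization of a finitely
generated `R`-algebra. -/
def adjointIdeal {R : Type*} (K : Type*) [CommRing R] [Field K] [Algebra R K] (I : Ideal R) :
    Ideal R where
  carrier := {r | ∀ v : ValuationOver R K, v.IsEssFiniteType →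
    v.idealVal I ≤ v.baseVal r + v.jacobianVal}
  zero_mem' := by
    intro v _
    simp [ValuationOver.baseVal, ValuationOver.val_zero]
  add_mem' := by
    intro r s hr hs v hv
    have h := v.min_val_le_val_add (algebraMap R v.ring r) (algebraMap R v.ring s)
    rw [← map_add] at h
    rcases min_le_iff.mp h with h | h
    · exact (hr v hv).trans (add_le_add_left h _)
    · exact (hs v hv).trans (add_le_add_left h _)
  smul_mem' := by
    intro c r hr v hv
    have h := v.val_le_val_mul (algebraMap R v.ring c) (algebraMap R v.ring r)
    rw [← map_mul] at h
    exact (hr v hv).trans (add_le_add_left h _)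

/-! ### Rees valuations -/

/-- `S` is a finite set of normalized discrete valuations of `K`, non-negative on `R`, which
determines the integral closures of all the powers of `I`: an element `r` of `R` is in the integral
closure of `I^n` if and only if `v r ≥ n * v I` for all `v ∈ S`. -/
structure DeterminesIntegralClosures {R K : Type*} [CommRing R] [Field K] [Algebra R K]
    (I : Ideal R) (S : Set (ValuationOver R K)) : Prop where
  finite : S.Finite
  isDiscrete : ∀ v ∈ S, IsDiscreteValuationRing v.ring
  isIntegralOverIdeal_iff : ∀ n : ℕ, 1 ≤ n → ∀ r : R,
    IsIntegralOverIdeal (I ^ n) r ↔ ∀ v ∈ S, (n : ℕ∞) * v.idealVal I ≤ v.baseVal r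

/-- The set `RV(I)` of the Rees valuations of a non-zero ideal `I`: the smallest set of valuations
that determines the integral closures of all the powers of `I`. -/
def reesValuations {R : Type*} (K : Type*) [CommRing R] [Field K] [Algebra R K] (I : Ideal R) :
    Set (ValuationOver R K) :=
  ⋂₀ {S | DeterminesIntegralClosures I S}

end

/-! Monomial ideals in a generalized regular system of parameters behave as in a polynomial ring.
Finite intersections are computed on exponents (`IsPrimeFamily.iInf_monIdeal`), and for positive
weights w the graded ring of the filtration by weighted monomials is a polynomial ring over the
domain R/(x) (`IsPrimeFamily.mul_notMem`). The weighted order is therefore a valuation whose level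
ideals are monomial. If the weights have gcd 1, it is normalized and its ring is essentially of
finite type over R.

The second ingredient is the inequality v(J) ≥ v(x₁⋯x_d) - 1 for every discrete v whose ring is
essentially of finite type (`ValuationOver.baseVal_prod_le_jacobianVal`), with equality for monomial
v. For the inequality, write R_v as A/Q with A a localization of a polynomial ring over R in which
one variable X maps to a uniformizer t. If xᵢ = uᵢ t^{wᵢ} with wᵢ > 0, the elements xᵢ - uᵢ X^{wᵢ}
of Q are part of a minimal generating system of Q consisting of regular parameters. In the Jacobian
matrix their rows are divisible by t^{wᵢ} outside the column of X and by t^{wᵢ-1} in it, so the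
determinant is divisible by t^{∑wᵢ-1}. For equality, explicit relations between differentials of
Laurent monomials give a determinant of exactly this order.

The Newton polyhedron is cut out by finitely many primitive weights, by elimination. Since level
ideals of monomial valuations intersect in monomial ideals, the corresponding monomial valuations
determine the integral closures of all powers of I. A minimal determining set lies in every other
one, because an irredundant valuation is proportional to a member of any competing set
(`exists_proportional_of_forall_iff`). So the Rees valuations exist and are monomial.

If e + 1 is interior to the polyhedron, it can be shrunk slightly, so v(x^e) + v(x₁⋯x_d) > v(Iⁿ)
whenever v(Iⁿ) > 0; the Jacobian inequality puts x^e in the adjoint. Conversely, testing the adjoint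
only on the Rees valuations places it in an intersection of monomial ideals, which is monomial. Its
exponents satisfy strict inequalities at all Rees valuations, and these force e + 1 into the
interior. Thus all the ideals coincide. -/

open scoped KaehlerDifferential

noncomputable section

set_option linter.unusedSectionVars false

/-! ### Combinatorics of monomial ideals in a prime family -/

section MonomialIdeals

variable {ι R : Type*} [Fintype ι] [CommRing R]

/-- The monomial `∏ i, x i ^ e i` in a finite family of elements. -/
def mon (x : ι → R) (e : ι → ℕ) : R := ∏ i, x i ^ e i

/-- The ideal generated by the monomials with exponents in `E`. -/
def monIdeal (x : ι → R) (E : Set (ι → ℕ)) : Ideal R := Ideal.span (mon x '' E)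

/-- All partial ideals of the family are prime, and they are pairwise different. -/
structure IsPrimeFamily (x : ι → R) : Prop where
  isPrime : ∀ S : Set ι, (Ideal.span (x '' S)).IsPrime
  notMem : ∀ (S : Set ι) (i : ι), i ∉ S → x i ∉ Ideal.span (x '' S)

variable {x : ι → R}

@[simp] theorem mon_zero : mon x 0 = 1 := by simp [mon]

theorem mon_add (e f : ι → ℕ) : mon x (e + f) = mon x e * mon x f := by
  simp [mon, pow_add, Finset.prod_mul_distrib]

theorem mon_single [DecidableEq ι] (i : ι) (n : ℕ) : mon x (Pi.single i n) = x i ^ n := by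
  rw [mon, Finset.prod_eq_single i] <;> simp +contextual

theorem mon_nsmul (n : ℕ) (e : ι → ℕ) : mon x (n • e) = mon x e ^ n := by
  simp [mon, ← Finset.prod_pow, ← pow_mul, mul_comm]

theorem mon_dvd_mon {e f : ι → ℕ} (h : e ≤ f) : mon x e ∣ mon x f := by
  obtain ⟨g, rfl⟩ := exists_add_of_le h
  exact ⟨mon x g, mon_add e g⟩

theorem mon_mem_monIdeal {E : Set (ι → ℕ)} {e : ι → ℕ} (h : e ∈ E) : mon x e ∈ monIdeal x E :=
  Ideal.subset_span ⟨e, h, rfl⟩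

theorem monIdeal_le_iff {E : Set (ι → ℕ)} {J : Ideal R} :
    monIdeal x E ≤ J ↔ ∀ e ∈ E, mon x e ∈ J := by
  rw [monIdeal, Ideal.span_le, Set.image_subset_iff]; rfl

theorem monIdeal_mono {E F : Set (ι → ℕ)} (h : E ⊆ F) : monIdeal x E ≤ monIdeal x F :=
  Ideal.span_mono (Set.image_mono h)

/-- Dickson's lemma for upper sets, in the form of a bound on the exponents of generators. -/
theorem exists_bound_of_isUpperSet {E : Set (ι → ℕ)} (hE : IsUpperSet E) :
    ∃ b : ι → ℕ, ∀ e ∈ E, e ⊓ b ∈ E := by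
  have hfin : {e | Minimal (· ∈ E) e}.Finite :=
    WellQuasiOrderedLE.finite_of_isAntichain (setOfPred_minimal_antichain _)
  obtain ⟨b, hb⟩ := hfin.bddAbove
  refine ⟨b, fun e he => ?_⟩
  obtain ⟨m, hme, hm⟩ := exists_minimal_le_of_wellFoundedLT (· ∈ E) e he
  exact hE (le_inf hme (hb hm)) hm.prop

/-- The exponents that land in `E` after adding one in direction `i`. -/
def shiftSet [DecidableEq ι] (E : Set (ι → ℕ)) (i : ι) : Set (ι → ℕ) :=
  {e | e + Pi.single i 1 ∈ E}

/-- The exponents that stay in `E` after setting the coordinate `i` to zero. -/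
def sliceSet [DecidableEq ι] (E : Set (ι → ℕ)) (i : ι) : Set (ι → ℕ) :=
  {e | Function.update e i 0 ∈ E}

section Slices

variable [DecidableEq ι] {E : Set (ι → ℕ)} {b : ι → ℕ}

theorem isUpperSet_shiftSet (hE : IsUpperSet E) (i : ι) : IsUpperSet (shiftSet E i) :=
  fun _ _ h h' => hE (add_le_add_left h _) h'

theorem isUpperSet_sliceSet (hE : IsUpperSet E) (i : ι) : IsUpperSet (sliceSet E i) :=
  fun _ _ h h' => hE (update_le_update_iff.2 ⟨le_rfl, fun j _ => h j⟩) h'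

theorem sliceSet_subset (hE : IsUpperSet E) (i : ι) : sliceSet E i ⊆ E :=
  fun _ h => hE (update_le_iff.2 ⟨Nat.zero_le _, fun _ _ => le_rfl⟩) h

theorem subset_shiftSet (hE : IsUpperSet E) (i : ι) : E ⊆ shiftSet E i :=
  fun _ h => hE le_self_add h

theorem shiftSet_bound {i : ι} (hi : b i ≠ 0) (hb : ∀ e ∈ E, e ⊓ b ∈ E) :
    ∀ e ∈ shiftSet E i, e ⊓ Function.update b i (b i - 1) ∈ shiftSet E i := by
  intro e he
  have := hb _ he
  simp only [shiftSet, Set.mem_ofPred_eq]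
  convert this using 1
  ext j
  by_cases hj : j = i
  · subst hj; simp; omega
  · simp [hj]

theorem sliceSet_bound {i : ι} (hb : ∀ e ∈ E, e ⊓ b ∈ E) :
    ∀ e ∈ sliceSet E i, e ⊓ Function.update b i 0 ∈ sliceSet E i := by
  intro e he
  have := hb _ he
  simp only [sliceSet, Set.mem_ofPred_eq]
  convert this using 1
  ext j
  by_cases hj : j = i
  · subst hj; simp
  · simp [hj]

theorem mul_mem_monIdeal_of_mem_shiftSet {i : ι} {r : R} (hr : r ∈ monIdeal x (shiftSet E i)) :
    x i * r ∈ monIdeal x E := by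
  have h : monIdeal x (shiftSet E i) ≤ (monIdeal x E).colon {x i} := by
    rw [monIdeal_le_iff]
    intro e he
    rw [Submodule.mem_colon_singleton, smul_eq_mul, mul_comm, ← pow_one (x i), ← mon_single, mul_comm,
      ← mon_add]
    exact mon_mem_monIdeal he
  simpa [Submodule.mem_colon_singleton, mul_comm] using h hr

/-- Sorts the generators by whether `x i` occurs in them. With its companion for the shift this lets
inductions remove one power of one variable at a time. -/
theorem exists_slice_of_mem_monIdeal (i : ι) {r : R} (hr : r ∈ monIdeal x E) :
    ∃ m ∈ monIdeal x (sliceSet E i), ∃ n ∈ monIdeal x (shiftSet E i), r = m + x i * n := by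
  have h : monIdeal x E ≤
      monIdeal x (sliceSet E i) ⊔ Ideal.span {x i} * monIdeal x (shiftSet E i) := by
    rw [monIdeal_le_iff]
    intro e he
    by_cases hi : e i = 0
    · refine Ideal.mem_sup_left (mon_mem_monIdeal ?_)
      rwa [sliceSet, Set.mem_ofPred_eq, ← hi, Function.update_eq_self]
    · refine Ideal.mem_sup_right ?_
      have h1 : Function.update e i (e i - 1) + Pi.single i 1 = e := by
        ext j
        by_cases hj : j = i
        · subst hj; simp; omega
        · simp [hj]
      have h4 : mon x e = x i * mon x (Function.update e i (e i - 1)) := by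
        conv_lhs => rw [← h1, mon_add, mon_single, pow_one, mul_comm]
      have h2 : Function.update e i (e i - 1) ∈ shiftSet E i := by
        rwa [shiftSet, Set.mem_ofPred_eq, h1]
      have h3 : mon x (Function.update e i (e i - 1)) ∈ monIdeal x (shiftSet E i) :=
        mon_mem_monIdeal h2
      exact Ideal.mem_span_singleton_mul.2 ⟨_, h3, h4.symm⟩
  obtain ⟨m, hm, n, hn, rfl⟩ := Submodule.mem_sup.1 (h hr)
  obtain ⟨n', hn', rfl⟩ := Ideal.mem_span_singleton_mul.1 hn
  exact ⟨m, hm, n', hn', rfl⟩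

end Slices

theorem monIdeal_eq_of_bound_zero {E : Set (ι → ℕ)} {b : ι → ℕ}
    (hb : ∀ e ∈ E, e ⊓ b ∈ E) (hb0 : b = 0) : E = ∅ ∨ monIdeal x E = ⊤ := by
  rcases E.eq_empty_or_nonempty with h | ⟨e, he⟩
  · exact Or.inl h
  · refine Or.inr ((Ideal.eq_top_iff_one _).2 ?_)
    rw [← mon_zero (x := x)]
    apply mon_mem_monIdeal
    convert hb e he
    ext j
    simp [hb0]

variable [DecidableEq ι]

/-- Computes the colon ideal by `x i`: after splitting off the part divisible by `x i`, what remains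
lies in the slice, where `x i` does not occur and can be cancelled by `hnzd`. That hypothesis is
kept explicit because it is supplied by the induction that uses this lemma. -/
theorem mem_sup_shiftSet_of_mul_mem {S : Set ι} {E : Set (ι → ℕ)} (hE : IsUpperSet E) {i : ι}
    (hnzd : ∀ r, x i * r ∈ Ideal.span (x '' S) ⊔ monIdeal x (sliceSet E i) →
      r ∈ Ideal.span (x '' S) ⊔ monIdeal x (sliceSet E i))
    {z : R} (hz : x i * z ∈ Ideal.span (x '' S) ⊔ monIdeal x E) :
    z ∈ Ideal.span (x '' S) ⊔ monIdeal x (shiftSet E i) := by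
  obtain ⟨s, hs, m, hm, hsm⟩ := Submodule.mem_sup.1 hz
  obtain ⟨m', hm', n, hn, rfl⟩ := exists_slice_of_mem_monIdeal i hm
  have h1 : z - n ∈ Ideal.span (x '' S) ⊔ monIdeal x (sliceSet E i) := by
    apply hnzd
    have : x i * (z - n) = s + m' := by linear_combination -hsm
    rw [this]
    exact Submodule.add_mem_sup hs hm'
  have h2 := sup_le_sup_left (c := Ideal.span (x '' S))
    (monIdeal_mono (x := x) ((sliceSet_subset hE i).trans (subset_shiftSet hE i))) h1
  simpa using Ideal.add_mem _ h2 (Ideal.mem_sup_right hn)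

theorem exists_of_mem_sup_insert {S : Set ι} {E : Set (ι → ℕ)} {i : ι} {r : R}
    (hr : r ∈ Ideal.span (x '' insert i S) ⊔ monIdeal x E) :
    ∃ s ∈ Ideal.span (x '' S), ∃ m ∈ monIdeal x E, ∃ r', r = s + m + x i * r' := by
  obtain ⟨s, hs, m, hm, rfl⟩ := Submodule.mem_sup.1 hr
  rw [Set.image_insert_eq, Ideal.mem_span_insert] at hs
  obtain ⟨a, t, ht, rfl⟩ := hs
  exact ⟨t, ht, m, hm, a, by ring⟩

theorem sup_le_sup_insert_sliceSet {S : Set ι} {E : Set (ι → ℕ)} (i : ι) :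
    Ideal.span (x '' S) ⊔ monIdeal x E ≤
      Ideal.span (x '' insert i S) ⊔ monIdeal x (sliceSet E i) := by
  refine sup_le (le_sup_of_le_left (Ideal.span_mono (Set.image_mono (Set.subset_insert _ _))))
    fun r hr => ?_
  obtain ⟨m, hm, n, hn, rfl⟩ := exists_slice_of_mem_monIdeal i hr
  exact Ideal.add_mem _ (Ideal.mem_sup_right hm) (Ideal.mem_sup_left
    (Ideal.mul_mem_right _ _ (Ideal.subset_span ⟨i, Set.mem_insert _ _, rfl⟩)))

theorem sum_update_lt {b : ι → ℕ} {i : ι} {k : ℕ} (h : k < b i) :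
    ∑ j, Function.update b i k j < ∑ j, b j := by
  refine Finset.sum_lt_sum (fun j _ => ?_) ⟨i, Finset.mem_univ _, by simpa using h⟩
  by_cases hj : j = i
  · subst hj; simpa using h.le
  · simp [hj]

theorem support_update_zero (b : ι → ℕ) (i : ι) (S : Set ι) (hi : b i ≠ 0) :
    insert i S ∪ {j | Function.update b i 0 j ≠ 0} = S ∪ {j | b j ≠ 0} := by
  ext j
  by_cases hj : j = i
  · subst hj; simp [hi]
  · simp [hj]

/-- An element outside the prime ideal generated by the variables that occur in a monomial ideal is
a nonzerodivisor modulo that monomial ideal. -/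
theorem IsPrimeFamily.mem_of_mul_mem_aux (hx : IsPrimeFamily x) (N : ℕ) :
    ∀ (b : ι → ℕ), ∑ j, b j = N → ∀ (S : Set ι), (∀ i ∈ S, b i = 0) →
    ∀ (E : Set (ι → ℕ)), IsUpperSet E → (∀ e ∈ E, e ⊓ b ∈ E) →
    ∀ f ∉ Ideal.span (x '' (S ∪ {i | b i ≠ 0})), ∀ r,
      f * r ∈ Ideal.span (x '' S) ⊔ monIdeal x E → r ∈ Ideal.span (x '' S) ⊔ monIdeal x E := by
  -- Induction on the total size of a bound `b` for the exponents of generators. The set `S` of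
  -- variables already set to zero is carried along because slicing at `i` passes to the quotient by
  -- `x i`.
  induction N using Nat.strong_induction_on with
  | _ N ih =>
    intro b hbN S hS E hE hb f hf r hr
    by_cases hb0 : b = 0
    · rcases monIdeal_eq_of_bound_zero (x := x) hb hb0 with h | h
      · subst h
        simp only [monIdeal, Set.image_empty, Ideal.span_empty, sup_bot_eq] at hr ⊢
        have hf' : f ∉ Ideal.span (x '' S) := by simpa [hb0] using hf
        exact ((hx.isPrime S).mem_or_mem hr).resolve_left hf'
      · simp [h]
    · obtain ⟨i, hi⟩ := Function.ne_iff.1 hb0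
      have hi : b i ≠ 0 := hi
      have hlt0 : ∑ j, Function.update b i 0 j < N := hbN ▸ sum_update_lt (Nat.pos_of_ne_zero hi)
      have hlt1 : ∑ j, Function.update b i (b i - 1) j < N := hbN ▸ sum_update_lt (by omega)
      have hiS : i ∉ S := fun h => hi (hS i h)
      have hS0 : ∀ j ∈ S, ∀ k, Function.update b i k j = 0 := fun j hj k => by
        rw [Function.update_of_ne (by rintro rfl; exact hiS hj), hS j hj]
      have hcolon : ∀ z, x i * z ∈ Ideal.span (x '' S) ⊔ monIdeal x E →
          z ∈ Ideal.span (x '' S) ⊔ monIdeal x (shiftSet E i) := fun z =>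
        mem_sup_shiftSet_of_mul_mem hE (ih _ hlt0 _ rfl S (fun j hj => hS0 j hj _) _
          (isUpperSet_sliceSet hE i) (sliceSet_bound hb) (x i)
          (hx.notMem _ _ (by simp [hiS])))
      -- Modulo `x i` only the slice remains, so `r` lies in the right ideal up to a multiple `x i *
      -- r'`. Then `x i` is cancelled, and `r'` is treated with the shifted set, whose bound is
      -- smaller by one at `i`.
      have h1 : r ∈ Ideal.span (x '' insert i S) ⊔ monIdeal x (sliceSet E i) := by
        refine ih _ hlt0 _ rfl (insert i S) ?_ _ (isUpperSet_sliceSet hE i) (sliceSet_bound hb) f ?_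
          r (sup_le_sup_insert_sliceSet i hr)
        · rintro j (rfl | hj)
          · simp
          · exact hS0 j hj _
        · rwa [support_update_zero b i S hi]
      obtain ⟨s, hs, m, hm, r', rfl⟩ := exists_of_mem_sup_insert h1
      have hm' := monIdeal_mono (sliceSet_subset hE i) hm
      have hsm := Submodule.add_mem_sup hs hm'
      have h2 : x i * (f * r') ∈ Ideal.span (x '' S) ⊔ monIdeal x E := by
        have : x i * (f * r') = f * (s + m + x i * r') - f * (s + m) := by ring
        rw [this]
        exact Ideal.sub_mem _ hr (Ideal.mul_mem_left _ _ hsm)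
      have h3 := ih _ hlt1 _ rfl S (fun j hj => hS0 j hj _) _ (isUpperSet_shiftSet hE i)
        (shiftSet_bound hi hb) f (fun h => hf (Ideal.span_mono (Set.image_mono
          (Set.union_subset_union_right S fun j hj => ?_)) h)) r' (hcolon _ h2)
      · refine Ideal.add_mem _ hsm ?_
        obtain ⟨t, ht, n, hn, rfl⟩ := Submodule.mem_sup.1 h3
        rw [mul_add]
        exact Submodule.add_mem_sup (Ideal.mul_mem_left _ _ ht)
          (mul_mem_monIdeal_of_mem_shiftSet hn)
      · by_cases hj' : j = i
        · subst hj'; exact hi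
        · simpa [hj'] using hj

theorem IsPrimeFamily.mem_sup_shiftSet (hx : IsPrimeFamily x) {b : ι → ℕ} {S : Set ι}
    (hS : ∀ i ∈ S, b i = 0) {E : Set (ι → ℕ)} (hE : IsUpperSet E) (hb : ∀ e ∈ E, e ⊓ b ∈ E)
    {i : ι} (hi : i ∉ S) {z : R} (hz : x i * z ∈ Ideal.span (x '' S) ⊔ monIdeal x E) :
    z ∈ Ideal.span (x '' S) ⊔ monIdeal x (shiftSet E i) := by
  refine mem_sup_shiftSet_of_mul_mem hE (hx.mem_of_mul_mem_aux _ _ rfl S ?_ _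
    (isUpperSet_sliceSet hE i) (sliceSet_bound hb) (x i) (hx.notMem _ _ (by simp [hi]))) hz
  intro j hj
  rw [Function.update_of_ne (by rintro rfl; exact hi hj), hS j hj]

/-- The same induction, run for `E` and `F` with a common bound. Modulo `x i` the element lies in
both slices, hence in their intersection; the remaining multiple of `x i` has its cofactor in both
shifts. Slice and shift commute with intersection of exponent sets. -/
theorem IsPrimeFamily.mem_inter_aux (hx : IsPrimeFamily x) (N : ℕ) :
    ∀ (b : ι → ℕ), ∑ j, b j = N → ∀ (S : Set ι), (∀ i ∈ S, b i = 0) →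
    ∀ (E F : Set (ι → ℕ)), IsUpperSet E → IsUpperSet F → (∀ e ∈ E, e ⊓ b ∈ E) →
    (∀ e ∈ F, e ⊓ b ∈ F) → ∀ r, r ∈ Ideal.span (x '' S) ⊔ monIdeal x E →
      r ∈ Ideal.span (x '' S) ⊔ monIdeal x F → r ∈ Ideal.span (x '' S) ⊔ monIdeal x (E ∩ F) := by
  induction N using Nat.strong_induction_on with
  | _ N ih =>
    intro b hbN S hS E F hE hF hbE hbF r hrE hrF
    by_cases hb0 : b = 0
    · rcases E.eq_empty_or_nonempty with h | ⟨e, he⟩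
      · subst h; simpa using hrE
      · rcases F.eq_empty_or_nonempty with h | ⟨f, hf⟩
        · subst h; simpa using hrF
        · have h0 : (0 : ι → ℕ) ∈ E ∩ F := by
            constructor
            · convert hbE e he; ext j; simp [hb0]
            · convert hbF f hf; ext j; simp [hb0]
          have : monIdeal x (E ∩ F) = ⊤ :=
            (Ideal.eq_top_iff_one _).2 (mon_zero (x := x) ▸ mon_mem_monIdeal h0)
          simp [this]
    · obtain ⟨i, hi⟩ := Function.ne_iff.1 hb0
      have hi : b i ≠ 0 := hi
      have hlt0 : ∑ j, Function.update b i 0 j < N := hbN ▸ sum_update_lt (Nat.pos_of_ne_zero hi)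
      have hlt1 : ∑ j, Function.update b i (b i - 1) j < N := hbN ▸ sum_update_lt (by omega)
      have hiS : i ∉ S := fun h => hi (hS i h)
      have hS0 : ∀ j ∈ S, ∀ k, Function.update b i k j = 0 := fun j hj k => by
        rw [Function.update_of_ne (by rintro rfl; exact hiS hj), hS j hj]
      have h1 := ih _ hlt0 _ rfl (insert i S) (by
          rintro j (rfl | hj)
          · simp
          · exact hS0 j hj _) _ _ (isUpperSet_sliceSet hE i) (isUpperSet_sliceSet hF i)
        (sliceSet_bound hbE) (sliceSet_bound hbF) r (sup_le_sup_insert_sliceSet i hrE)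
        (sup_le_sup_insert_sliceSet i hrF)
      obtain ⟨s, hs, m, hm, r', rfl⟩ := exists_of_mem_sup_insert h1
      have hm' : m ∈ monIdeal x (E ∩ F) :=
        monIdeal_mono (Set.inter_subset_inter (sliceSet_subset hE i) (sliceSet_subset hF i)) hm
      have hsm := Submodule.add_mem_sup hs hm'
      have key : ∀ G, IsUpperSet G → (∀ e ∈ G, e ⊓ b ∈ G) → E ∩ F ⊆ G →
          s + m + x i * r' ∈ Ideal.span (x '' S) ⊔ monIdeal x G →
          r' ∈ Ideal.span (x '' S) ⊔ monIdeal x (shiftSet G i) := fun G hG hbG hEFG h =>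
        hx.mem_sup_shiftSet hS hG hbG hiS ((Ideal.add_mem_iff_right _
          ((sup_le_sup_left (monIdeal_mono hEFG) (Ideal.span (x '' S)) : _ ≤ Ideal.span (x '' S) ⊔ monIdeal x G) hsm)).1 h)
      have h3 := ih _ hlt1 _ rfl S (fun j hj => hS0 j hj _) _ _ (isUpperSet_shiftSet hE i)
        (isUpperSet_shiftSet hF i) (shiftSet_bound hi hbE) (shiftSet_bound hi hbF) r'
        (key E hE hbE Set.inter_subset_left hrE) (key F hF hbF Set.inter_subset_right hrF)
      refine Ideal.add_mem _ hsm ?_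
      obtain ⟨t, ht, n, hn, rfl⟩ := Submodule.mem_sup.1 h3
      rw [mul_add]
      exact Submodule.add_mem_sup (Ideal.mul_mem_left _ _ ht) (mul_mem_monIdeal_of_mem_shiftSet hn)

theorem IsPrimeFamily.mem_shiftSet (hx : IsPrimeFamily x) {E : Set (ι → ℕ)} (hE : IsUpperSet E)
    {i : ι} {z : R} (hz : x i * z ∈ monIdeal x E) : z ∈ monIdeal x (shiftSet E i) := by
  obtain ⟨b, hb⟩ := exists_bound_of_isUpperSet hE
  have := hx.mem_sup_shiftSet (b := b) (S := ∅) (by simp) hE hb (i := i) (by simp) (z := z)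
  simpa using this (by simpa using hz)

omit [DecidableEq ι] in
theorem IsPrimeFamily.monIdeal_inf (hx : IsPrimeFamily x) {E F : Set (ι → ℕ)} (hE : IsUpperSet E)
    (hF : IsUpperSet F) : monIdeal x E ⊓ monIdeal x F = monIdeal x (E ∩ F) := by
  classical
  refine le_antisymm (fun r hr => ?_) (le_inf (monIdeal_mono Set.inter_subset_left)
    (monIdeal_mono Set.inter_subset_right))
  obtain ⟨b, hb⟩ := exists_bound_of_isUpperSet hE
  obtain ⟨c, hc⟩ := exists_bound_of_isUpperSet hF
  have := hx.mem_inter_aux _ (b ⊔ c) rfl ∅ (by simp) E F hE hF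
    (fun e he => hE (inf_le_inf_left _ le_sup_left) (hb e he))
    (fun e he => hF (inf_le_inf_left _ le_sup_right) (hc e he)) r
  simpa using this (by simpa using hr.1) (by simpa using hr.2)

omit [DecidableEq ι] in
theorem IsPrimeFamily.iInf_monIdeal (hx : IsPrimeFamily x) {α : Type*} (s : Finset α)
    (E : α → Set (ι → ℕ)) (hE : ∀ a, IsUpperSet (E a)) :
    ⨅ a ∈ s, monIdeal x (E a) = monIdeal x (⋂ a ∈ s, E a) := by
  classical
  induction s using Finset.induction_on with
  | empty =>
    have : monIdeal x Set.univ = ⊤ :=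
      (Ideal.eq_top_iff_one _).2 (mon_zero (x := x) ▸ mon_mem_monIdeal (Set.mem_univ _))
    simp [this]
  | insert a s ha ih =>
    rw [Finset.iInf_insert, ih, hx.monIdeal_inf (hE a) (isUpperSet_iInter₂ fun a _ => hE a),
      Finset.set_biInter_insert]

-- Cancels the variables of `mon x e` one by one, shifting `E` each time, down to exponent 0. If 0
-- is then not in the shifted set, the ideal lies in the ideal of all the variables, which excludes
-- `c`.
omit [DecidableEq ι] in
theorem IsPrimeFamily.mem_of_mul_mon_mem (hx : IsPrimeFamily x) {E : Set (ι → ℕ)}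
    (hE : IsUpperSet E) {e : ι → ℕ} {c : R} (hc : c ∉ Ideal.span (Set.range x))
    (h : c * mon x e ∈ monIdeal x E) : e ∈ E := by
  classical
  induction hn : ∑ j, e j generalizing e E with
  | zero =>
    have he : e = 0 := by ext j; simpa using (Finset.sum_eq_zero_iff.1 hn) j
    subst he
    by_contra h0
    rw [mon_zero, mul_one] at h
    refine hc ((monIdeal_le_iff.2 fun f hf => ?_ : monIdeal x E ≤ _) h)
    obtain ⟨i, hi⟩ : ∃ i, f i ≠ 0 := by
      by_contra! h'
      exact h0 (by convert hf; ext j; simp [h'])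
    exact Ideal.mem_of_dvd _ ((dvd_pow_self _ hi).trans
      (Finset.dvd_prod_of_mem _ (Finset.mem_univ i))) (Ideal.subset_span ⟨i, rfl⟩)
  | succ n ih =>
    obtain ⟨i, hi⟩ : ∃ i, e i ≠ 0 := by
      by_contra! h'
      simp [h'] at hn
    have h1 : Function.update e i (e i - 1) + Pi.single i 1 = e := by
      ext j
      by_cases hj : j = i
      · subst hj; simp; omega
      · simp [hj]
    have h2 := @ih (shiftSet E i) (isUpperSet_shiftSet hE i) (Function.update e i (e i - 1)) ?_ ?_
    · rwa [shiftSet, Set.mem_ofPred_eq, h1] at h2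
    · refine hx.mem_shiftSet hE ?_
      rw [← h1, mon_add, mon_single, pow_one] at h
      convert h using 1; ring
    · have := congrArg (fun e : ι → ℕ => ∑ j, e j) h1
      simp [Finset.sum_add_distrib] at this
      omega

end MonomialIdeals

/-! ### Regular local rings and parts of regular systems of parameters -/

section RegularLocal

open IsLocalRing

universe u

variable {A : Type u} [CommRing A]

/-- The elements of `s` are linearly independent in the cotangent space. -/
def CotangentIndep [IsLocalRing A] (s : Set (maximalIdeal A)) : Prop :=
  LinearIndepOn (ResidueField A) (M := CotangentSpace A) (maximalIdeal A).toCotangent s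

theorem CotangentIndep.finite [IsLocalRing A] [IsNoetherianRing A] {s : Set (maximalIdeal A)}
    (hs : CotangentIndep s) : s.Finite :=
  Set.finite_coe_iff.1 (LinearIndependent.finite (R := ResidueField A) (M := CotangentSpace A) hs)

theorem CotangentIndep.mono [IsLocalRing A] {s t : Set (maximalIdeal A)}
    (ht : CotangentIndep t) (h : s ⊆ t) : CotangentIndep s := LinearIndepOn.mono ht h

theorem exists_cotangentIndep_extension [IsLocalRing A] [IsNoetherianRing A]
    {s t : Set (maximalIdeal A)} (hs : CotangentIndep s) (hst : s ⊆ t) :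
    ∃ b ⊆ t, s ⊆ b ∧ CotangentIndep b ∧ (maximalIdeal A).toCotangent '' t ⊆
      (Submodule.span (ResidueField A) (M := CotangentSpace A)
        ((maximalIdeal A).toCotangent '' b) : Set (CotangentSpace A)) := by
  obtain ⟨b, h1, h2, h3, h4⟩ := exists_linearIndepOn_extension hs hst
  exact ⟨b, h1, h2, h4, h3⟩

theorem ideal_span_eq_maximalIdeal [IsLocalRing A] [IsNoetherianRing A] {b : Set (maximalIdeal A)}
    (hb : Submodule.span (ResidueField A) (M := CotangentSpace A)
      ((maximalIdeal A).toCotangent '' b) = ⊤) :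
    Ideal.span (Subtype.val '' b) = maximalIdeal A := by
  rw [CotangentSpace.span_image_eq_top_iff] at hb
  have := congrArg (Submodule.map (maximalIdeal A).subtype) hb
  rwa [Submodule.map_span, Submodule.map_top, Submodule.range_subtype] at this

theorem ideal_span_val_le [IsLocalRing A] (s : Set (maximalIdeal A)) :
    Ideal.span (Subtype.val '' s) ≤ maximalIdeal A := by
  rw [Ideal.span_le]; rintro _ ⟨a, -, rfl⟩; exact a.2

theorem CotangentIndep.ncard_basis [IsLocalRing A] [IsNoetherianRing A]
    {b : Set (maximalIdeal A)} (hb : CotangentIndep b)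
    (hb' : Submodule.span (ResidueField A) (M := CotangentSpace A)
      ((maximalIdeal A).toCotangent '' b) = ⊤) :
    b.ncard = (maximalIdeal A).spanFinrank := by
  rw [spanFinrank_maximalIdeal_eq_finrank_cotangentSpace]
  let B := Module.Basis.mk hb (by rw [← Set.image_eq_range, hb'])
  rw [Module.finrank_eq_nat_card_basis B]
  rfl

theorem CotangentIndep.exists_basis [IsLocalRing A] [IsNoetherianRing A]
    {s : Set (maximalIdeal A)} (hs : CotangentIndep s) :
    ∃ b, s ⊆ b ∧ b.ncard = (maximalIdeal A).spanFinrank ∧ b.Finite ∧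
      Ideal.span (Subtype.val '' b) = maximalIdeal A := by
  obtain ⟨b, -, h1, h2, h3⟩ := exists_cotangentIndep_extension hs (Set.subset_univ s)
  have h4 : Submodule.span (ResidueField A) (M := CotangentSpace A)
      ((maximalIdeal A).toCotangent '' b) = ⊤ := by
    rw [eq_top_iff]
    intro z _
    obtain ⟨y, rfl⟩ := (maximalIdeal A).toCotangent_surjective z
    exact h3 ⟨y, Set.mem_univ _, rfl⟩
  exact ⟨b, h1, h2.ncard_basis h4, h2.finite, ideal_span_eq_maximalIdeal h4⟩

instance isLocalRing_quotient [IsLocalRing A] (s : Set (maximalIdeal A)) :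
    IsLocalRing (A ⧸ Ideal.span (Subtype.val '' s : Set A)) := by
  have : Nontrivial (A ⧸ Ideal.span (Subtype.val '' s : Set A)) :=
    Ideal.Quotient.nontrivial_iff.2 fun h =>
      Ideal.IsPrime.ne_top' (top_le_iff.1 (h ▸ ideal_span_val_le s))
  exact IsLocalRing.of_surjective' (Ideal.Quotient.mk _) Ideal.Quotient.mk_surjective

/-- The quotient of a regular local ring by part of a regular system of parameters is regular. -/
theorem CotangentIndep.isRegularLocalRing_quotient [IsRegularLocalRing A]
    {s : Set (maximalIdeal A)} (hs : CotangentIndep s) :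
    IsRegularLocalRing (A ⧸ Ideal.span (Subtype.val '' s)) ∧
      (maximalIdeal (A ⧸ Ideal.span (Subtype.val '' s))).spanFinrank + s.ncard =
        (maximalIdeal A).spanFinrank := by
  obtain ⟨b, hsb, hcard, hfin, hspan⟩ := hs.exists_basis
  have hfin' := hfin.subset hsb
  set I := Ideal.span (Subtype.val '' s : Set A)
  have hmax : maximalIdeal (A ⧸ I) = Ideal.span ((fun a => Ideal.Quotient.mk I a.1) '' (b \ s)) := by
    rw [← IsLocalRing.map_maximalIdeal_of_surjective (Ideal.Quotient.mk I)
      Ideal.Quotient.mk_surjective, show Ideal.map (Ideal.Quotient.mk I) (maximalIdeal A) =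
        Ideal.map (Ideal.Quotient.mk I) (Ideal.span (Subtype.val '' b)) by rw [hspan],
      Ideal.map_span]
    refine le_antisymm (Ideal.span_le.2 ?_) (Ideal.span_mono ?_)
    · rintro _ ⟨_, ⟨a, ha, rfl⟩, rfl⟩
      by_cases has : a ∈ s
      · have h0 : (a : A) ∈ I := Ideal.subset_span ⟨a, has, rfl⟩
        rw [Ideal.Quotient.eq_zero_iff_mem.2 h0]
        exact zero_mem _
      · exact Ideal.subset_span (Set.mem_image_of_mem _ (Set.mem_sdiff _ |>.2 ⟨ha, has⟩))
    · rintro _ ⟨a, ha, rfl⟩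
      exact ⟨_, ⟨a, ha.1, rfl⟩, rfl⟩
  -- The basis elements outside `s` still generate the maximal ideal of the quotient, which bounds
  -- its embedding dimension from above. The dimension drops by at most the number of elements of
  -- `s`, so it meets this bound.
  have hle : (maximalIdeal (A ⧸ I)).spanFinrank + s.ncard ≤ (maximalIdeal A).spanFinrank := by
    rw [hmax, ← hcard, ← Set.ncard_sdiff_add_ncard_of_subset hsb hfin]
    gcongr
    exact (Submodule.spanFinrank_span_le_ncard_of_finite ((hfin.sdiff).image _)).trans
      (Set.ncard_image_le hfin.sdiff)
  have hdim := ringKrullDim_le_ringKrullDim_quotient_add_encard (Subtype.val '' s : Set A) (by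
    rw [IsLocalRing.ringJacobson_eq_maximalIdeal]
    rintro _ ⟨a, -, rfl⟩; exact a.2)
  rw [← IsRegularLocalRing.spanFinrank_maximalIdeal, Subtype.val_injective.encard_image,
    ← hfin'.cast_ncard_eq] at hdim
  have hdim2 := ringKrullDim_le_spanFinrank_maximalIdeal (A ⧸ I)
  have h3 : ((maximalIdeal A).spanFinrank : WithBot ℕ∞) ≤
      ((maximalIdeal (A ⧸ I)).spanFinrank : WithBot ℕ∞) + (s.ncard : ℕ) :=
    hdim.trans (by gcongr; rfl)
  have h4 : (maximalIdeal A).spanFinrank ≤ (maximalIdeal (A ⧸ I)).spanFinrank + s.ncard := by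
    exact_mod_cast h3
  have h5 := le_antisymm hle h4
  refine ⟨IsRegularLocalRing.of_spanFinrank_maximalIdeal_le _ ?_, h5⟩
  rw [← h5] at hdim
  generalize ringKrullDim (A ⧸ I) = D at hdim
  induction D using WithBot.recBotCoe with
  | bot => simp at hdim
  | coe D =>
    induction D using ENat.recTopCoe with
    | top => exact le_top
    | coe D =>
      have h6 : (maximalIdeal (A ⧸ I)).spanFinrank + s.ncard ≤ D + s.ncard := by exact_mod_cast hdim
      exact_mod_cast Nat.le_of_add_le_add_right h6

/-- Prime avoidance gives f in the maximal ideal, outside its square and outside all minimal primes.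
By induction A/(f) is a domain, so (f) contains a minimal prime q. Since f is not in q, every
element of q is f times an element of q, and q = 0 by Nakayama. -/
theorem isDomain_of_isRegularLocalRing_aux (n : ℕ) :
    ∀ (A : Type u) [CommRing A] [IsRegularLocalRing A], (maximalIdeal A).spanFinrank = n →
      IsDomain A := by
  induction n with
  | zero =>
    intro A _ _ h
    rw [Submodule.spanFinrank_eq_zero_iff_eq_bot (IsNoetherian.noetherian _)] at h
    exact (IsLocalRing.isField_iff_maximalIdeal_eq.2 h).isDomain
  | succ n ih =>
    intro A _ _ h
    have hnot : ∀ p ∈ minimalPrimes A, ¬ maximalIdeal A ≤ p := by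
      intro p hp hle
      have hpp : p.IsPrime := hp.1.1
      have := le_antisymm hle (le_maximalIdeal hpp.ne_top)
      have h0 := Ideal.height_eq_zero_iff.2 hp
      have h1 := IsLocalRing.maximalIdeal_height_eq_ringKrullDim (R := A)
      rw [this, h0, ← IsRegularLocalRing.spanFinrank_maximalIdeal, h] at h1
      norm_cast at h1
    have hsq : ¬ maximalIdeal A ≤ maximalIdeal A ^ 2 := by
      intro hle
      have := Submodule.eq_bot_of_le_smul_of_le_jacobson_bot (maximalIdeal A) (maximalIdeal A)
        (IsNoetherian.noetherian _) (by rwa [smul_eq_mul, ← pow_two])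
        (IsLocalRing.maximalIdeal_le_jacobson _)
      rw [this, Submodule.spanFinrank_bot] at h
      omega
    obtain ⟨f, hfm, hf⟩ : ∃ f ∈ maximalIdeal A, f ∉ maximalIdeal A ^ 2 ∧
        ∀ p ∈ minimalPrimes A, f ∉ p := by
      by_contra! hcon
      have hfin : (insert (maximalIdeal A ^ 2) (minimalPrimes A)).Finite :=
        (minimalPrimes.finite_of_isNoetherianRing A).insert _
      -- Prime avoidance tolerates two non-prime members; both exceptional slots are given to the
      -- square of the maximal ideal.
      have := (Ideal.subset_union_prime_finite hfin (f := id) (maximalIdeal A ^ 2)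
        (maximalIdeal A ^ 2) (I := maximalIdeal A) (by
          rintro p (rfl | hp) h1 h2
          · exact absurd rfl h1
          · exact hp.1.1)).1 (by
          intro f hf
          by_cases h2 : f ∈ maximalIdeal A ^ 2
          · exact Set.mem_biUnion (Set.mem_insert _ _) h2
          · obtain ⟨p, hp, hfp⟩ := hcon f hf h2
            exact Set.mem_biUnion (Set.mem_insert_of_mem _ hp) hfp)
      obtain ⟨p, rfl | hp, hle⟩ := this
      · exact hsq hle
      · exact hnot p hp hle
    have hdomk : IsDomain (ResidueField A) := Field.isDomain
    have htf : Module.IsTorsionFree (ResidueField A) (CotangentSpace A) := inferInstance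
    have hind : CotangentIndep ({⟨f, hfm⟩} : Set (maximalIdeal A)) := by
      refine LinearIndepOn.singleton (R := ResidueField A) (M := CotangentSpace A) ?_
      intro h0
      exact hf.1 (((maximalIdeal A).toCotangent_eq_zero ⟨f, hfm⟩).1 h0)
    obtain ⟨hreg, hcard⟩ := hind.isRegularLocalRing_quotient
    rw [h, Set.ncard_singleton] at hcard
    have hdom := ih _ (Nat.succ_injective hcard)
    rw [Set.image_singleton, Ideal.Quotient.isDomain_iff_prime] at hdom
    obtain ⟨q, hq, hqf⟩ := Ideal.exists_minimalPrimes_le (bot_le (a := Ideal.span {f}))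
    have hqp : q.IsPrime := hq.1.1
    have hfq : f ∉ q := hf.2 q hq
    have : q = ⊥ := by
      refine Submodule.eq_bot_of_le_smul_of_le_jacobson_bot (maximalIdeal A) q
        (IsNoetherian.noetherian _) (fun y hy => ?_) (IsLocalRing.maximalIdeal_le_jacobson _)
      obtain ⟨z, rfl⟩ := Ideal.mem_span_singleton.1 (hqf hy)
      exact Submodule.smul_mem_smul hfm ((hqp.mem_or_mem hy).resolve_left hfq)
    rw [this] at hqp
    exact IsDomain.of_bot_isPrime A

theorem isDomain_of_isRegularLocalRing [IsRegularLocalRing A] : IsDomain A :=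
  isDomain_of_isRegularLocalRing_aux _ A rfl

theorem CotangentIndep.isPrime [IsRegularLocalRing A] {s : Set (maximalIdeal A)}
    (hs : CotangentIndep s) : (Ideal.span (Subtype.val '' s : Set A)).IsPrime := by
  have := hs.isRegularLocalRing_quotient.1
  rw [← Ideal.Quotient.isDomain_iff_prime]
  exact isDomain_of_isRegularLocalRing

theorem CotangentIndep.notMem [IsLocalRing A] {s : Set (maximalIdeal A)} {a : maximalIdeal A}
    (hs : CotangentIndep (insert a s)) (ha : a ∉ s) : (a : A) ∉ Ideal.span (Subtype.val '' s) := by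
  intro h
  have h1 : a ∈ Submodule.span A s := by
    have : (a : A) ∈ Submodule.map (maximalIdeal A).subtype (Submodule.span A s) := by
      rwa [Submodule.map_span]
    obtain ⟨b, hb, hba⟩ := this
    rwa [Subtype.ext hba] at hb
  have h2 : (maximalIdeal A).toCotangent a ∈ Submodule.span (ResidueField A) (M := CotangentSpace A)
      ((maximalIdeal A).toCotangent '' s) := by
    have h3 := Submodule.mem_map_of_mem (f := (maximalIdeal A).toCotangent) h1
    rw [Submodule.map_span] at h3
    exact Submodule.span_subset_span A (ResidueField A) _ h3
  exact (linearIndepOn_insert ha).1 hs |>.2 h2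

/-- Adding the elements one at a time gives a strictly increasing chain of primes, since each
partial ideal is prime and misses the next element. -/
theorem CotangentIndep.ncard_le_height [IsRegularLocalRing A] {s : Set (maximalIdeal A)}
    (hs : CotangentIndep s) : (s.ncard : ℕ∞) ≤ (Ideal.span (Subtype.val '' s : Set A)).height := by
  induction s, hs.finite using Set.Finite.induction_on with
  | empty => simp
  | @insert a s has hfin ih =>
    have h1 := hs.mono (Set.subset_insert a s)
    have hp := h1.isPrime
    have hp' := hs.isPrime
    have hlt : Ideal.span (Subtype.val '' s : Set A) < Ideal.span (Subtype.val '' insert a s) := by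
      refine lt_of_le_of_ne (Ideal.span_mono (Set.image_mono (Set.subset_insert _ _))) fun h => ?_
      exact hs.notMem has (h ▸ Ideal.subset_span ⟨a, Set.mem_insert _ _, rfl⟩)
    rw [Set.ncard_insert_of_notMem has hfin]
    push_cast
    exact (add_le_add_left (ih h1) 1).trans (Ideal.height_add_one_le_of_lt_of_isPrime hlt)

/-- A prime ideal `Q` of a regular local ring such that the maximal ideal is generated by `Q` and
one more element is generated by part of a regular system of parameters, which can be chosen to
contain given independent elements of `Q`. -/
theorem CotangentIndep.exists_span_eq [IsRegularLocalRing A] {Q : Ideal A} (hQ : Q.IsPrime)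
    (hne : Q ≠ maximalIdeal A) {t : A} (ht : t ∈ maximalIdeal A)
    (hQt : maximalIdeal A ≤ Q ⊔ Ideal.span {t}) {s : Set (maximalIdeal A)} (hs : CotangentIndep s)
    (hsQ : ∀ a ∈ s, (a : A) ∈ Q) :
    ∃ b, s ⊆ b ∧ CotangentIndep b ∧ Ideal.span (Subtype.val '' b) = Q := by
  -- Take `b` maximal independent among the elements of `Q`. Modulo `b` the ring is a regular domain
  -- whose maximal ideal is generated by `t`, hence of height at most one. If `b` did not generate
  -- `Q`, the image of `Q` would lie strictly between zero and the maximal ideal.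
  obtain ⟨b, hbQ, hsb, hb, hspan⟩ :=
    exists_cotangentIndep_extension (t := {a : maximalIdeal A | (a : A) ∈ Q}) hs hsQ
  refine ⟨b, hsb, hb, ?_⟩
  have hbQ' : Ideal.span (Subtype.val '' b) ≤ Q := by
    rw [Ideal.span_le]; rintro _ ⟨a, ha, rfl⟩; exact hbQ ha
  by_contra hneq
  have hp := hb.isPrime
  set I := Ideal.span (Subtype.val '' b : Set A) with hI
  obtain ⟨hreg, hcard⟩ := hb.isRegularLocalRing_quotient
  have hQ' : Q ≤ maximalIdeal A := le_maximalIdeal hQ.ne_top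
  -- the maximal ideal is generated by `b` and `t`
  have hgen : maximalIdeal A ≤ I ⊔ Ideal.span {t} := by
    have h1 : Ideal.span (Subtype.val '' (insert ⟨t, ht⟩ b : Set (maximalIdeal A))) =
        maximalIdeal A := by
      apply ideal_span_eq_maximalIdeal
      rw [eq_top_iff]
      intro z _
      obtain ⟨y, rfl⟩ := (maximalIdeal A).toCotangent_surjective z
      obtain ⟨q, hq, r, hr, hqr⟩ := Submodule.mem_sup.1 (hQt y.2)
      obtain ⟨c, rfl⟩ := Ideal.mem_span_singleton.1 hr
      have hy : y = ⟨q, hQ' hq⟩ + c • (⟨t, ht⟩ : maximalIdeal A) := by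
        ext; simp [← hqr, mul_comm]
      rw [hy, map_add, map_smul]
      refine Submodule.add_mem _ ?_ ?_
      · exact Submodule.span_mono (Set.image_mono (Set.subset_insert _ _))
          (hspan ⟨⟨q, hQ' hq⟩, hq, rfl⟩)
      · exact Submodule.span_subset_span A (ResidueField A) _
          (Submodule.smul_mem _ _ (Submodule.subset_span ⟨_, Set.mem_insert _ _, rfl⟩))
    rw [← h1, Ideal.span_le]
    rintro _ ⟨a, ha | ha, rfl⟩
    · rw [ha]; exact Ideal.mem_sup_right (Ideal.mem_span_singleton_self _)
    · exact Ideal.mem_sup_left (Ideal.subset_span ⟨a, ha, rfl⟩)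
  have hmax : maximalIdeal (A ⧸ I) = Ideal.span {Ideal.Quotient.mk I t} := by
    rw [← IsLocalRing.map_maximalIdeal_of_surjective (Ideal.Quotient.mk I)
      Ideal.Quotient.mk_surjective]
    refine le_antisymm ((Ideal.map_mono hgen).trans ?_) ?_
    · rw [Ideal.map_sup, Ideal.map_quotient_self, bot_sup_eq, Ideal.map_span, Set.image_singleton]
    · rw [Ideal.span_singleton_le_iff_mem]; exact Ideal.mem_map_of_mem _ ht
  have hht : (maximalIdeal (A ⧸ I)).height ≤ 1 := by
    have := Ideal.height_le_spanFinrank (maximalIdeal (A ⧸ I)) Ideal.IsPrime.ne_top'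
    refine this.trans ?_
    rw [hmax]
    exact_mod_cast (Submodule.spanFinrank_span_le_ncard_of_finite (Set.finite_singleton _)).trans
      (Set.ncard_singleton _).le
  have hker : RingHom.ker (Ideal.Quotient.mk I) ≤ Q := by rwa [Ideal.mk_ker]
  have hQp : (Q.map (Ideal.Quotient.mk I)).IsPrime :=
    Ideal.map_isPrime_of_surjective Ideal.Quotient.mk_surjective hker
  have hdom : IsDomain (A ⧸ I) := isDomain_of_isRegularLocalRing
  have hcomap : (Q.map (Ideal.Quotient.mk I)).comap (Ideal.Quotient.mk I) = Q := by
    rw [Ideal.comap_map_of_surjective' _ Ideal.Quotient.mk_surjective, Ideal.mk_ker]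
    exact sup_eq_left.2 hbQ'
  have h1 : (⊥ : Ideal (A ⧸ I)) < Q.map (Ideal.Quotient.mk I) := by
    rw [bot_lt_iff_ne_bot, Ne, Ideal.map_eq_bot_iff_le_ker, Ideal.mk_ker]
    exact fun h => hneq (le_antisymm hbQ' h)
  have h2 : Q.map (Ideal.Quotient.mk I) < maximalIdeal (A ⧸ I) := by
    refine lt_of_le_of_ne (le_maximalIdeal hQp.ne_top) fun h => hne ?_
    refine le_antisymm hQ' fun a ha => ?_
    rw [← hcomap, h, Ideal.mem_comap, ← IsLocalRing.map_maximalIdeal_of_surjective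
      (Ideal.Quotient.mk I) Ideal.Quotient.mk_surjective]
    exact Ideal.mem_map_of_mem _ ha
  have h3 := Ideal.height_add_one_le_of_lt_of_isPrime h1
  have h4 := Ideal.height_add_one_le_of_lt_of_isPrime h2
  rw [Ideal.height_bot, zero_add] at h3
  have h5 := ((add_le_add_left h3 1).trans h4).trans hht
  norm_num at h5

end RegularLocal

/-! ### The zeroth Fitting ideal -/

section Fitting

variable {A M : Type*} [CommRing A] [AddCommGroup M] [Module A M]

/-- The determinant of a square matrix of relations between generators lies in the Fitting ideal. -/
theorem det_mem_fittingIdealZero {ι : Type*} [Fintype ι] [DecidableEq ι] (m : ι → M)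
    (hm : Submodule.span A (Set.range m) = ⊤) (P : Matrix ι ι A)
    (hP : ∀ i, ∑ j, P i j • m j = 0) : P.det ∈ fittingIdealZero A M := by
  let e := Fintype.equivFin ι
  refine Ideal.subset_span ⟨Fintype.card ι, m ∘ e.symm, P.submatrix e.symm e.symm, ?_, ?_, ?_⟩
  · rw [e.symm.surjective.range_comp, hm]
  · intro i
    rw [← hP (e.symm i), ← e.symm.sum_comp]
    rfl
  · rw [Matrix.det_submatrix_equiv_self]

/-- If the relations between a generating family are generated by the rows of a square matrix, then
the Fitting ideal is contained in the ideal generated by its determinant. -/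
theorem fittingIdealZero_le_span_det {ι : Type*} [Fintype ι] [DecidableEq ι] (e : ι → M)
    (he : Submodule.span A (Set.range e) = ⊤) (D : Matrix ι ι A)
    (hD : ∀ r : ι → A, ∑ j, r j • e j = 0 → ∃ s : ι → A, Matrix.vecMul s D = r) :
    fittingIdealZero A M ≤ Ideal.span {D.det} := by
  rw [fittingIdealZero, Ideal.span_le]
  rintro _ ⟨n, m, P, hm, hP, rfl⟩
  have hB : ∀ l, ∃ b : ι → A, ∑ j, b j • e j = m l := fun l => by
    have : m l ∈ Submodule.span A (Set.range e) := he ▸ Submodule.mem_top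
    exact (Submodule.mem_span_range_iff_exists_fun A).1 this
  have hC : ∀ j, ∃ c : Fin n → A, ∑ l, c l • m l = e j := fun j => by
    have : e j ∈ Submodule.span A (Set.range m) := hm ▸ Submodule.mem_top
    exact (Submodule.mem_span_range_iff_exists_fun A).1 this
  choose B hB using hB
  choose C hC using hC
  have h1 : ∀ {κ : Type} [Fintype κ] (Q : κ → Fin n → A) (i : κ),
      ∑ j, (∑ l, Q i l * B l j) • e j = ∑ l, Q i l • m l := by
    intro κ _ Q i
    simp_rw [Finset.sum_smul, mul_smul]
    rw [Finset.sum_comm]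
    simp_rw [← Finset.smul_sum, hB]
  have hX : ∀ i, ∃ s, Matrix.vecMul s D = fun j => ∑ l, P i l * B l j := fun i =>
    hD _ (by rw [h1 P i, hP i])
  have hY : ∀ i, ∃ s, Matrix.vecMul s D =
      fun j => ∑ l, C i l * B l j - (1 : Matrix ι ι A) i j := fun i => by
    refine hD _ ?_
    simp_rw [sub_smul, Finset.sum_sub_distrib]
    have h2 : ∑ j, (∑ l, C i l * B l j) • e j = ∑ l, C i l • m l := by
      simp_rw [Finset.sum_smul, mul_smul]
      rw [Finset.sum_comm]
      simp_rw [← Finset.smul_sum, hB]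
    rw [h2, hC]
    simp [Matrix.one_apply]
  choose X hX using hX
  choose Y hY using hY
  let B' : Matrix (Fin n) ι A := Matrix.of B
  let C' : Matrix ι (Fin n) A := Matrix.of C
  let X' : Matrix (Fin n) ι A := Matrix.of X
  let Y' : Matrix ι ι A := Matrix.of Y
  have hX' : X' * D = P * B' := by
    ext i j
    exact congrFun (hX i) j
  have hY' : Y' * D = C' * B' - 1 := by
    ext i j
    exact congrFun (hY i) j
  -- `B'` and `C'` are the base changes between the two generating families. The rows of `P * B'`
  -- and `C' * B' - 1` are relations between the `e j`, hence combinations of rows of `D`. The block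
  -- identity turns this into a factorization of `P.det` through `D.det`, up to sign.
  have h3 : Matrix.fromBlocks P 0 C' (-1) * Matrix.fromBlocks 1 B' 0 1 =
      Matrix.fromBlocks P X' C' Y' * Matrix.fromBlocks 1 0 0 D := by
    simp [Matrix.fromBlocks_multiply, hX', hY', sub_eq_add_neg]
  have h4 := congrArg Matrix.det h3
  rw [Matrix.det_mul, Matrix.det_mul, Matrix.det_fromBlocks_zero₁₂, Matrix.det_fromBlocks_zero₂₁,
    Matrix.det_fromBlocks_zero₂₁, Matrix.det_neg] at h4
  simp only [Matrix.det_one, mul_one, one_mul] at h4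
  rw [SetLike.mem_coe, Ideal.mem_span_singleton]
  have h5 : P.det = (Matrix.fromBlocks P X' C' Y').det * (-1) ^ Fintype.card ι * D.det := by
    calc P.det = P.det * (-1) ^ Fintype.card ι * (-1) ^ Fintype.card ι := by
          rw [mul_assoc, ← mul_pow]; simp
      _ = _ := by rw [h4]; ring
  rw [h5]
  exact dvd_mul_left _ _

end Fitting

/-! ### Extending and descending derivations -/

section Derivations

variable {R S T N : Type*} [CommRing R] [CommRing S] [CommRing T] [Algebra R S] [Algebra R T]
  [Algebra S T] [IsScalarTower R S T] [AddCommGroup N] [Module R N] [Module S N] [Module T N]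
  [IsScalarTower R S N] [IsScalarTower R T N] [IsScalarTower S T N]

/-- Since `N` is a module over the localization, `M` acts on it invertibly, so the linear map
representing the derivation factors through the localized module of differentials. -/
theorem Derivation.exists_extension_of_isLocalization (M : Submonoid S) [IsLocalization M T]
    (D : Derivation R S N) :
    ∃ D' : Derivation R T N, ∀ s, D' (algebraMap S T s) = D s := by
  have hloc : IsLocalizedModule M (KaehlerDifferential.map R R S T) :=
    KaehlerDifferential.isLocalizedModule_map R S T M
  let f : Ω[T⁄R] →ₗ[S] N := IsLocalizedModule.lift M (KaehlerDifferential.map R R S T)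
    D.liftKaehlerDifferential (fun x => by
      rw [Module.End.isUnit_iff]
      have := (IsLocalization.map_units T x)
      obtain ⟨u, hu⟩ := this
      have hact : ∀ n : N, algebraMap S (Module.End S N) x n = (u : T) • n := fun n => by
        rw [Module.algebraMap_end_apply, hu, algebraMap_smul]
      refine ⟨fun a b h => ?_, fun b => ⟨(↑u⁻¹ : T) • b, ?_⟩⟩
      · rw [hact, hact] at h
        simpa [smul_smul] using congrArg (fun n => (↑u⁻¹ : T) • n) h
      · rw [hact]; simp [smul_smul])
  let f' : Ω[T⁄R] →ₗ[T] N := f.extendScalarsOfIsLocalization M T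
  refine ⟨f'.compDer (KaehlerDifferential.D R T), fun s => ?_⟩
  have : f (KaehlerDifferential.map R R S T (KaehlerDifferential.D R S s)) =
      D.liftKaehlerDifferential (KaehlerDifferential.D R S s) := IsLocalizedModule.lift_apply _ _ _ _ _
  have h2 : ∀ z, f' z = f z := fun z => rfl
  simpa [h2] using this

theorem Derivation.exists_descent_of_surjective (hsurj : Function.Surjective (algebraMap S T))
    (D : Derivation R S N) (hD : ∀ s, algebraMap S T s = 0 → D s = 0) :
    ∃ D' : Derivation R T N, ∀ s, D' (algebraMap S T s) = D s := by
  let g := Function.surjInv hsurj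
  have hg : ∀ t, algebraMap S T (g t) = t := Function.surjInv_eq hsurj
  have key : ∀ s s', algebraMap S T s = algebraMap S T s' → D s = D s' := fun s s' h => by
    rw [← sub_eq_zero, ← map_sub]
    exact hD _ (by rw [map_sub, h, sub_self])
  let L : T →ₗ[R] N :=
    { toFun := fun t => D (g t)
      map_add' := fun a b => by
        rw [← map_add]; exact key _ _ (by rw [map_add, hg, hg, hg])
      map_smul' := fun r a => by
        rw [← D.map_smul]
        refine key _ _ ?_
        rw [hg, Algebra.smul_def, Algebra.smul_def, map_mul, hg,
          ← IsScalarTower.algebraMap_apply R S T]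
        rfl }
  refine ⟨Derivation.mk' L fun a b => ?_, fun s => key _ _ (hg _)⟩
  change D (g (a * b)) = a • D (g b) + b • D (g a)
  have : D (g (a * b)) = D (g a * g b) := key _ _ (by rw [map_mul, hg, hg, hg])
  rw [this, D.leibniz, ← algebraMap_smul T (g a), ← algebraMap_smul T (g b), hg, hg]

/-- Relations between the differentials of coordinates come from the differentials of the elements
of the kernel. -/
theorem mem_span_of_kaehler_relation {A V : Type*} [CommRing A] [CommRing V] [Algebra R A]
    [Algebra R V] [Algebra A V] [IsScalarTower R A V]
    (hsurj : Function.Surjective (algebraMap A V)) {ι κ : Type*} [Fintype ι] [DecidableEq ι]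
    (X : ι → A) (δ : Derivation R A (ι → V)) (hδ : ∀ j, δ (X j) = Pi.single j 1) (g : κ → A)
    (hg : RingHom.ker (algebraMap A V) ≤ Ideal.span (Set.range g))
    (hg0 : ∀ k, algebraMap A V (g k) = 0) (r : ι → V)
    (hr : ∑ j, r j • KaehlerDifferential.D R V (algebraMap A V (X j)) = 0) :
    r ∈ Submodule.span V (Set.range fun k => δ (g k)) := by
  set W := Submodule.span V (Set.range fun k => δ (g k)) with hW
  let δ' : Derivation R A ((ι → V) ⧸ W) := (W.mkQ.restrictScalars A).compDer δ
  have hδ' : ∀ a, algebraMap A V a = 0 → δ' a = 0 := by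
    intro a ha
    -- The elements of the kernel whose derivative lies in `W` form an ideal: in the Leibniz rule
    -- the term with a kernel element as scalar vanishes, because scalars act through `V`. So
    -- testing generators suffices.
    let J : Ideal A :=
      { carrier := {a | algebraMap A V a = 0 ∧ δ a ∈ W}
        add_mem' := fun h h' => ⟨by rw [map_add, h.1, h'.1, add_zero], by
          rw [map_add]; exact add_mem h.2 h'.2⟩
        zero_mem' := ⟨map_zero _, by rw [map_zero]; exact zero_mem _⟩
        smul_mem' := fun c b h => ⟨by rw [smul_eq_mul, map_mul, h.1, mul_zero], by
          rw [smul_eq_mul, δ.leibniz, ← algebraMap_smul V b, h.1, zero_smul, add_zero,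
            ← algebraMap_smul V c]
          exact W.smul_mem _ h.2⟩ }
    have hJ : Ideal.span (Set.range g) ≤ J := by
      rw [Ideal.span_le]
      rintro _ ⟨k, rfl⟩
      exact ⟨hg0 k, Submodule.subset_span ⟨k, rfl⟩⟩
    change W.mkQ (δ a) = 0
    rw [Submodule.mkQ_apply, Submodule.Quotient.mk_eq_zero]
    exact (hJ (hg ha)).2
  obtain ⟨D', hD'⟩ := δ'.exists_descent_of_surjective hsurj hδ'
  -- The descended derivation sends the differential of the j-th coordinate to the class of the j-th
  -- basis vector, so it turns the relation into the vanishing of `r` modulo `W`.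
  have h := congrArg D'.liftKaehlerDifferential hr
  rw [map_sum, map_zero] at h
  simp_rw [map_smul, Derivation.liftKaehlerDifferential_comp_D, hD'] at h
  have h2 : W.mkQ r = 0 := by
    rw [← h]
    have : r = ∑ j, r j • (Pi.single j 1 : ι → V) := by
      ext i; simp [Finset.sum_apply, Pi.single_apply]
    conv_lhs => rw [this]
    rw [map_sum]
    refine Finset.sum_congr rfl fun j _ => ?_
    rw [map_smul, ← hδ]
    rfl
  rwa [Submodule.mkQ_apply, Submodule.Quotient.mk_eq_zero] at h2

end Derivations

/-! ### Lower bound for the Jacobian ideal from a regular presentation -/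

section JacobianBound

open IsLocalRing

/-- Independence in the cotangent space, in terms of representatives. -/
theorem cotangentIndep_range_iff {A : Type*} [CommRing A] [IsLocalRing A] {T : Type*} [Fintype T]
    (f : T → maximalIdeal A) :
    (Function.Injective f ∧ CotangentIndep (Set.range f)) ↔
      ∀ c : T → A, ∑ i, c i * (f i : A) ∈ maximalIdeal A ^ 2 → ∀ i, c i ∈ maximalIdeal A := by
  have h0 : ∀ c : T → A, ∑ i, c i * (f i : A) ∈ maximalIdeal A ^ 2 ↔
      ∑ i, residue A (c i) • (show CotangentSpace A from (maximalIdeal A).toCotangent (f i)) = 0 := by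
    intro c
    have h1 : ∑ i, residue A (c i) •
        (show CotangentSpace A from (maximalIdeal A).toCotangent (f i)) =
        (maximalIdeal A).toCotangent (∑ i, c i • f i) := by
      rw [map_sum]
      refine Finset.sum_congr rfl fun i _ => ?_
      rw [map_smul]; rfl
    rw [h1, (maximalIdeal A).toCotangent_eq_zero]
    simp
  have h2 : (Function.Injective f ∧ CotangentIndep (Set.range f)) ↔
      LinearIndependent (ResidueField A) (fun i =>
        (show CotangentSpace A from (maximalIdeal A).toCotangent (f i))) := by
    constructor
    · rintro ⟨hf, h⟩
      exact LinearIndependent.comp h (fun i => ⟨f i, i, rfl⟩)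
        fun i j hij => hf (congrArg Subtype.val hij)
    · intro h
      have hinj : Function.Injective f := fun i j hij => h.injective (by simp [hij])
      refine ⟨hinj, ?_⟩
      have := LinearIndependent.comp h (Equiv.ofInjective f hinj).symm (Equiv.injective _)
      unfold CotangentIndep LinearIndepOn
      convert this using 2 with a
      obtain ⟨-, i, rfl⟩ := a
      simp
  rw [h2, Fintype.linearIndependent_iff]
  constructor
  · intro h c hc i
    exact (residue_eq_zero_iff _).1 (h _ ((h0 c).1 hc) i)
  · intro h c hc i
    choose c' hc' using fun i => residue_surjective (c i)
    rw [← hc']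
    exact (residue_eq_zero_iff _).2 (h c' ((h0 c').2 (by simpa [hc'] using hc)) i)

/-- Every term of the Leibniz expansion uses column `o` exactly once, so at most one power of `t` is
lost in total. -/
theorem pow_dvd_det {V ι : Type*} [CommRing V] [Fintype ι] [DecidableEq ι] (t : V)
    (D : Matrix ι ι V) (E : ι → ℕ) (o : ι)
    (h : ∀ k j, t ^ (E k - if j = o then 1 else 0) ∣ D k j) : t ^ (∑ k, E k - 1) ∣ D.det := by
  rw [Matrix.det_apply]
  refine Finset.dvd_sum fun σ _ => ?_
  rw [Units.smul_def, zsmul_eq_mul]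
  refine Dvd.dvd.mul_left ?_ _
  refine dvd_trans ?_ (Finset.prod_dvd_prod_of_dvd _ _ fun i _ => h (σ i) i)
  rw [Finset.prod_pow_eq_pow_sum]
  refine pow_dvd_pow _ ?_
  have h1 : ∑ k, E k = ∑ i, E (σ i) := (Equiv.sum_comp σ E).symm
  have h2 : ∑ i, E (σ i) ≤ ∑ i, ((E (σ i) - if i = o then 1 else 0) + if i = o then 1 else 0) :=
    Finset.sum_le_sum fun i _ => by omega
  rw [Finset.sum_add_distrib] at h2
  simp only [Finset.sum_ite_eq', Finset.mem_univ, if_true] at h2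
  omega

variable {R A V : Type*} [CommRing R] [CommRing A] [CommRing V] [Algebra R A] [Algebra R V]
  [Algebra A V] [IsScalarTower R A V] {ι : Type*} [Fintype ι] [DecidableEq ι]

theorem derivation_mem_of_mem_sq [IsLocalRing A] [IsLocalRing V]
    (hsurj : Function.Surjective (algebraMap A V)) (δ : Derivation R A (ι → V)) (o : ι) {a : A}
    (ha : a ∈ maximalIdeal A ^ 2) : δ a o ∈ maximalIdeal V := by
  have hmap : ∀ a ∈ maximalIdeal A, algebraMap A V a ∈ maximalIdeal V := fun a ha => by
    rw [← IsLocalRing.map_maximalIdeal_of_surjective _ hsurj]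
    exact Ideal.mem_map_of_mem _ ha
  rw [pow_two] at ha
  induction ha using Submodule.mul_induction_on' with
  | mem_mul_mem a ha b hb =>
    rw [δ.leibniz, Pi.add_apply, Pi.smul_apply, Pi.smul_apply, Algebra.smul_def, Algebra.smul_def]
    exact add_mem (Ideal.mul_mem_right _ _ (hmap a ha)) (Ideal.mul_mem_right _ _ (hmap b hb))
  | add a _ b _ iha ihb => rw [map_add]; exact add_mem iha ihb

/-- The component `o` of `δ` kills the elements coming from `R` and takes the value 1 at `z`.
Applied to a relation modulo the square of the maximal ideal, it shows that the coefficient of `z`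
is not a unit, so the `z`-term lies in that square and independence of the `y i` applies. -/
theorem cotangentIndep_sub [IsLocalRing A] [IsLocalRing V]
    (hsurj : Function.Surjective (algebraMap A V)) (δ : Derivation R A (ι → V)) {o : ι} {z : A}
    (hz : z ∈ maximalIdeal A) (hδ : δ z o = 1) {T : Type*} [Fintype T] (y : T → R) (b : T → A)
    (hy : ∀ i, algebraMap R A (y i) ∈ maximalIdeal A)
    (hind : ∀ c : T → A, ∑ i, c i * algebraMap R A (y i) ∈ maximalIdeal A ^ 2 →
      ∀ i, c i ∈ maximalIdeal A) (c : T → A)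
    (hc : ∑ i, c i * (algebraMap R A (y i) - b i * z) ∈ maximalIdeal A ^ 2) (i : T) :
    c i ∈ maximalIdeal A := by
  have hmap : ∀ a ∈ maximalIdeal A, algebraMap A V a ∈ maximalIdeal V := fun a ha => by
    rw [← IsLocalRing.map_maximalIdeal_of_surjective _ hsurj]
    exact Ideal.mem_map_of_mem _ ha
  set B := ∑ i, c i * b i with hB
  have h1 : ∑ i, c i * (algebraMap R A (y i) - b i * z) =
      ∑ i, c i * algebraMap R A (y i) - B * z := by
    rw [hB, Finset.sum_mul, ← Finset.sum_sub_distrib]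
    exact Finset.sum_congr rfl fun i _ => by ring
  have hB' : B ∈ maximalIdeal A := by
    have h2 := derivation_mem_of_mem_sq hsurj δ o hc
    rw [h1, map_sub, map_sum, Pi.sub_apply, Finset.sum_apply, δ.leibniz] at h2
    have h3 : ∑ i, δ (c i * algebraMap R A (y i)) o ∈ maximalIdeal V := by
      refine Ideal.sum_mem _ fun i _ => ?_
      rw [δ.leibniz, δ.map_algebraMap, smul_zero, zero_add, Pi.smul_apply, Algebra.smul_def]
      exact Ideal.mul_mem_right _ _ (hmap _ (hy i))
    have h4 := sub_mem h3 h2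
    rw [sub_sub_cancel, Pi.add_apply, Pi.smul_apply, Pi.smul_apply, Algebra.smul_def,
      Algebra.smul_def, hδ, mul_one] at h4
    have h5 := sub_mem h4 (Ideal.mul_mem_right (δ B o) _ (hmap z hz))
    rw [add_sub_cancel_right] at h5
    by_contra hB0
    rw [mem_maximalIdeal, mem_nonunits_iff, not_not] at hB0
    exact (mem_nonunits_iff.1 ((mem_maximalIdeal _).1 h5)) (hB0.map _)
  refine hind c ?_ i
  have : ∑ i, c i * algebraMap R A (y i) =
      ∑ i, c i * (algebraMap R A (y i) - b i * z) + B * z := by rw [h1]; ring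
  rw [this]
  exact add_mem hc (by rw [pow_two]; exact Ideal.mul_mem_mul hB' hz)

/-- The lower bound for the Jacobian ideal of a discrete valuation ring that is presented as a
quotient of a regular local ring. -/
theorem jacobianIdeal_le_of_presentation [IsRegularLocalRing A] [IsDomain V]
    [IsDiscreteValuationRing V] (hsurj : Function.Surjective (algebraMap A V)) (X : ι → A)
    (δ : Derivation R A (ι → V)) (hδ : ∀ j, δ (X j) = Pi.single j 1)
    (hspan : Submodule.span V
      (Set.range fun j => KaehlerDifferential.D R V (algebraMap A V (X j))) = ⊤)
    (hheight : (RingHom.ker (algebraMap A V)).height ≤ Fintype.card ι) {o : ι}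
    (ho : Irreducible (algebraMap A V (X o))) {T : Type*} [Fintype T] (y : T → R) (w : T → ℕ)
    (hw : ∀ i, w i ≠ 0) (u : T → A)
    (hu : ∀ i, algebraMap R V (y i) = algebraMap A V (u i) * algebraMap A V (X o) ^ w i)
    (hind : ∀ c : T → A, ∑ i, c i * algebraMap R A (y i) ∈ maximalIdeal A ^ 2 →
      ∀ i, c i ∈ maximalIdeal A) :
    jacobianIdeal R V ≤ Ideal.span {algebraMap A V (X o) ^ (∑ i, w i - 1)} := by
  classical
  set φ := algebraMap A V with hφ
  set t := φ (X o) with ht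
  have htm : t ∈ maximalIdeal V := (mem_maximalIdeal _).2 ho.1
  have hcomap : ∀ a, φ a ∈ maximalIdeal V → a ∈ maximalIdeal A := fun a ha => by
    by_contra h
    rw [mem_maximalIdeal, mem_nonunits_iff, not_not] at h
    exact (mem_nonunits_iff.1 ((mem_maximalIdeal _).1 ha)) (h.map φ)
  have hmax : maximalIdeal V = Ideal.span {t} := ho.maximalIdeal_eq
  set Q := RingHom.ker φ with hQ
  have hQp : Q.IsPrime := RingHom.ker_isPrime φ
  have hXo : X o ∈ maximalIdeal A := hcomap _ htm
  have hQne : Q ≠ maximalIdeal A := fun h => ho.ne_zero (by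
    rw [← h, RingHom.mem_ker] at hXo; exact hXo)
  have hQt : maximalIdeal A ≤ Q ⊔ Ideal.span {X o} := by
    intro a ha
    have h1 : φ a ∈ maximalIdeal V := by
      rw [← IsLocalRing.map_maximalIdeal_of_surjective φ hsurj]
      exact Ideal.mem_map_of_mem _ ha
    rw [hmax] at h1
    obtain ⟨c, hc⟩ := Ideal.mem_span_singleton.1 h1
    obtain ⟨c, rfl⟩ := hsurj c
    have h2 : a - X o * c ∈ Q := by
      rw [hQ, RingHom.mem_ker, map_sub, map_mul, hc, sub_self]
    have h3 := Submodule.add_mem_sup h2 (Ideal.mul_mem_right c _ (Ideal.mem_span_singleton_self (X o)))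
    rwa [sub_add_cancel] at h3
  have hyA : ∀ i, φ (algebraMap R A (y i)) = φ (u i) * t ^ w i := fun i => by
    rw [hφ, ← IsScalarTower.algebraMap_apply, hu]
  have hym : ∀ i, algebraMap R A (y i) ∈ maximalIdeal A := fun i => hcomap _ (by
    rw [hyA]; exact Ideal.mul_mem_left _ _ (Ideal.pow_mem_of_mem _ htm _ (Nat.pos_of_ne_zero (hw i))))
  -- These elements of the kernel record the factorizations of the `y i` in `V`. As `w i` is
  -- nonzero, the correction is a multiple of `X o`, so `cotangentIndep_sub` makes them part of a
  -- regular system of parameters, to be enlarged to generators of `Q`.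
  set g : T → A := fun i => algebraMap R A (y i) - u i * X o ^ w i with hg
  have hgQ : ∀ i, g i ∈ Q := fun i => by
    rw [hQ, RingHom.mem_ker, hg]; simp only [map_sub, map_mul, map_pow, hyA]; rw [← ht]; ring
  have hgm : ∀ i, g i ∈ maximalIdeal A := fun i => le_maximalIdeal hQp.ne_top (hgQ i)
  obtain ⟨hginj, hgind⟩ := (cotangentIndep_range_iff fun i => (⟨g i, hgm i⟩ : maximalIdeal A)).2
    (fun c hc i => cotangentIndep_sub hsurj δ hXo (o := o) (by rw [hδ]; simp) y
      (fun i => u i * X o ^ (w i - 1)) hym hind c (by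
        convert hc using 3 with i
        simp only [hg]
        rw [mul_assoc (u i), ← pow_succ, Nat.sub_add_cancel (Nat.pos_of_ne_zero (hw i))]) i)
  obtain ⟨b, hgb, hb, hbQ⟩ := hgind.exists_span_eq hQp hQne hXo hQt (by
    rintro _ ⟨i, rfl⟩; exact hgQ i)
  have hbfin : Fintype b := hb.finite.fintype
  have hcard : Fintype.card b ≤ Fintype.card ι := by
    have := hb.ncard_le_height
    rw [hbQ] at this
    have h2 := this.trans hheight
    rw [Set.ncard_eq_toFinset_card', Set.toFinset_card] at h2
    exact_mod_cast h2
  -- The height bound leaves at most as many generators as coordinates; zero rows pad their Jacobian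
  -- matrix to a square one.
  obtain ⟨emb⟩ := Function.Embedding.nonempty_of_card_le hcard
  let F : ι → ι → V := Function.extend emb (fun a : b => δ ((a : maximalIdeal A) : A)) 0
  let D : Matrix ι ι V := Matrix.of F
  have hDemb : ∀ a : b, D (emb a) = δ ((a : maximalIdeal A) : A) := fun a => by
    change F (emb a) = _
    exact emb.injective.extend_apply _ _ a
  have hrel : ∀ r : ι → V, ∑ j, r j • KaehlerDifferential.D R V (φ (X j)) = 0 →
      ∃ s : ι → V, Matrix.vecMul s D = r := by
    intro r hr
    have h1 := mem_span_of_kaehler_relation hsurj X δ hδ (fun a : b => ((a : maximalIdeal A) : A))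
      (by
        rw [← hφ, ← hQ, ← hbQ]
        refine Ideal.span_mono ?_
        rintro _ ⟨a, ha, rfl⟩
        exact ⟨⟨a, ha⟩, rfl⟩)
      (fun a => by
        have : ((a : maximalIdeal A) : A) ∈ Q := hbQ ▸ Ideal.subset_span ⟨a, a.2, rfl⟩
        exact this) r hr
    have h2 : r ∈ Submodule.span V (Set.range D) := by
      refine Submodule.span_mono ?_ h1
      rintro _ ⟨a, rfl⟩
      exact ⟨emb a, hDemb a⟩
    obtain ⟨s, hs⟩ := (Submodule.mem_span_range_iff_exists_fun V).1 h2
    refine ⟨s, ?_⟩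
    rw [← hs]
    ext j
    simp [Matrix.vecMul, dotProduct, Finset.sum_apply]
  refine (fittingIdealZero_le_span_det _ hspan D hrel).trans ?_
  rw [Ideal.span_singleton_le_span_singleton]
  let e : T → ι := fun i => emb ⟨⟨g i, hgm i⟩, hgb ⟨i, rfl⟩⟩
  have he : Function.Injective e := fun i j hij => hginj
    (congrArg Subtype.val (emb.injective hij))
  -- Only the rows of the special elements `g i` contribute divisibility; all other rows get
  -- exponent zero.
  let E : ι → ℕ := Function.extend e w 0
  have hE : ∀ i, E (e i) = w i := fun i => he.extend_apply _ _ i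
  have hsum : ∑ i, w i ≤ ∑ k, E k := by
    calc ∑ i, w i = ∑ i, E (e i) := by simp [hE]
      _ = ∑ k ∈ Finset.univ.map ⟨e, he⟩, E k := by simp
      _ ≤ _ := Finset.sum_le_sum_of_subset (Finset.subset_univ _)
  refine (pow_dvd_pow t (Nat.sub_le_sub_right hsum 1)).trans (pow_dvd_det t D E o fun k j => ?_)
  by_cases hk : ∃ i, e i = k
  · obtain ⟨i, rfl⟩ := hk
    -- By the Leibniz rule only the derivative of the power of `X o` has the smaller exponent `w i -
    -- 1`, and it is concentrated in column `o`.
    have h1 : D (e i) j = - (φ (u i) * (w i * t ^ (w i - 1) * (Pi.single o 1 : ι → V) j) +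
        t ^ w i * δ (u i) j) := by
      rw [show D (e i) = δ (g i) from hDemb _, hg]
      simp only [map_sub, Derivation.map_algebraMap, Derivation.leibniz, Derivation.leibniz_pow, hδ,
        zero_sub, Pi.neg_apply, Pi.add_apply, Algebra.smul_def, map_pow]
      simp [← ht, ← hφ, mul_assoc, mul_comm, mul_left_comm]
    rw [h1, hE, dvd_neg]
    refine dvd_add ?_ (Dvd.dvd.mul_right (pow_dvd_pow _ (Nat.sub_le _ _)) _)
    by_cases hj : j = o
    · subst hj
      simp only [if_true]
      exact Dvd.dvd.mul_left (Dvd.dvd.mul_right (Dvd.dvd.mul_left dvd_rfl _) _) _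
    · simp [hj]
  · have : E k = 0 := by
      simp only [E]; rw [Function.extend_apply' _ _ _ hk]; rfl
    simp [this]

end JacobianBound

/-! ### Regular sequences with regular quotient -/

section RegularSequences

open IsLocalRing RingTheory.Sequence

variable {R : Type*} [CommRing R] {T : Type*} [Fintype T] {y : T → R}

theorem IsPrimeFamily.mem_of_mul_mem_span (hy : IsPrimeFamily y) {S : Set T} {i : T} (hi : i ∉ S)
    {r : R} (h : y i * r ∈ Ideal.span (y '' S)) : r ∈ Ideal.span (y '' S) :=
  ((hy.isPrime S).mem_or_mem h).resolve_left (hy.notMem S i hi)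

theorem IsPrimeFamily.isWeaklyRegular (hy : IsPrimeFamily y) (l : List T) (hl : l.Nodup) :
    IsWeaklyRegular R (l.map y) := by
  induction l using List.reverseRecOn with
  | nil => simp
  | append_singleton l a ih =>
    rw [List.nodup_append'] at hl
    rw [List.map_append, isWeaklyRegular_append_iff]
    refine ⟨ih hl.1, ?_⟩
    rw [List.map_singleton, isWeaklyRegular_singleton_iff]
    have hofList : (Ideal.ofList (l.map y) • ⊤ : Ideal R) = Ideal.span (y '' {i | i ∈ l}) := by
      rw [smul_eq_mul, Ideal.mul_top, Ideal.ofList]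
      congr 1
      ext z; simp
    have hal : a ∉ {i | i ∈ l} := fun h => hl.2.2 h (by simp)
    intro z z' hzz
    obtain ⟨z, rfl⟩ := Submodule.Quotient.mk_surjective _ z
    obtain ⟨z', rfl⟩ := Submodule.Quotient.mk_surjective _ z'
    simp only [← Submodule.Quotient.mk_smul] at hzz
    rw [Submodule.Quotient.eq] at hzz ⊢
    rw [hofList] at hzz ⊢
    rw [← smul_sub, smul_eq_mul] at hzz
    exact hy.mem_of_mul_mem_span hal hzz

/-- A weakly regular sequence in the maximal ideal of a regular local ring with regular quotient is
part of a regular system of parameters. -/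
theorem mem_maximalIdeal_of_sum_mem_sq {A : Type*} [CommRing A] [IsRegularLocalRing A] (f : T → A)
    (hf : ∀ i, f i ∈ maximalIdeal A) (hreg : IsWeaklyRegular A (Finset.univ.toList.map f))
    [IsRegularLocalRing (A ⧸ Ideal.span (Set.range f))] (c : T → A)
    (hc : ∑ i, c i * f i ∈ maximalIdeal A ^ 2) (i : T) : c i ∈ maximalIdeal A := by
  classical
  set I := Ideal.span (Set.range f) with hI
  have hofList : Ideal.ofList (Finset.univ.toList.map f) = I := by
    rw [hI, Ideal.ofList]; congr 1; ext z; simp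
  have hreg' : IsRegular A (Finset.univ.toList.map f) :=
    (IsLocalRing.isRegular_iff_isWeaklyRegular_of_subset_maximalIdeal (by
      intro z hz; obtain ⟨j, -, rfl⟩ := List.mem_map.1 hz; exact hf j)).2 hreg
  have hdim := ringKrullDim_add_length_eq_ringKrullDim_of_isRegular _ hreg'
  rw [hofList, ← IsRegularLocalRing.spanFinrank_maximalIdeal,
    ← IsRegularLocalRing.spanFinrank_maximalIdeal, List.length_map, Finset.length_toList,
    Finset.card_univ] at hdim
  -- A regular sequence lowers the dimension by its length, and regularity of both rings turns this
  -- into a statement on embedding dimensions. Lifted generators for the quotient and a maximal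
  -- independent subset `b` of the `f i` generate the maximal ideal, so counting forces `b` to
  -- consist of all the `f i`, without repetition.
  have hdim' : (maximalIdeal (A ⧸ I)).spanFinrank + Fintype.card T =
      (maximalIdeal A).spanFinrank := by exact_mod_cast hdim
  let F : T → maximalIdeal A := fun i => ⟨f i, hf i⟩
  obtain ⟨b, hbF, -, hb, hspan⟩ := exists_cotangentIndep_extension (s := ∅) (t := Set.range F)
    (linearIndepOn_empty _ _) (Set.empty_subset _)
  -- generators of the maximal ideal of the quotient, lifted
  obtain ⟨G, hGcard, hG⟩ := Submodule.FG.exists_span_finset_card_eq_spanFinrank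
    (IsNoetherian.noetherian (maximalIdeal (A ⧸ I)))
  have hmap := IsLocalRing.map_maximalIdeal_of_surjective (Ideal.Quotient.mk I)
      Ideal.Quotient.mk_surjective
  have hlift : ∀ z ∈ G, ∃ a : maximalIdeal A, Ideal.Quotient.mk I a = z := by
    intro z hz
    have h1 : z ∈ maximalIdeal (A ⧸ I) := by rw [← hG]; exact Submodule.subset_span hz
    rw [← hmap, Ideal.mem_map_iff_of_surjective _ Ideal.Quotient.mk_surjective] at h1
    obtain ⟨a, ha, haz⟩ := h1
    exact ⟨⟨a, ha⟩, haz⟩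
  choose L hL using hlift
  let g : Set (maximalIdeal A) := Set.range fun z : G => L z z.2
  have hg : g.ncard ≤ (maximalIdeal (A ⧸ I)).spanFinrank := by
    rw [← hGcard, ← Fintype.card_coe, ← Nat.card_eq_fintype_card, ← Set.ncard_univ]
    have : g = (fun z : G => L z z.2) '' Set.univ := Set.image_univ.symm
    rw [this]
    exact Set.ncard_image_le Set.finite_univ
  have hgfin : g.Finite := Set.finite_range _
  have hgen : Submodule.span (ResidueField A) (M := CotangentSpace A)
      ((maximalIdeal A).toCotangent '' (g ∪ b)) = ⊤ := by
    rw [eq_top_iff]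
    intro v _
    obtain ⟨a, rfl⟩ := (maximalIdeal A).toCotangent_surjective v
    have h1 : Ideal.Quotient.mk I a ∈ maximalIdeal (A ⧸ I) := by
      rw [← hmap]; exact Ideal.mem_map_of_mem _ a.2
    rw [← hG] at h1
    have h2 : Ideal.Quotient.mk I a ∈ (Ideal.span (Subtype.val '' g)).map (Ideal.Quotient.mk I) := by
      rw [Ideal.map_span]
      refine Ideal.span_mono ?_ h1
      intro z hz
      exact ⟨_, ⟨_, ⟨⟨z, hz⟩, rfl⟩, rfl⟩, hL z hz⟩
    have h3 : (a : A) ∈ Ideal.span (Subtype.val '' g) ⊔ I := by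
      rw [← Ideal.mem_comap, Ideal.comap_map_of_surjective' _ Ideal.Quotient.mk_surjective,
        Ideal.mk_ker] at h2
      exact h2
    have h4 : I = Ideal.span (Subtype.val '' Set.range F) := by
      rw [← Set.range_comp]; rfl
    rw [h4, ← Ideal.span_union, ← Set.image_union] at h3
    have h5 : a ∈ Submodule.span A (g ∪ Set.range F) := by
      have h6 : (a : A) ∈ Submodule.map (maximalIdeal A).subtype
          (Submodule.span A (g ∪ Set.range F)) := by
        rw [Submodule.map_span]; exact h3
      obtain ⟨a', ha', haa⟩ := h6
      rwa [← Subtype.ext haa]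
    have h7 := Submodule.mem_map_of_mem (f := (maximalIdeal A).toCotangent) h5
    rw [Submodule.map_span] at h7
    have h8 := Submodule.span_subset_span A (ResidueField A) _ h7
    refine Submodule.span_le.2 ?_ h8
    rintro _ ⟨a', ha' | ha', rfl⟩
    · exact Submodule.subset_span ⟨a', Or.inl ha', rfl⟩
    · exact Submodule.span_mono (Set.image_mono Set.subset_union_right) (hspan ⟨a', ha', rfl⟩)
  have hle : (maximalIdeal A).spanFinrank ≤ (g ∪ b).ncard := by
    refine (congrArg Submodule.spanFinrank (ideal_span_eq_maximalIdeal hgen)).ge.trans ?_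
    exact (Submodule.spanFinrank_span_le_ncard_of_finite ((hgfin.union hb.finite).image _)).trans
      (Set.ncard_image_le (hgfin.union hb.finite))
  have hle2 := Set.ncard_union_le g b
  have hFcard : (Set.range F).ncard ≤ Fintype.card T := by
    rw [← Set.image_univ, ← Nat.card_eq_fintype_card, ← Set.ncard_univ]
    exact Set.ncard_image_le Set.finite_univ
  have hbcard := Set.ncard_le_ncard hbF (Set.finite_range F)
  have hbeq : b = Set.range F := Set.eq_of_subset_of_ncard_le hbF (by omega) (Set.finite_range F)
  have hFinj : Function.Injective F := by
    have h9 : (Finset.univ.image F).card = (Finset.univ : Finset T).card := by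
      rw [← Set.ncard_coe_finset, Finset.coe_image, Finset.coe_univ, Set.image_univ,
        Finset.card_univ]
      rw [hbeq] at hbcard hle2 hle
      omega
    have := Finset.card_image_iff.1 h9
    simpa [Set.injOn_univ] using this
  exact (cotangentIndep_range_iff F).1 ⟨hFinj, hbeq ▸ hb⟩ c hc i

end RegularSequences

/-! ### The Jacobian bound for rings essentially of finite type -/

section EssFinite

open IsLocalRing RingTheory.Sequence

/-- For an element z of the ring with denominator t, the Leibniz rule for z t isolates t dz modulo
differentials already covered, and t is a unit. -/
theorem span_kaehler_eq_top {R V : Type*} [CommRing R] [CommRing V] [Algebra R V] (s : Set V)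
    (hs : ∀ z : V, ∃ t ∈ Algebra.adjoin R s, IsUnit t ∧ z * t ∈ Algebra.adjoin R s)
    (W : Submodule V (Ω[V⁄R])) (hW : ∀ a ∈ s, KaehlerDifferential.D R V a ∈ W) : W = ⊤ := by
  have h1 : ∀ a ∈ Algebra.adjoin R s, KaehlerDifferential.D R V a ∈ W := by
    intro a ha
    induction ha using Algebra.adjoin_induction with
    | mem a ha => exact hW a ha
    | algebraMap r => simp
    | add a b _ _ ha hb => rw [map_add]; exact add_mem ha hb
    | mul a b _ _ ha hb =>
      rw [Derivation.leibniz]; exact add_mem (W.smul_mem _ hb) (W.smul_mem _ ha)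
  rw [eq_top_iff, ← KaehlerDifferential.span_range_derivation, Submodule.span_le]
  rintro _ ⟨z, rfl⟩
  obtain ⟨t, ht, htu, hzt⟩ := hs z
  have h2 := h1 _ hzt
  rw [Derivation.leibniz] at h2
  have h3 := (Submodule.add_mem_iff_right W (W.smul_mem z (h1 t ht))).1 h2
  obtain ⟨u, rfl⟩ := htu
  simpa [smul_smul] using W.smul_mem (↑u⁻¹ : V) h3

variable {R V : Type*} [CommRing R] [IsDomain R] [IsRegularRing R] [CommRing V] [IsDomain V]
  [Algebra R V]

/-- Writing the i-th coordinate as a fraction aᵢ/bᵢ over `R`, the kernel is minimal over the ideal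
of the linear forms bᵢXᵢ - aᵢ, and Krull's height theorem applies. Minimality: modulo these forms, a
power of B = ∏ bᵢ makes any polynomial constant; for a polynomial in the kernel the constant is 0,
and B lies in no prime below the kernel. -/
theorem height_ker_aeval_le {ι : Type*} [Fintype ι] (hinj : Function.Injective (algebraMap R V))
    (hfrac : ∀ z : V, ∃ a b : R, b ≠ 0 ∧ z * algebraMap R V b = algebraMap R V a) (τ : ι → V) :
    (RingHom.ker (MvPolynomial.aeval (R := R) τ)).height ≤ Fintype.card ι := by
  classical
  choose a b hb hab using fun i => hfrac (τ i)
  let h : ι → MvPolynomial ι R := fun i => MvPolynomial.C (b i) * MvPolynomial.X i -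
    MvPolynomial.C (a i)
  set q := RingHom.ker (MvPolynomial.aeval (R := R) τ) with hq
  have hqp : q.IsPrime := RingHom.ker_isPrime _
  let s : Finset (MvPolynomial ι R) := Finset.univ.image h
  have hsq : Ideal.span (s : Set (MvPolynomial ι R)) ≤ q := by
    rw [Ideal.span_le]
    intro z hz
    obtain ⟨i, -, rfl⟩ := Finset.mem_image.1 (Finset.mem_coe.1 hz)
    simp only [h, hq, SetLike.mem_coe, RingHom.mem_ker, map_sub, map_mul, MvPolynomial.aeval_X,
      MvPolynomial.algHom_C]
    rw [mul_comm, hab, sub_self]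
  set B := ∏ i, b i with hB
  have hB0 : B ≠ 0 := Finset.prod_ne_zero_iff.2 fun i _ => hb i
  have hBX : ∀ i, ∃ c : R, MvPolynomial.C B * MvPolynomial.X i - MvPolynomial.C c ∈
      Ideal.span (s : Set (MvPolynomial ι R)) := by
    intro i
    obtain ⟨e, he⟩ := Finset.dvd_prod_of_mem b (Finset.mem_univ i)
    refine ⟨e * a i, ?_⟩
    have : MvPolynomial.C B * MvPolynomial.X i - MvPolynomial.C (e * a i) =
        MvPolynomial.C e * h i := by
      rw [hB, he]; simp only [h, map_mul]; ring
    rw [this]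
    exact Ideal.mul_mem_left _ _ (Ideal.subset_span (by simp [s]))
  have key : ∀ p : MvPolynomial ι R, ∃ (N : ℕ) (c : R), MvPolynomial.C B ^ N * p -
      MvPolynomial.C c ∈ Ideal.span (s : Set (MvPolynomial ι R)) := by
    intro p
    induction p using MvPolynomial.induction_on with
    | C r => exact ⟨0, r, by simp⟩
    | add p p' hp hp' =>
      obtain ⟨N, c, h1⟩ := hp
      obtain ⟨N', c', h2⟩ := hp'
      refine ⟨N + N', B ^ N' * c + B ^ N * c', ?_⟩
      have := add_mem (Ideal.mul_mem_left _ (MvPolynomial.C B ^ N') h1)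
        (Ideal.mul_mem_left _ (MvPolynomial.C B ^ N) h2)
      convert this using 1
      simp only [map_add, map_mul, map_pow]; ring
    | mul_X p i hp =>
      obtain ⟨N, c, h1⟩ := hp
      obtain ⟨c', h2⟩ := hBX i
      refine ⟨N + 1, c * c', ?_⟩
      have := add_mem (Ideal.mul_mem_left _ (MvPolynomial.C B * MvPolynomial.X i) h1)
        (Ideal.mul_mem_left _ (MvPolynomial.C c) h2)
      convert this using 1
      simp only [map_mul]; ring
  have hmin : q ∈ (Ideal.span (s : Set (MvPolynomial ι R))).minimalPrimes := by
    refine ⟨⟨hqp, hsq⟩, ?_⟩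
    rintro q' ⟨hq'p, hsq'⟩ hq'q p hp
    obtain ⟨N, c, h1⟩ := key p
    have h2 : MvPolynomial.aeval τ (MvPolynomial.C B ^ N * p - MvPolynomial.C c) = 0 := hsq h1
    have hp0 : MvPolynomial.aeval τ p = 0 := hp
    rw [map_sub, map_mul, hp0, mul_zero, zero_sub, neg_eq_zero, MvPolynomial.algHom_C] at h2
    have hc : c = 0 := hinj (by rw [h2, map_zero])
    rw [hc, map_zero, sub_zero] at h1
    refine (hq'p.mem_or_mem (hsq' h1)).resolve_left fun h3 => ?_
    have h4 : MvPolynomial.aeval τ (MvPolynomial.C (σ := ι) B) = 0 := hq'q (hq'p.mem_of_pow_mem _ h3)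
    rw [MvPolynomial.algHom_C] at h4
    exact hB0 (hinj (by rw [h4, map_zero]))
  refine (Ideal.height_le_card_of_mem_minimalPrimes_span_finset hmin).trans ?_
  exact_mod_cast Finset.card_image_le

/-- A local ring that is a localization is the localization at the contraction of its maximal ideal,
where regularity is part of the hypothesis on `S`. -/
theorem isRegularLocalRing_of_isLocalization {S A : Type*} [CommRing S] [CommRing A] [Algebra S A]
    [IsRegularRing S] (M : Submonoid S) [IsLocalization M A] [IsLocalRing A] :
    IsRegularLocalRing A := by
  have := IsLocalization.isLocalization_isLocalization_atPrime_isLocalization M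
    (Localization.AtPrime (maximalIdeal A)) (maximalIdeal A)
  have hreg : IsRegularLocalRing (Localization.AtPrime ((maximalIdeal A).under S)) :=
    IsRegularRing.isRegularLocalRing_localization _
  have hreg' : IsRegularLocalRing (Localization.AtPrime (maximalIdeal A)) :=
    IsRegularLocalRing.of_ringEquiv (IsLocalization.algEquiv ((maximalIdeal A).under S).primeCompl
      (Localization.AtPrime ((maximalIdeal A).under S))
      (Localization.AtPrime (maximalIdeal A))).toRingEquiv
  exact IsRegularLocalRing.of_ringEquiv (IsLocalization.atUnits A (maximalIdeal A).primeCompl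
    (S := Localization.AtPrime (maximalIdeal A)) fun a ha => by
      have h : ¬ (a ∈ maximalIdeal A) := ha
      rwa [mem_maximalIdeal, mem_nonunits_iff, not_not] at h).symm.toRingEquiv

/-- The Jacobian ideal of a discrete valuation ring that is essentially of finite type over a
regular domain with the same field of fractions, in the presence of elements of a generalized
regular system of parameters. -/
theorem jacobianIdeal_le_of_essFiniteType [IsDiscreteValuationRing V] [Algebra.EssFiniteType R V]
    (hinj : Function.Injective (algebraMap R V))
    (hfrac : ∀ z : V, ∃ a b : R, b ≠ 0 ∧ z * algebraMap R V b = algebraMap R V a)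
    {T : Type*} [Fintype T] {y : T → R} (hy : IsPrimeFamily y)
    [IsRegularRing (R ⧸ Ideal.span (Set.range y))] {t : V} (ht : Irreducible t) (w : T → ℕ)
    (hw : ∀ i, w i ≠ 0) (u : T → V) (hu : ∀ i, algebraMap R V (y i) = u i * t ^ w i) :
    jacobianIdeal R V ≤ Ideal.span {t ^ (∑ i, w i - 1)} := by
  classical
  obtain ⟨σ, hσ⟩ := (Algebra.essFiniteType_iff (R := R) (S := V)).1 inferInstance
  let ι := Option σ
  -- The additional variable `none` maps to the uniformizer, so that the presentation has a
  -- coordinate `X o` as required.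
  let τ : ι → V := fun o => o.elim t (fun s => s)
  let S := MvPolynomial ι R
  let φ : S →ₐ[R] V := MvPolynomial.aeval τ
  let _ : Algebra S V := φ.toRingHom.toAlgebra
  have hSV : ∀ p : S, algebraMap S V p = φ p := fun _ => rfl
  have : IsScalarTower R S V := IsScalarTower.of_algebraMap_eq fun r => (φ.commutes r).symm
  let n : Ideal S := (maximalIdeal V).comap (algebraMap S V)
  have hn : n.IsPrime := Ideal.IsPrime.comap _
  let A := Localization.AtPrime n
  have hunit : ∀ p : n.primeCompl, IsUnit (algebraMap S V p) := fun p => by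
    by_contra h
    exact p.2 ((mem_maximalIdeal _).2 h)
  let _ : Algebra A V := (IsLocalization.lift (M := n.primeCompl) hunit).toAlgebra
  have : IsScalarTower S A V := IsScalarTower.of_algebraMap_eq fun p =>
    (IsLocalization.lift_eq (M := n.primeCompl) hunit p).symm
  have : IsScalarTower R A V := IsScalarTower.of_algebraMap_eq fun r => by
    rw [IsScalarTower.algebraMap_apply R S V, IsScalarTower.algebraMap_apply R S A,
      ← IsScalarTower.algebraMap_apply S A V]
  have : IsRegularLocalRing A := IsRegularRing.isRegularLocalRing_localization n
  have hadj : ∀ a ∈ Algebra.adjoin R (σ : Set V), ∃ p : S, φ p = a := by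
    intro a ha
    have h1 : Algebra.adjoin R (σ : Set V) ≤ φ.range := Algebra.adjoin_le fun s hs =>
      ⟨MvPolynomial.X (some ⟨s, hs⟩), MvPolynomial.aeval_X _ _⟩
    exact h1 ha
  have hsurj : Function.Surjective (algebraMap A V) := by
    intro z
    obtain ⟨b, hb, hbu, hzb⟩ := hσ z
    obtain ⟨p, hp⟩ := hadj _ hzb
    obtain ⟨q, rfl⟩ := hadj b hb
    let q' : n.primeCompl := ⟨q, fun h => (mem_maximalIdeal _).1 h hbu⟩
    refine ⟨IsLocalization.mk' A p q', ?_⟩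
    have h1 : algebraMap A V (IsLocalization.mk' A p q') * φ q = z * φ q := by
      have h2 := congrArg (algebraMap A V) (IsLocalization.mk'_spec A p q')
      rw [map_mul, ← IsScalarTower.algebraMap_apply S A V,
        ← IsScalarTower.algebraMap_apply S A V] at h2
      exact h2.trans hp
    exact hbu.mul_right_cancel h1
  obtain ⟨δ, hδ⟩ := Derivation.exists_extension_of_isLocalization (T := A) (N := ι → V) n.primeCompl
    (MvPolynomial.mkDerivation R (fun j : ι => (Pi.single j 1 : ι → V)))
  let X : ι → A := fun j => algebraMap S A (MvPolynomial.X j)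
  have hX : ∀ j, algebraMap A V (X j) = τ j := fun j => by
    rw [← IsScalarTower.algebraMap_apply S A V]; exact MvPolynomial.aeval_X _ _
  have hspan : Submodule.span V
      (Set.range fun j => KaehlerDifferential.D R V (algebraMap A V (X j))) = ⊤ := by
    refine span_kaehler_eq_top (σ : Set V) hσ _ fun a ha => ?_
    exact Submodule.subset_span ⟨some ⟨a, ha⟩, by simp only [hX]; rfl⟩
  have hheight : (RingHom.ker (algebraMap A V)).height ≤ Fintype.card ι := by
    rw [← IsLocalization.height_under n.primeCompl]
    refine le_trans (le_of_eq ?_) (height_ker_aeval_le hinj hfrac τ)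
    congr 1
    ext p
    rw [Ideal.mem_comap, RingHom.mem_ker, RingHom.mem_ker,
      ← IsScalarTower.algebraMap_apply S A V]; rfl
  have htm : t ∈ maximalIdeal V := (mem_maximalIdeal _).2 ht.1
  have hym : ∀ i, algebraMap R A (y i) ∈ maximalIdeal A := fun i => by
    by_contra h
    rw [mem_maximalIdeal, mem_nonunits_iff, not_not] at h
    have h1 := h.map (algebraMap A V)
    rw [← IsScalarTower.algebraMap_apply, hu] at h1
    exact (mem_maximalIdeal _).1 (Ideal.mul_mem_left _ (u i) (Ideal.pow_mem_of_mem _ htm _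
      (Nat.pos_of_ne_zero (hw i)))) h1
  -- Flatness carries the regular sequence `y` from `R` to `A`. The quotient of `A` by it is a
  -- localization of a polynomial ring over the regular ring R/(y), so the `y i` are independent in
  -- the cotangent space of `A`.
  have : Module.Flat R A := Module.Flat.trans R S A
  have hwreg : RingTheory.Sequence.IsWeaklyRegular A
      (Finset.univ.toList.map fun i => algebraMap R A (y i)) := by
    have := (hy.isWeaklyRegular Finset.univ.toList (Finset.nodup_toList _)).of_flat (S := A)
    rwa [List.map_map] at this
  have : IsRegularLocalRing (A ⧸ Ideal.span (Set.range fun i => algebraMap R A (y i))) := by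
    let I : Ideal S := Ideal.map MvPolynomial.C (Ideal.span (Set.range y))
    have hI : Ideal.span (Set.range fun i => algebraMap R A (y i)) = I.map (algebraMap S A) := by
      simp only [I]
      rw [Ideal.map_span, Ideal.map_span, ← Set.range_comp, ← Set.range_comp]
      rfl
    have hreg : IsRegularRing (S ⧸ I) := IsRegularRing.of_ringEquiv
      (MvPolynomial.quotientEquivQuotientMvPolynomial (Ideal.span (Set.range y))).toRingEquiv
    rw [hI]
    have : Nontrivial (A ⧸ I.map (algebraMap S A)) := by
      rw [Ideal.Quotient.nontrivial_iff, ← hI]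
      intro h
      refine Ideal.IsPrime.ne_top' (top_le_iff.1 (h ▸ Ideal.span_le.2 ?_ : ⊤ ≤ maximalIdeal A))
      rintro _ ⟨i, rfl⟩
      exact hym i
    have : IsLocalRing (A ⧸ I.map (algebraMap S A)) :=
      IsLocalRing.of_surjective' (Ideal.Quotient.mk _) Ideal.Quotient.mk_surjective
    exact isRegularLocalRing_of_isLocalization
      (Algebra.algebraMapSubmonoid (S ⧸ I) n.primeCompl)
  choose u' hu' using fun i => hsurj (u i)
  have hXo : algebraMap A V (X none) = t := hX none
  have := jacobianIdeal_le_of_presentation hsurj X δ (fun j => by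
      rw [hδ, MvPolynomial.mkDerivation_X]) hspan hheight (o := none) (by rwa [hXo]) y w hw u'
    (fun i => by rw [hu', hXo, hu])
    (mem_maximalIdeal_of_sum_mem_sq (fun i => algebraMap R A (y i)) hym hwreg)
  rwa [hXo] at this

end EssFinite

/-! ### The weighted order of elements -/

section WeightedOrder

variable {ι R : Type*} [Fintype ι] [CommRing R]

/-- The weighted degree of an exponent. -/
def wdeg (w : ι → ℕ) (e : ι → ℕ) : ℕ := ∑ i, e i * w i

/-- The exponents of weighted degree at least `n`. -/
def levelSet (w : ι → ℕ) (n : ℕ) : Set (ι → ℕ) := {e | n ≤ wdeg w e}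

theorem mem_levelSet {w : ι → ℕ} {n : ℕ} {e : ι → ℕ} : e ∈ levelSet w n ↔ n ≤ wdeg w e := Iff.rfl

theorem wdeg_add (w e f : ι → ℕ) : wdeg w (e + f) = wdeg w e + wdeg w f := by
  simp [wdeg, add_mul, Finset.sum_add_distrib]

theorem wdeg_mono (w : ι → ℕ) {e f : ι → ℕ} (h : e ≤ f) : wdeg w e ≤ wdeg w f :=
  Finset.sum_le_sum fun i _ => Nat.mul_le_mul_right _ (h i)

theorem wdeg_lt {w : ι → ℕ} (hw : ∀ i, w i ≠ 0) {e f : ι → ℕ} (h : e < f) :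
    wdeg w e < wdeg w f := by
  obtain ⟨hle, i, hi⟩ := Pi.lt_def.1 h
  exact Finset.sum_lt_sum (fun i _ => Nat.mul_le_mul_right _ (hle i))
    ⟨i, Finset.mem_univ _, Nat.mul_lt_mul_of_pos_right hi (Nat.pos_of_ne_zero (hw i))⟩

theorem isUpperSet_levelSet (w : ι → ℕ) (n : ℕ) : IsUpperSet (levelSet w n) :=
  fun _ _ h h' => le_trans (mem_levelSet.1 h') (wdeg_mono w h)

theorem levelSet_anti (w : ι → ℕ) {m n : ℕ} (h : m ≤ n) : levelSet w n ⊆ levelSet w m :=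
  fun _ h' => h.trans h'

variable {x : ι → R} {w : ι → ℕ}

theorem monIdeal_levelSet_zero : monIdeal x (levelSet w 0) = ⊤ :=
  (Ideal.eq_top_iff_one _).2 (mon_zero (x := x) ▸ mon_mem_monIdeal (Nat.zero_le _))

theorem monIdeal_levelSet_mul {a b : ℕ} {f g : R} (hf : f ∈ monIdeal x (levelSet w a))
    (hg : g ∈ monIdeal x (levelSet w b)) : f * g ∈ monIdeal x (levelSet w (a + b)) := by
  have h : monIdeal x (levelSet w a) * monIdeal x (levelSet w b) ≤
      monIdeal x (levelSet w (a + b)) := by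
    rw [monIdeal, monIdeal, Ideal.span_mul_span', Ideal.span_le]
    rintro _ ⟨_, ⟨e, he, rfl⟩, _, ⟨e', he', rfl⟩, rfl⟩
    simp only [SetLike.mem_coe]
    rw [← mon_add]
    refine mon_mem_monIdeal ?_
    rw [mem_levelSet, wdeg_add]
    exact add_le_add he he'
  exact h (Ideal.mul_mem_mul hf hg)

theorem span_range_le_monIdeal_levelSet_one (hw : ∀ i, w i ≠ 0) :
    Ideal.span (Set.range x) ≤ monIdeal x (levelSet w 1) := by
  classical
  rw [Ideal.span_le]
  rintro _ ⟨i, rfl⟩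
  have : x i = mon x (Pi.single i 1) := by rw [mon_single, pow_one]
  rw [this]
  refine mon_mem_monIdeal ?_
  rw [mem_levelSet, wdeg]
  refine le_trans ?_ (Finset.single_le_sum (fun j _ => Nat.zero_le _) (Finset.mem_univ i))
  simpa using Nat.one_le_iff_ne_zero.2 (hw i)

theorem eval_mem_levelSet {k : ℕ} {F : MvPolynomial ι R}
    (hF : MvPolynomial.IsWeightedHomogeneous w F k) :
    MvPolynomial.eval x F ∈ monIdeal x (levelSet w k) := by
  rw [MvPolynomial.eval_eq']
  refine Ideal.sum_mem _ fun e he => Ideal.mul_mem_left _ _ (mon_mem_monIdeal (e := ⇑e) ?_)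
  have := hF (MvPolynomial.mem_support_iff.1 he)
  rw [Finsupp.weight_apply, Finsupp.sum_fintype _ _ (by simp)] at this
  exact this.ge

theorem exists_initial_form {k : ℕ} {f : R} (hf : f ∈ monIdeal x (levelSet w k)) :
    ∃ F : MvPolynomial ι R, MvPolynomial.IsWeightedHomogeneous w F k ∧
      f - MvPolynomial.eval x F ∈ monIdeal x (levelSet w (k + 1)) := by
  unfold monIdeal at hf
  induction hf using Submodule.span_induction with
  | mem f h =>
    obtain ⟨e, he, rfl⟩ := h
    rcases (mem_levelSet.1 he).eq_or_lt with h | h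
    · refine ⟨MvPolynomial.monomial (Finsupp.equivFunOnFinite.symm e) 1, ?_, ?_⟩
      · refine MvPolynomial.isWeightedHomogeneous_monomial _ _ _ ?_
        rw [Finsupp.weight_apply, Finsupp.sum_fintype _ _ (by simp)]
        exact h.symm
      · have : MvPolynomial.eval x (MvPolynomial.monomial (Finsupp.equivFunOnFinite.symm e) 1) =
            mon x e := by
          rw [MvPolynomial.eval_monomial, one_mul, Finsupp.prod_fintype _ _ (by simp)]
          rfl
        rw [this, sub_self]
        exact zero_mem _
    · exact ⟨0, MvPolynomial.isWeightedHomogeneous_zero _ _ _, by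
        simpa using mon_mem_monIdeal h⟩
  | zero => exact ⟨0, MvPolynomial.isWeightedHomogeneous_zero _ _ _, by simp⟩
  | add f g _ _ hf hg =>
    obtain ⟨F, hF, hF'⟩ := hf
    obtain ⟨G, hG, hG'⟩ := hg
    refine ⟨F + G, hF.add hG, ?_⟩
    have := add_mem hF' hG'
    rw [map_add]
    convert this using 1; ring
  | smul c f _ hf =>
    obtain ⟨F, hF, hF'⟩ := hf
    refine ⟨MvPolynomial.C c * F, ?_, ?_⟩
    · have := (MvPolynomial.isWeightedHomogeneous_C w c).mul hF
      rwa [zero_add] at this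
    · have := Ideal.mul_mem_left _ c hF'
      rw [map_mul, MvPolynomial.eval_C, smul_eq_mul]
      convert this using 1; ring

/-- This is the injectivity half of the description of the graded ring. As the weights are positive,
the exponents of degree at least `k` other than `e₀` form an upper set; a coefficient outside (x) at
`e₀` would contradict `mem_of_mul_mon_mem` for it. -/
theorem IsPrimeFamily.coeff_mem_of_eval_mem (hx : IsPrimeFamily x) (hw : ∀ i, w i ≠ 0) {k : ℕ}
    {F : MvPolynomial ι R} (hF : MvPolynomial.IsWeightedHomogeneous w F k)
    (h : MvPolynomial.eval x F ∈ monIdeal x (levelSet w (k + 1))) (e₀ : ι →₀ ℕ) :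
    F.coeff e₀ ∈ Ideal.span (Set.range x) := by
  classical
  by_contra hc
  have hc0 : F.coeff e₀ ≠ 0 := fun h0 => hc (h0 ▸ zero_mem _)
  have hwd : ∀ e, F.coeff e ≠ 0 → wdeg w e = k := fun e he => by
    have := hF he
    rwa [Finsupp.weight_apply, Finsupp.sum_fintype _ _ (by simp)] at this
  let E : Set (ι → ℕ) := {e | k ≤ wdeg w e ∧ e ≠ e₀}
  have hE : IsUpperSet E := by
    rintro e e' hee' ⟨h1, h2⟩
    refine ⟨h1.trans (wdeg_mono w hee'), ?_⟩
    rintro rfl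
    have h3 := wdeg_lt hw (lt_of_le_of_ne hee' h2)
    rw [hwd e₀ hc0] at h3
    omega
  have h1 : F.coeff e₀ * mon x e₀ ∈ monIdeal x E := by
    have h2 : MvPolynomial.eval x F ∈ monIdeal x E := by
      refine monIdeal_mono (fun e he => ?_) h
      rw [mem_levelSet] at he
      refine ⟨by omega, ?_⟩
      rintro rfl
      rw [hwd e₀ hc0] at he
      omega
    rw [MvPolynomial.eval_eq', ← Finset.add_sum_erase _ _ (MvPolynomial.mem_support_iff.2 hc0)] at h2
    refine (Ideal.add_mem_iff_left _ (Ideal.sum_mem _ fun e he => ?_)).1 h2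
    rw [Finset.mem_erase, MvPolynomial.mem_support_iff] at he
    exact Ideal.mul_mem_left _ _ (mon_mem_monIdeal (e := ⇑e)
      ⟨(hwd e he.2).ge, fun h => he.1 (DFunLike.coe_injective h)⟩)
  exact (hx.mem_of_mul_mon_mem hE hc h1).2 rfl

/-- Initial forms are nonzero modulo `P`, because coefficients in `P` raise the weighted order.
Their product is nonzero in the polynomial ring over the domain R/P, so the product of the elements
has no larger order. -/
theorem IsPrimeFamily.mul_notMem (hx : IsPrimeFamily x) (hw : ∀ i, w i ≠ 0) {a b : ℕ} {f g : R}
    (hf : f ∈ monIdeal x (levelSet w a)) (hf' : f ∉ monIdeal x (levelSet w (a + 1)))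
    (hg : g ∈ monIdeal x (levelSet w b)) (hg' : g ∉ monIdeal x (levelSet w (b + 1))) :
    f * g ∉ monIdeal x (levelSet w (a + b + 1)) := by
  intro h
  obtain ⟨F, hF, hfF⟩ := exists_initial_form hf
  obtain ⟨G, hG, hgG⟩ := exists_initial_form hg
  set P := Ideal.span (Set.range x) with hP
  have hPp : P.IsPrime := by simpa [hP] using hx.isPrime Set.univ
  have key : ∀ {k : ℕ} {f : R} {F : MvPolynomial ι R}, f ∉ monIdeal x (levelSet w (k + 1)) →
      MvPolynomial.IsWeightedHomogeneous w F k →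
      f - MvPolynomial.eval x F ∈ monIdeal x (levelSet w (k + 1)) →
      MvPolynomial.map (Ideal.Quotient.mk P) F ≠ 0 := by
    intro k f F hf hF hfF h0
    refine hf ?_
    have h1 : MvPolynomial.eval x F ∈ monIdeal x (levelSet w (k + 1)) := by
      rw [MvPolynomial.eval_eq']
      refine Ideal.sum_mem _ fun e he => ?_
      have h2 := hF (MvPolynomial.mem_support_iff.1 he)
      rw [Finsupp.weight_apply, Finsupp.sum_fintype _ _ (by simp)] at h2
      have h3 : F.coeff e ∈ P := by
        have := congrArg (MvPolynomial.coeff e) h0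
        rwa [MvPolynomial.coeff_map, MvPolynomial.coeff_zero, Ideal.Quotient.eq_zero_iff_mem] at this
      rw [add_comm]
      exact monIdeal_levelSet_mul (span_range_le_monIdeal_levelSet_one hw h3)
        (mon_mem_monIdeal (e := ⇑e) h2.ge)
    simpa using add_mem hfF h1
  have hFG : MvPolynomial.eval x (F * G) ∈ monIdeal x (levelSet w (a + b + 1)) := by
    have h1 : f * (g - MvPolynomial.eval x G) ∈ monIdeal x (levelSet w (a + b + 1)) := by
      rw [add_assoc]; exact monIdeal_levelSet_mul hf hgG
    have h2 : (f - MvPolynomial.eval x F) * MvPolynomial.eval x G ∈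
        monIdeal x (levelSet w (a + b + 1)) := by
      have := monIdeal_levelSet_mul hfF (eval_mem_levelSet hG (x := x))
      rwa [add_right_comm] at this
    have h3 := sub_mem (sub_mem h h1) h2
    rw [map_mul]
    convert h3 using 1; ring
  have hcoef := hx.coeff_mem_of_eval_mem hw (hF.mul hG) hFG
  have h0 : MvPolynomial.map (Ideal.Quotient.mk P) F * MvPolynomial.map (Ideal.Quotient.mk P) G =
      0 := by
    rw [← map_mul]
    ext e
    rw [MvPolynomial.coeff_map, MvPolynomial.coeff_zero, Ideal.Quotient.eq_zero_iff_mem]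
    exact hcoef e
  rcases mul_eq_zero.1 h0 with h0 | h0
  · exact key hf' hF hfF h0
  · exact key hg' hG hgG h0

theorem IsPrimeFamily.exists_notMem_levelSet [IsDomain R] [IsNoetherianRing R]
    (hx : IsPrimeFamily x) {f : R} (hf : f ≠ 0) :
    ∃ n, f ∉ monIdeal x (levelSet w n) := by
  by_contra! h
  set P := Ideal.span (Set.range x) with hP
  have hPp : P.IsPrime := by simpa [hP] using hx.isPrime Set.univ
  have hmon : ∀ e : ι → ℕ, mon x e ∈ P ^ ∑ i, e i := fun e => by
    rw [mon, ← Finset.prod_pow_eq_pow_sum]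
    exact Ideal.prod_mem_prod fun i _ => Ideal.pow_mem_pow
      (Ideal.subset_span (Set.mem_range_self i) : x i ∈ P) _
  have h0 : f ∈ ⨅ j : ℕ, P ^ j := by
    rw [Ideal.mem_iInf]
    intro j
    -- The weighted degree is at most (∑ w + 1) times the ordinary degree, so this level lies in the
    -- j-th power of `P`; the summand 1 keeps the factor positive. Krull's intersection theorem
    -- concludes.
    refine (monIdeal_le_iff.2 fun e he => ?_) (h ((∑ i, w i + 1) * j))
    refine Ideal.pow_le_pow_right ?_ (hmon e)
    have h1 : wdeg w e ≤ (∑ i, w i + 1) * ∑ i, e i := by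
      rw [Finset.mul_sum]
      refine Finset.sum_le_sum fun i _ => ?_
      rw [mul_comm]
      refine Nat.mul_le_mul_right _ ?_
      have := Finset.single_le_sum (fun j _ => Nat.zero_le (w j)) (Finset.mem_univ i)
      omega
    exact Nat.le_of_mul_le_mul_left (he.trans h1) (by omega)
  rw [Ideal.iInf_pow_eq_bot_of_isDomain P hPp.ne_top] at h0
  exact hf h0

/-- The weighted order of a nonzero element. -/
theorem IsPrimeFamily.exists_order [IsDomain R] [IsNoetherianRing R] (hx : IsPrimeFamily x)
    (hw : ∀ i, w i ≠ 0) : ∃ o : R → ℕ, (∀ f, f ≠ 0 → ∀ n, f ∈ monIdeal x (levelSet w n) ↔ n ≤ o f) ∧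
      ∀ f g, f ≠ 0 → g ≠ 0 → o (f * g) = o f + o g := by
  classical
  have h1 : ∀ f : R, ∃ k, f ≠ 0 → ∀ n, f ∈ monIdeal x (levelSet w n) ↔ n ≤ k := by
    intro f
    by_cases hf : f = 0
    · exact ⟨0, fun h => absurd hf h⟩
    · have hex := hx.exists_notMem_levelSet (w := w) hf
      refine ⟨Nat.find hex - 1, fun _ n => ?_⟩
      have hpos : Nat.find hex ≠ 0 := fun h0 => by
        have := Nat.find_spec hex
        rw [h0, monIdeal_levelSet_zero] at this
        exact this trivial
      constructor
      · intro hn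
        by_contra hlt
        exact Nat.find_spec hex (monIdeal_mono (levelSet_anti w (by omega)) hn)
      · intro hn
        by_contra hn'
        have := Nat.find_min' hex hn'
        omega
  choose o ho using h1
  refine ⟨o, ho, fun f g hf hg => ?_⟩
  have hf1 := (ho f hf _).2 le_rfl
  have hg1 := (ho g hg _).2 le_rfl
  have hf2 : f ∉ monIdeal x (levelSet w (o f + 1)) := fun h => by
    have := (ho f hf _).1 h; omega
  have hg2 : g ∉ monIdeal x (levelSet w (o g + 1)) := fun h => by
    have := (ho g hg _).1 h; omega
  have h3 := (ho _ (mul_ne_zero hf hg) _).1 (monIdeal_levelSet_mul hf1 hg1)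
  have h4 := hx.mul_notMem hw hf1 hf2 hg1 hg2
  rw [ho _ (mul_ne_zero hf hg)] at h4
  omega

theorem IsPrimeFamily.mon_mem_levelSet (hx : IsPrimeFamily x) {e : ι → ℕ} {n : ℕ} :
    mon x e ∈ monIdeal x (levelSet w n) ↔ n ≤ wdeg w e := by
  refine ⟨fun h => ?_, fun h => mon_mem_monIdeal (mem_levelSet.2 h)⟩
  have hP : (1 : R) ∉ Ideal.span (Set.range x) := fun h => by
    have hPp : (Ideal.span (Set.range x)).IsPrime := by simpa using hx.isPrime Set.univ
    exact hPp.ne_top ((Ideal.eq_top_iff_one _).2 h)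
  exact hx.mem_of_mul_mon_mem (isUpperSet_levelSet w n) hP (by rwa [one_mul])

theorem IsPrimeFamily.ne_zero [IsDomain R] (hx : IsPrimeFamily x) (i : ι) : x i ≠ 0 := fun h =>
  hx.notMem ∅ i (by simp) (by simp [h])

theorem IsPrimeFamily.mon_ne_zero [IsDomain R] (hx : IsPrimeFamily x) (e : ι → ℕ) :
    mon x e ≠ 0 :=
  Finset.prod_ne_zero_iff.2 fun i _ => pow_ne_zero _ (hx.ne_zero i)

end WeightedOrder

/-! ### Discrete valuation rings from order functions -/

section OrderValuation

open IsLocalRing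

variable {R K : Type*} [CommRing R] [IsDomain R] [Field K] [Algebra R K] [IsFractionRing R K]

/-- A function on the nonzero elements of a domain with the properties of a discrete valuation. -/
structure IsOrderFunction (o : R → ℕ) : Prop where
  mul : ∀ f g, f ≠ 0 → g ≠ 0 → o (f * g) = o f + o g
  add : ∀ f g, f ≠ 0 → g ≠ 0 → f + g ≠ 0 → ∀ n, n ≤ o f → n ≤ o g → n ≤ o (f + g)

/-- The extension of an order function to the field of fractions (with a junk value at `0`). -/
def fracOrder (o : R → ℕ) (z : K) : ℤ :=
  (o (IsLocalization.sec (nonZeroDivisors R) z).1 : ℤ) -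
    o ((IsLocalization.sec (nonZeroDivisors R) z).2 : R)

variable {o : R → ℕ}

theorem IsOrderFunction.fracOrder_eq (ho : IsOrderFunction o) {z : K} (hz : z ≠ 0) {a b : R}
    (hb : b ≠ 0) (h : z * algebraMap R K b = algebraMap R K a) : fracOrder o z = o a - o b := by
  have hinj := IsFractionRing.injective R K
  have h1 := IsLocalization.sec_spec (nonZeroDivisors R) z
  set c := (IsLocalization.sec (nonZeroDivisors R) z).1 with hc
  set d := (IsLocalization.sec (nonZeroDivisors R) z).2 with hd
  have hd0 : (d : R) ≠ 0 := nonZeroDivisors.coe_ne_zero d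
  have ha0 : a ≠ 0 := by
    rintro rfl
    rw [map_zero] at h
    exact (mul_ne_zero hz (by simpa using hinj.ne hb)) h
  have hc0 : c ≠ 0 := by
    intro h0
    rw [h0, map_zero] at h1
    exact (mul_ne_zero hz (by simp)) h1
  have h2 : a * d = c * b := by
    apply hinj
    rw [map_mul, map_mul, ← h, ← h1]; ring
  have h3 := congrArg o h2
  rw [ho.mul _ _ ha0 hd0, ho.mul _ _ hc0 hb] at h3
  rw [fracOrder, ← hc, ← hd]
  omega

theorem exists_frac_rep (z : K) (hz : z ≠ 0) :
    ∃ a b : R, a ≠ 0 ∧ b ≠ 0 ∧ z * algebraMap R K b = algebraMap R K a := by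
  obtain ⟨a, b, hb, h⟩ := IsFractionRing.div_surjective (A := R) z
  have hb0 := nonZeroDivisors.ne_zero hb
  have hb1 : algebraMap R K b ≠ 0 := by simpa using (IsFractionRing.injective R K).ne hb0
  refine ⟨a, b, ?_, hb0, by rw [← h, div_mul_cancel₀ _ hb1]⟩
  rintro rfl
  rw [map_zero, zero_div] at h
  exact hz h.symm

theorem IsOrderFunction.fracOrder_algebraMap (ho : IsOrderFunction o) {a : R} (ha : a ≠ 0) :
    fracOrder o (algebraMap R K a) = o a := by
  have h1 : o 1 = 0 := by
    have := ho.mul 1 1 one_ne_zero one_ne_zero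
    rw [mul_one] at this; omega
  rw [ho.fracOrder_eq (a := a) (b := 1) (by simpa using (IsFractionRing.injective R K).ne ha)
    one_ne_zero (by simp), h1]
  simp

theorem IsOrderFunction.fracOrder_mul (ho : IsOrderFunction o) {z z' : K} (hz : z ≠ 0)
    (hz' : z' ≠ 0) : fracOrder o (z * z') = fracOrder o z + fracOrder o z' := by
  obtain ⟨a, b, ha, hb, h⟩ := exists_frac_rep (R := R) z hz
  obtain ⟨a', b', ha', hb', h'⟩ := exists_frac_rep (R := R) z' hz'
  rw [ho.fracOrder_eq hz hb h, ho.fracOrder_eq hz' hb' h',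
    ho.fracOrder_eq (a := a * a') (b := b * b') (mul_ne_zero hz hz') (mul_ne_zero hb hb')
      (by rw [map_mul, map_mul, ← h, ← h']; ring), ho.mul _ _ ha ha', ho.mul _ _ hb hb']
  push_cast; ring

theorem IsOrderFunction.fracOrder_one (ho : IsOrderFunction o) : fracOrder o (1 : K) = 0 := by
  have := ho.fracOrder_mul (one_ne_zero (α := K)) (one_ne_zero (α := K))
  rw [mul_one] at this; omega

theorem IsOrderFunction.fracOrder_inv (ho : IsOrderFunction o) {z : K} (hz : z ≠ 0) :
    fracOrder o z⁻¹ = -fracOrder o z := by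
  have := ho.fracOrder_mul hz (inv_ne_zero hz)
  rw [mul_inv_cancel₀ hz, ho.fracOrder_one] at this; omega

theorem IsOrderFunction.fracOrder_pow (ho : IsOrderFunction o) {z : K} (hz : z ≠ 0) (n : ℕ) :
    fracOrder o (z ^ n) = n * fracOrder o z := by
  induction n with
  | zero => simp [ho.fracOrder_one]
  | succ n ih => rw [pow_succ, ho.fracOrder_mul (pow_ne_zero _ hz) hz, ih]; push_cast; ring

theorem IsOrderFunction.fracOrder_zpow (ho : IsOrderFunction o) {z : K} (hz : z ≠ 0) (n : ℤ) :
    fracOrder o (z ^ n) = n * fracOrder o z := by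
  cases n with
  | ofNat n => simpa using ho.fracOrder_pow hz n
  | negSucc n =>
    rw [zpow_negSucc, ho.fracOrder_inv (pow_ne_zero _ hz), ho.fracOrder_pow hz,
      Int.negSucc_eq]
    push_cast; ring

theorem IsOrderFunction.fracOrder_prod (ho : IsOrderFunction o) {α : Type*} (s : Finset α)
    (f : α → K) (hf : ∀ i ∈ s, f i ≠ 0) :
    fracOrder o (∏ i ∈ s, f i) = ∑ i ∈ s, fracOrder o (f i) := by
  classical
  induction s using Finset.induction_on with
  | empty => simp [ho.fracOrder_one]
  | insert a s ha ih =>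
    rw [Finset.prod_insert ha, Finset.sum_insert ha,
      ho.fracOrder_mul (hf a (Finset.mem_insert_self _ _)) (Finset.prod_ne_zero_iff.2 fun i hi =>
        hf i (Finset.mem_insert_of_mem hi)), ih fun i hi => hf i (Finset.mem_insert_of_mem hi)]

theorem IsOrderFunction.le_fracOrder_add (ho : IsOrderFunction o) {z z' : K} (hz : z ≠ 0)
    (hz' : z' ≠ 0) (hzz : z + z' ≠ 0) (h0 : 0 ≤ fracOrder o z) (h0' : 0 ≤ fracOrder o z') :
    0 ≤ fracOrder o (z + z') := by
  obtain ⟨a, b, ha, hb, h⟩ := exists_frac_rep (R := R) z hz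
  obtain ⟨a', b', ha', hb', h'⟩ := exists_frac_rep (R := R) z' hz'
  have hsum : (z + z') * algebraMap R K (b * b') = algebraMap R K (a * b' + a' * b) := by
    rw [map_add, map_mul, map_mul, map_mul, ← h, ← h']; ring
  have hne : a * b' + a' * b ≠ 0 := by
    intro h1
    rw [h1, map_zero] at hsum
    exact mul_ne_zero hzz (by simpa using (IsFractionRing.injective R K).ne (mul_ne_zero hb hb')) hsum
  rw [ho.fracOrder_eq hz hb h] at h0
  rw [ho.fracOrder_eq hz' hb' h'] at h0'
  rw [ho.fracOrder_eq hzz (mul_ne_zero hb hb') hsum, ho.mul _ _ hb hb']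
  have := ho.add (a * b') (a' * b) (mul_ne_zero ha hb') (mul_ne_zero ha' hb) hne (o b + o b')
    (by rw [ho.mul _ _ ha hb']; omega) (by rw [ho.mul _ _ ha' hb]; omega)
  omega

/-- The valuation ring of an order function. -/
def IsOrderFunction.valuationOver (K : Type*) [Field K] [Algebra R K] [IsFractionRing R K]
    (ho : IsOrderFunction o) : ValuationOver R K where
  carrier := {z | z = 0 ∨ 0 ≤ fracOrder o z}
  mul_mem' := by
    rintro z z' hz hz'
    by_cases h : z = 0
    · left; rw [h, zero_mul]
    by_cases h' : z' = 0
    · left; rw [h', mul_zero]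
    right
    rw [ho.fracOrder_mul h h']
    exact add_nonneg (hz.resolve_left h) (hz'.resolve_left h')
  add_mem' := by
    rintro z z' hz hz'
    by_cases h : z = 0
    · rwa [h, zero_add]
    by_cases h' : z' = 0
    · rwa [h', add_zero]
    by_cases h'' : z + z' = 0
    · exact Or.inl h''
    exact Or.inr (ho.le_fracOrder_add h h' h'' (hz.resolve_left h) (hz'.resolve_left h'))
  algebraMap_mem' := by
    intro r
    by_cases h : r = 0
    · left; rw [h, map_zero]
    · right; rw [ho.fracOrder_algebraMap h]; exact Int.natCast_nonneg _
  mem_or_inv_mem' := by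
    intro z
    by_cases h : z = 0
    · exact Or.inl (Or.inl h)
    · rcases le_total 0 (fracOrder o z) with h1 | h1
      · exact Or.inl (Or.inr h1)
      · exact Or.inr (Or.inr (by rw [ho.fracOrder_inv h]; omega))

variable (ho : IsOrderFunction o)

theorem IsOrderFunction.mem_ring {z : K} :
    z ∈ (ho.valuationOver K).ring ↔ z = 0 ∨ 0 ≤ fracOrder o z := Iff.rfl

theorem IsOrderFunction.isUnit_iff (z : (ho.valuationOver K).ring) :
    IsUnit z ↔ (z : K) ≠ 0 ∧ fracOrder o (z : K) = 0 := by
  constructor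
  · rintro ⟨u, rfl⟩
    have h1 : ((u : (ho.valuationOver K).ring) : K) * ((↑u⁻¹ : (ho.valuationOver K).ring) : K) = 1 := by
      rw [← MulMemClass.coe_mul, Units.mul_inv]; rfl
    have h2 := left_ne_zero_of_mul_eq_one h1
    have h3 := right_ne_zero_of_mul_eq_one h1
    have h4 := ho.fracOrder_mul h2 h3
    rw [h1, ho.fracOrder_one] at h4
    have h5 := (ho.mem_ring.1 (u : (ho.valuationOver K).ring).2).resolve_left h2
    have h6 := (ho.mem_ring.1 (↑u⁻¹ : (ho.valuationOver K).ring).2).resolve_left h3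
    exact ⟨h2, by omega⟩
  · rintro ⟨h1, h2⟩
    have h3 : (z : K)⁻¹ ∈ (ho.valuationOver K).ring :=
      ho.mem_ring.2 (Or.inr (by rw [ho.fracOrder_inv h1, h2, neg_zero]))
    refine IsUnit.of_mul_eq_one (⟨_, h3⟩ : (ho.valuationOver K).ring) ?_
    ext
    exact mul_inv_cancel₀ h1

variable {p : (ho.valuationOver K).ring} (hp0 : (p : K) ≠ 0) (hp : fracOrder o (p : K) = 1)
include hp0 hp

theorem IsOrderFunction.pow_dvd_iff (n : ℕ) (z : (ho.valuationOver K).ring) :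
    p ^ n ∣ z ↔ (z : K) = 0 ∨ (n : ℤ) ≤ fracOrder o (z : K) := by
  have hpn : (p : K) ^ n ≠ 0 := pow_ne_zero _ hp0
  constructor
  · rintro ⟨y, rfl⟩
    by_cases hy : (y : K) = 0
    · left; simp [hy]
    · right
      have h1 := (ho.mem_ring.1 y.2).resolve_left hy
      simp only [MulMemClass.coe_mul, SubmonoidClass.coe_pow]
      rw [ho.fracOrder_mul hpn hy, ho.fracOrder_pow hp0, hp]
      omega
  · intro h
    rcases h with h | h
    · rw [show z = 0 from Subtype.ext h]; exact dvd_zero _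
    · by_cases hz : (z : K) = 0
      · rw [show z = 0 from Subtype.ext hz]; exact dvd_zero _
      have h1 : (z : K) * ((p : K) ^ n)⁻¹ ∈ (ho.valuationOver K).ring := by
        refine ho.mem_ring.2 (Or.inr ?_)
        rw [ho.fracOrder_mul hz (inv_ne_zero hpn), ho.fracOrder_inv hpn, ho.fracOrder_pow hp0, hp]
        omega
      refine ⟨⟨_, h1⟩, ?_⟩
      ext
      simp only [MulMemClass.coe_mul, SubmonoidClass.coe_pow]
      field_simp

theorem IsOrderFunction.maximalIdeal_eq :
    maximalIdeal (ho.valuationOver K).ring = Ideal.span {p} := by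
  ext z
  rw [mem_maximalIdeal, mem_nonunits_iff, ho.isUnit_iff, Ideal.mem_span_singleton]
  have h1 := ho.pow_dvd_iff hp0 hp 1 z
  rw [pow_one] at h1
  rw [h1]
  have h2 := ho.mem_ring.1 z.2
  push_cast
  constructor
  · intro h
    by_cases hz : (z : K) = 0
    · exact Or.inl hz
    · right
      have h3 := h2.resolve_left hz
      have h4 : fracOrder o (z : K) ≠ 0 := fun h4 => h ⟨hz, h4⟩
      omega
  · rintro (h | h) ⟨h3, h4⟩
    · exact h3 h
    · omega

theorem IsOrderFunction.le_val_iff (n : ℕ) (z : (ho.valuationOver K).ring) :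
    (n : ℕ∞) ≤ (ho.valuationOver K).val z ↔ (z : K) = 0 ∨ (n : ℤ) ≤ fracOrder o (z : K) := by
  rw [ValuationOver.le_val_iff, ho.maximalIdeal_eq hp0 hp, Ideal.span_singleton_pow,
    Ideal.mem_span_singleton, ho.pow_dvd_iff hp0 hp]

/-- An element of order one generates the maximal ideal, and dividing by the right power of it
leaves a unit. -/
theorem IsOrderFunction.isDiscreteValuationRing :
    IsDiscreteValuationRing (ho.valuationOver K).ring := by
  refine IsDiscreteValuationRing.ofHasUnitMulPowIrreducibleFactorization ⟨p, ?_, ?_⟩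
  · constructor
    · rw [ho.isUnit_iff, hp]; simp
    · intro a b hab
      have hab' : (p : K) = (a : K) * (b : K) := by rw [hab]; rfl
      have ha : (a : K) ≠ 0 := left_ne_zero_of_mul (hab' ▸ hp0)
      have hb : (b : K) ≠ 0 := right_ne_zero_of_mul (hab' ▸ hp0)
      rw [hab', ho.fracOrder_mul ha hb] at hp
      have h1 := (ho.mem_ring.1 a.2).resolve_left ha
      have h2 := (ho.mem_ring.1 b.2).resolve_left hb
      rw [ho.isUnit_iff, ho.isUnit_iff]
      rcases h1.eq_or_lt with h3 | h3
      · exact Or.inl ⟨ha, h3.symm⟩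
      · exact Or.inr ⟨hb, by omega⟩
  · intro z hz
    have hz' : (z : K) ≠ 0 := fun h => hz (Subtype.ext h)
    have h1 := (ho.mem_ring.1 z.2).resolve_left hz'
    obtain ⟨n, hn⟩ := Int.eq_ofNat_of_zero_le h1
    refine ⟨n, ?_⟩
    obtain ⟨y, hy⟩ := (ho.pow_dvd_iff hp0 hp n z).2 (Or.inr hn.ge)
    have hy' : (z : K) = (p : K) ^ n * (y : K) := by rw [hy]; rfl
    have hy0 : (y : K) ≠ 0 := right_ne_zero_of_mul (hy' ▸ hz')
    have hyu : IsUnit y := by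
      rw [ho.isUnit_iff]
      refine ⟨hy0, ?_⟩
      rw [hy', ho.fracOrder_mul (pow_ne_zero _ hp0) hy0, ho.fracOrder_pow hp0, hp] at hn
      omega
    obtain ⟨u, rfl⟩ := hyu
    exact ⟨u, hy.symm⟩

end OrderValuation

/-! ### An explicit element of the Jacobian ideal -/

section MonomialJacobian

variable {ι R V : Type*} [Fintype ι] [CommRing R] [CommRing V] [Algebra R V]

/-- The logarithmic derivative of a unit. -/
def kaehlerLog (R V : Type*) [CommRing R] [CommRing V] [Algebra R V] :
    Additive Vˣ →+ Ω[V⁄R] where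
  toFun q := ((q.toMul⁻¹ : Vˣ) : V) • KaehlerDifferential.D R V (q.toMul : V)
  map_zero' := by simp
  map_add' a b := by
    simp only [toMul_add, Units.val_mul, mul_inv, Derivation.leibniz, smul_add, smul_smul]
    rw [add_comm]
    congr 1
    · congr 1
      calc _ = (((Additive.toMul b)⁻¹ * Additive.toMul b : Vˣ) : V) * ((Additive.toMul a)⁻¹ : Vˣ) := by
            push_cast; ring
        _ = _ := by simp
    · congr 1
      calc _ = (((Additive.toMul a)⁻¹ * Additive.toMul a : Vˣ) : V) * ((Additive.toMul b)⁻¹ : Vˣ) := by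
            push_cast; ring
        _ = _ := by simp

/-- Logarithmic differentiation of the multiplicative relation between the units. -/
theorem sum_smul_kaehler_eq_zero {q : ι → Vˣ} {u : ι → ℤ} (hu : ∏ i, q i ^ u i = 1) :
    ∑ i, ((u i : V) * ((q i)⁻¹ : Vˣ)) • KaehlerDifferential.D R V (q i : V) = 0 := by
  have h : kaehlerLog R V (Additive.ofMul (∏ i, q i ^ u i)) = 0 := by
    rw [hu, ofMul_one, map_zero]
  rw [ofMul_prod, map_sum] at h
  rw [← h]
  refine Finset.sum_congr rfl fun i _ => ?_
  rw [ofMul_zpow, map_zsmul, mul_smul, ← Int.cast_smul_eq_zsmul V]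
  rfl

/-- Multiplying the last column by `p` makes it the combination `b` of the other columns, up to the
entry 1 in the corner, because `C * b` = ∑ uᵢwᵢ = 1. Subtracting that combination leaves a
triangular matrix. The extra factor `p` avoids a truncated exponent. -/
theorem det_fromBlocks_diagonal_pow [IsDomain V] [DecidableEq ι] {p : V} {q : ι → Vˣ}
    {w : ι → ℕ} {u : ι → ℤ} (hw : ∀ i, w i ≠ 0) (huw : ∑ i, u i * (w i : ℤ) = 1) :
    (Matrix.fromBlocks (Matrix.diagonal fun i => p ^ w i)
      (Matrix.of fun i (_ : Unit) => (w i : V) * p ^ (w i - 1) * (q i : V))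
      (Matrix.of fun (_ : Unit) j => (u j : V) * ((q j)⁻¹ : Vˣ)) 0).det * p =
      -p ^ ∑ i, w i := by
  set A : Matrix ι ι V := Matrix.diagonal fun i => p ^ w i
  set B : Matrix ι Unit V := Matrix.of fun i (_ : Unit) => (w i : V) * p ^ (w i - 1) * (q i : V)
  set C : Matrix Unit ι V := Matrix.of fun (_ : Unit) j => (u j : V) * ((q j)⁻¹ : Vˣ)
  set b : Matrix ι Unit V := Matrix.of fun i (_ : Unit) => (w i : V) * (q i : V)
  have hCb : C * b = 1 := by
    ext i j
    simp only [Matrix.mul_apply, C, b, Matrix.of_apply]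
    rw [show (1 : Matrix Unit Unit V) i j = ((1 : ℤ) : V) by simp, ← huw]
    push_cast
    refine Finset.sum_congr rfl fun k _ => ?_
    calc _ = (u k : V) * w k * (((q k)⁻¹ * q k : Vˣ) : V) := by push_cast; ring
      _ = _ := by simp
  set P : Matrix Unit Unit V := Matrix.of fun _ _ => p with hP
  have hAb : A * b = B * P := by
    ext i j
    simp only [Matrix.mul_apply, A, B, b, P, Matrix.of_apply, Matrix.diagonal_apply, ite_mul, zero_mul,
      Finset.sum_ite_eq, Finset.mem_univ, if_true, Finset.univ_unique, Finset.sum_singleton]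
    obtain ⟨k, hk⟩ := Nat.exists_eq_succ_of_ne_zero (hw i)
    rw [hk, Nat.succ_sub_one, pow_succ]; ring
  have hprod : Matrix.fromBlocks A B C 0 * Matrix.fromBlocks 1 0 0 P =
      Matrix.fromBlocks A 0 C (-1) * Matrix.fromBlocks 1 b 0 1 := by
    rw [Matrix.fromBlocks_multiply, Matrix.fromBlocks_multiply]
    simp only [mul_one, add_zero, zero_mul, hAb, hCb]
    simp
  have h := congrArg Matrix.det hprod
  rw [Matrix.det_mul, Matrix.det_mul, Matrix.det_fromBlocks_zero₁₂, Matrix.det_fromBlocks_zero₁₂,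
    Matrix.det_fromBlocks_zero₂₁] at h
  simpa [A, P, Matrix.det_diagonal, Finset.prod_pow_eq_pow_sum] using h

/-- The generators of Ω are the dqᵢ and dp. The square matrix of relations has one row for each dxᵢ
= 0, from xᵢ = qᵢ p^{wᵢ}, and one for the multiplicative relation between the qᵢ. -/
theorem exists_mem_jacobianIdeal_mul_eq [IsDomain V] {x : ι → R} {p : V}
    {q : ι → Vˣ} {w : ι → ℕ} {u : ι → ℤ} (hw : ∀ i, w i ≠ 0) (huw : ∑ i, u i * (w i : ℤ) = 1)
    (hu : ∏ i, q i ^ u i = 1) (hx : ∀ i, algebraMap R V (x i) = (q i : V) * p ^ w i)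
    (hs : ∀ z, ∃ t ∈ Algebra.adjoin R
      (insert p (Set.range (fun i => (q i : V)) ∪ Set.range (fun i => ((q i)⁻¹ : Vˣ).val))),
      IsUnit t ∧ z * t ∈ Algebra.adjoin R
      (insert p (Set.range (fun i => (q i : V)) ∪ Set.range (fun i => ((q i)⁻¹ : Vˣ).val)))) :
    ∃ D ∈ jacobianIdeal R V, D * p = -p ^ ∑ i, w i := by
  classical
  refine ⟨_, ?_, det_fromBlocks_diagonal_pow (q := q) hw huw⟩
  refine det_mem_fittingIdealZero (Sum.elim (fun i => KaehlerDifferential.D R V (q i : V))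
    fun _ => KaehlerDifferential.D R V p) ?_ _ ?_
  · refine span_kaehler_eq_top _ hs _ ?_
    have hq : ∀ i, KaehlerDifferential.D R V (q i : V) ∈ Submodule.span V (Set.range
        (Sum.elim (fun i => KaehlerDifferential.D R V (q i : V))
          fun _ : Unit => KaehlerDifferential.D R V p)) :=
      fun i => Submodule.subset_span ⟨Sum.inl i, rfl⟩
    rintro a (rfl | ⟨i, rfl⟩ | ⟨i, rfl⟩)
    · exact Submodule.subset_span ⟨Sum.inr (), rfl⟩
    · exact hq i
    · show KaehlerDifferential.D R V (((q i)⁻¹ : Vˣ) : V) ∈ _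
      rw [Derivation.leibniz_of_mul_eq_one _ (show (((q i)⁻¹ : Vˣ) : V) * q i = 1 by simp)]
      exact Submodule.smul_mem _ _ (hq i)
  · rintro (i | i)
    · have h := (KaehlerDifferential.D R V).map_algebraMap (x i)
      rw [hx, Derivation.leibniz, Derivation.leibniz_pow] at h
      rw [← h]
      simp only [Fintype.sum_sum_type, Matrix.fromBlocks_apply₁₁, Matrix.fromBlocks_apply₁₂,
        Sum.elim_inl, Sum.elim_inr, Matrix.diagonal_apply, ite_smul, zero_smul, Finset.sum_ite_eq,
        Finset.mem_univ, if_true, Finset.univ_unique, Finset.sum_singleton, Matrix.of_apply]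
      rw [add_comm]
      congr 1
      rw [← Nat.cast_smul_eq_nsmul V, smul_smul, smul_smul]
      congr 1; ring
    · simpa [Fintype.sum_sum_type] using sum_smul_kaehler_eq_zero (R := R) hu

end MonomialJacobian

/-! ### Monomial valuations for positive primitive weights -/

section MonomialValuation

variable {ι R K : Type*} [Fintype ι] [CommRing R] [IsDomain R] [Field K] [Algebra R K]
  [IsFractionRing R K] {x : ι → R} {w : ι → ℕ}

theorem IsPrimeFamily.exists_isOrderFunction [IsNoetherianRing R] (hx : IsPrimeFamily x)
    (hw : ∀ i, w i ≠ 0) :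
    ∃ o : R → ℕ, IsOrderFunction o ∧ (∀ f ≠ 0, ∀ n, f ∈ monIdeal x (levelSet w n) ↔ n ≤ o f) ∧
      ∀ e, o (mon x e) = wdeg w e := by
  obtain ⟨o, h1, h2⟩ := hx.exists_order hw
  refine ⟨o, ⟨h2, fun f g hf hg hfg n hnf hng => ?_⟩, h1, fun e => ?_⟩
  · rw [← h1 _ hfg]
    exact Ideal.add_mem _ ((h1 _ hf n).2 hnf) ((h1 _ hg n).2 hng)
  · refine eq_of_forall_le_iff fun n => ?_
    rw [← h1 _ (hx.mon_ne_zero e), hx.mon_mem_levelSet]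

/-- Clears denominators: a fraction of nonnegative order can be divided by the power of `p` given by
the order of its denominator, leaving a unit of the finitely generated subalgebra below. -/
theorem exists_mem_adjoin_mul_pow_eq {V : Type*} [CommRing V] [Algebra R V] {s : Set V} {p : V}
    {q : ι → V} (hp : p ∈ Algebra.adjoin R s) (hq : ∀ i, q i ∈ Algebra.adjoin R s)
    (hxq : ∀ i, algebraMap R V (x i) = q i * p ^ w i) {n : ℕ} {f : R}
    (hf : f ∈ monIdeal x (levelSet w n)) :
    ∃ a ∈ Algebra.adjoin R s, algebraMap R V f = a * p ^ n := by
  induction hf using Submodule.span_induction with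
  | mem f hf =>
    obtain ⟨e, he, rfl⟩ := hf
    refine ⟨(∏ i, q i ^ e i) * p ^ (wdeg w e - n), mul_mem (prod_mem fun i _ => pow_mem (hq i) _)
      (pow_mem hp _), ?_⟩
    rw [mul_assoc, ← pow_add, Nat.sub_add_cancel he, mon, map_prod, wdeg,
      ← Finset.prod_pow_eq_pow_sum, ← Finset.prod_mul_distrib]
    refine Finset.prod_congr rfl fun i _ => ?_
    rw [map_pow, hxq, mul_pow, ← pow_mul, mul_comm (e i)]
  | zero => exact ⟨0, zero_mem _, by simp⟩
  | add f g _ _ hf hg =>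
    obtain ⟨a, ha, h1⟩ := hf
    obtain ⟨b, hb, h2⟩ := hg
    exact ⟨a + b, add_mem ha hb, by rw [map_add, h1, h2, add_mul]⟩
  | smul c f _ hf =>
    obtain ⟨a, ha, h1⟩ := hf
    exact ⟨algebraMap R V c * a, mul_mem (Subalgebra.algebraMap_mem _ _) ha, by
      rw [smul_eq_mul, map_mul, h1, mul_assoc]⟩

theorem IsPrimeFamily.exists_valuationOver (K : Type*) [Field K] [Algebra R K]
    [IsFractionRing R K] [IsNoetherianRing R] (hx : IsPrimeFamily x)
    (hw : ∀ i, w i ≠ 0) {u : ι → ℤ} (huw : ∑ i, u i * (w i : ℤ) = 1) :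
    ∃ v : ValuationOver R K, IsDiscreteValuationRing v.ring ∧
      (∀ (n : ℕ) (r : R), (n : ℕ∞) ≤ v.baseVal r ↔ r ∈ monIdeal x (levelSet w n)) ∧
      v.IsEssFiniteType ∧ v.jacobianVal + 1 ≤ ((∑ i, w i : ℕ) : ℕ∞) := by
  classical
  obtain ⟨o, ho, hoM, hom⟩ := hx.exists_isOrderFunction hw
  have hinj := IsFractionRing.injective R K
  have hxK : ∀ i, algebraMap R K (x i) ≠ 0 := fun i => by simpa using hinj.ne (hx.ne_zero i)
  have hox : ∀ i, fracOrder o (algebraMap R K (x i)) = w i := by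
    intro i
    rw [ho.fracOrder_algebraMap (hx.ne_zero i)]
    have := hom (Pi.single i 1)
    rw [mon_single, pow_one] at this
    rw [this, wdeg, Finset.sum_eq_single i (by intro j _ hj; simp [hj]) (by simp)]
    simp
  -- By the Bézout relation this Laurent monomial has order 1. The quotients of `x i` by `π ^ w i`
  -- are then units, and the product of their powers with exponents `u i` is 1.
  set π : K := ∏ i, algebraMap R K (x i) ^ u i with hπ
  have hπ0 : π ≠ 0 := Finset.prod_ne_zero_iff.2 fun i _ => zpow_ne_zero _ (hxK i)
  have hoπ : fracOrder o π = 1 := by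
    rw [hπ, ho.fracOrder_prod _ _ fun i _ => zpow_ne_zero _ (hxK i), ← huw]
    exact Finset.sum_congr rfl fun i _ => by rw [ho.fracOrder_zpow (hxK i), hox]
  set v := ho.valuationOver K with hv
  set p : v.ring := ⟨π, ho.mem_ring.2 (Or.inr (by rw [hoπ]; exact zero_le_one))⟩ with hp
  have hpow : ∀ i, fracOrder o (π ^ w i)⁻¹ = -(w i : ℤ) := fun i => by
    rw [ho.fracOrder_inv (pow_ne_zero _ hπ0), ho.fracOrder_pow hπ0, hoπ, mul_one]
  have hq0 : ∀ i, algebraMap R K (x i) * (π ^ w i)⁻¹ ≠ 0 := fun i =>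
    mul_ne_zero (hxK i) (inv_ne_zero (pow_ne_zero _ hπ0))
  have hoq : ∀ i, fracOrder o (algebraMap R K (x i) * (π ^ w i)⁻¹) = 0 := fun i => by
    rw [ho.fracOrder_mul (hxK i) (inv_ne_zero (pow_ne_zero _ hπ0)), hox, hpow]; ring
  have hqu : ∀ i, IsUnit (⟨_, ho.mem_ring.2 (Or.inr (hoq i).ge)⟩ : v.ring) := fun i =>
    (ho.isUnit_iff _).2 ⟨hq0 i, hoq i⟩
  choose q hq using hqu
  have hqK : ∀ i, ((q i : v.ring) : K) = algebraMap R K (x i) * (π ^ w i)⁻¹ := fun i => by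
    rw [hq]
  have hxq : ∀ i, algebraMap R v.ring (x i) = (q i : v.ring) * p ^ w i := by
    intro i
    ext
    push_cast
    rw [hqK, mul_assoc, inv_mul_cancel₀ (pow_ne_zero _ hπ0), mul_one]
  have hqprod : ∏ i, q i ^ u i = 1 := by
    set φ : v.ringˣ →* Kˣ := Units.map (v.ring.val : v.ring →* K) with hφ
    have hφinj : Function.Injective φ := Units.map_injective Subtype.val_injective
    apply hφinj
    rw [map_prod, map_one]
    ext
    rw [Units.coe_prod, Units.val_one]
    have h1 : ∀ i, ((φ (q i ^ u i) : Kˣ) : K) =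
        algebraMap R K (x i) ^ u i * (π ^ (u i * (w i : ℤ)))⁻¹ := by
      intro i
      rw [map_zpow, Units.val_zpow_eq_zpow_val]
      have : ((φ (q i) : Kˣ) : K) = ((q i : v.ring) : K) := rfl
      rw [this, hqK, mul_zpow, inv_zpow, mul_comm (u i), zpow_mul, zpow_natCast]
    rw [Finset.prod_congr rfl fun i _ => h1 i, Finset.prod_mul_distrib, Finset.prod_inv_distrib,
      ← hπ]
    have h2 : ∀ s : Finset ι, ∏ i ∈ s, π ^ (u i * (w i : ℤ)) = π ^ (∑ i ∈ s, u i * (w i : ℤ)) := by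
      intro s
      induction s using Finset.induction_on with
      | empty => simp
      | insert a s ha ih => rw [Finset.prod_insert ha, Finset.sum_insert ha, ih, zpow_add₀ hπ0]
    rw [h2, huw, zpow_one, mul_inv_cancel₀ hπ0]
  have hs : ∀ z : v.ring, ∃ t ∈ Algebra.adjoin R
      (insert p (Set.range (fun i => (q i : v.ring)) ∪
        Set.range (fun i => ((q i)⁻¹ : v.ringˣ).val))),
      IsUnit t ∧ z * t ∈ Algebra.adjoin R
      (insert p (Set.range (fun i => (q i : v.ring)) ∪
        Set.range (fun i => ((q i)⁻¹ : v.ringˣ).val))) := by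
    intro z
    have hpA : p ∈ Algebra.adjoin R (insert p (Set.range (fun i => (q i : v.ring)) ∪
        Set.range (fun i => ((q i)⁻¹ : v.ringˣ).val))) :=
      Algebra.subset_adjoin (Set.mem_insert _ _)
    have hqA : ∀ i, (q i : v.ring) ∈ Algebra.adjoin R
        (insert p (Set.range (fun i => (q i : v.ring)) ∪
        Set.range (fun i => ((q i)⁻¹ : v.ringˣ).val))) := fun i =>
      Algebra.subset_adjoin (Set.mem_insert_of_mem _ (Or.inl ⟨i, rfl⟩))
    by_cases hz : (z : K) = 0
    · exact ⟨1, one_mem _, isUnit_one, by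
        rw [show z = 0 from Subtype.ext hz, zero_mul]; exact zero_mem _⟩
    obtain ⟨a, b, ha, hb, hab⟩ := exists_frac_rep (R := R) (z : K) hz
    have h0 := (ho.mem_ring.1 z.2).resolve_left hz
    rw [ho.fracOrder_eq hz hb hab] at h0
    obtain ⟨s, hsA, hsa⟩ := exists_mem_adjoin_mul_pow_eq hpA hqA hxq
      ((hoM a ha (o b)).2 (by omega))
    obtain ⟨t, htA, htb⟩ := exists_mem_adjoin_mul_pow_eq hpA hqA hxq ((hoM b hb (o b)).2 le_rfl)
    have hpo : p ^ o b ≠ 0 := pow_ne_zero _ fun h => hπ0 (congrArg Subtype.val h)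
    have hbK : algebraMap R K b = (t : K) * π ^ o b := congrArg Subtype.val htb
    have hbK0 : algebraMap R K b ≠ 0 := by simpa using hinj.ne hb
    refine ⟨t, htA, ?_, ?_⟩
    · rw [ho.isUnit_iff]
      have ht0 : (t : K) ≠ 0 := fun h => hbK0 (by rw [hbK, h, zero_mul])
      refine ⟨ht0, ?_⟩
      have h3 := ho.fracOrder_mul ht0 (pow_ne_zero (o b) hπ0)
      rw [← hbK, ho.fracOrder_algebraMap hb, ho.fracOrder_pow hπ0, hoπ] at h3
      omega
    · have : z * t = s := by
        apply mul_right_cancel₀ hpo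
        rw [mul_assoc, ← htb, ← hsa]
        exact Subtype.ext hab
      rwa [this]
  refine ⟨v, ho.isDiscreteValuationRing hπ0 hoπ (p := p), fun n r => ?_, ?_, ?_⟩
  · rw [ValuationOver.baseVal, ho.le_val_iff (p := p) hπ0 hoπ]
    by_cases hr : r = 0
    · rw [hr]; simp
    · have : ((algebraMap R v.ring r : v.ring) : K) = algebraMap R K r := rfl
      rw [hoM r hr, this, ho.fracOrder_algebraMap hr]
      have : algebraMap R K r ≠ 0 := by simpa using hinj.ne hr
      simp [this]
  · have hfin : (insert p (Set.range (fun i => (q i : v.ring)) ∪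
        Set.range (fun i => ((q i)⁻¹ : v.ringˣ).val))).Finite :=
      ((Set.finite_range _).union (Set.finite_range _)).insert _
    refine (Algebra.essFiniteType_iff R v.ring).2 ⟨hfin.toFinset, ?_⟩
    rw [Set.Finite.coe_toFinset]
    exact hs
  · obtain ⟨D, hD, hDp⟩ := exists_mem_jacobianIdeal_mul_eq hw huw hqprod hxq hs
    have h1 : v.jacobianVal ≤ v.val D := iInf_le (fun a : jacobianIdeal R v.ring => v.val a) ⟨D, hD⟩
    -- Otherwise the product of `D` with `p` would have order greater than the sum of the weights,
    -- whereas it is minus that exact power of `p`.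
    have h2 : ¬ (((∑ i, w i : ℕ) : ℕ∞) ≤ v.val D) := by
      rw [ho.le_val_iff (p := p) hπ0 hoπ, ← ho.pow_dvd_iff (p := p) hπ0 hoπ]
      rintro ⟨c, hc⟩
      have h3 : p ^ (∑ i, w i + 1) ∣ p ^ ∑ i, w i := ⟨-c, by
        rw [hc] at hDp
        linear_combination hDp⟩
      rw [ho.pow_dvd_iff (p := p) hπ0 hoπ] at h3
      rcases h3 with h3 | h3
      · exact pow_ne_zero _ hπ0 h3
      · rw [SubmonoidClass.coe_pow, ho.fracOrder_pow hπ0, hoπ] at h3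
        push_cast at h3; omega
    exact (add_le_add_left h1 1).trans (Order.add_one_le_of_lt (not_le.1 h2))

end MonomialValuation

/-! ### Allowing zero weights -/

section SubFamilies

variable {ι R : Type*} [Fintype ι] [CommRing R] {x : ι → R}

theorem IsPrimeFamily.comp (hx : IsPrimeFamily x) {κ : Type*} [Fintype κ] {f : κ → ι}
    (hf : Function.Injective f) : IsPrimeFamily fun k => x (f k) where
  isPrime S := by
    have : (fun k => x (f k)) '' S = x '' (f '' S) := by rw [Set.image_image]
    rw [this]; exact hx.isPrime _
  notMem S k hk := by
    have : (fun k => x (f k)) '' S = x '' (f '' S) := by rw [Set.image_image]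
    rw [this]; exact hx.notMem _ _ fun h => hk ((hf.mem_set_image).1 h)

/-- Variables of weight zero can be stripped from the generators. This reduces arbitrary weights to
positive ones, for which the order is finite on nonzero elements. -/
theorem monIdeal_levelSet_restrict (w : ι → ℕ) [DecidablePred fun i => w i ≠ 0] (n : ℕ) :
    monIdeal (fun i : {i // w i ≠ 0} => x i) (levelSet (fun i : {i // w i ≠ 0} => w i) n) =
      monIdeal x (levelSet w n) := by
  have hdeg : ∀ e : ι → ℕ, wdeg (fun i : {i // w i ≠ 0} => w i) (fun i => e i) = wdeg w e := by
    intro e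
    rw [wdeg, wdeg]
    rw [← Finset.sum_filter_of_ne (p := fun i => w i ≠ 0) (s := Finset.univ)
      (fun i _ h => right_ne_zero_of_mul h), Finset.sum_subtype (Finset.univ.filter fun i => w i ≠ 0) (p := fun i => w i ≠ 0) (by simp)]
  refine le_antisymm ?_ ?_
  · rw [monIdeal, Ideal.span_le]
    rintro _ ⟨e, he, rfl⟩
    set e' : ι → ℕ := fun i => if h : w i ≠ 0 then e ⟨i, h⟩ else 0 with he'
    have h1 : (fun i : {i // w i ≠ 0} => e' i) = e := by
      ext i; simp only [he', dif_pos i.2]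
    have h2 : mon (fun i : {i // w i ≠ 0} => x i) e = mon x e' := by
      rw [mon, mon, ← Finset.prod_filter_of_ne (p := fun i => w i ≠ 0) (s := Finset.univ)
        (f := fun i => x i ^ e' i) (fun i _ h => by
          by_contra h3
          apply h
          simp only [he', dif_neg (not_not.2 h3), pow_zero]),
        Finset.prod_subtype (Finset.univ.filter fun i => w i ≠ 0) (p := fun i => w i ≠ 0) (by simp)]
      exact Finset.prod_congr rfl fun i _ => by rw [← h1]
    rw [SetLike.mem_coe, h2]
    refine mon_mem_monIdeal ?_
    rw [mem_levelSet, ← hdeg, h1]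
    exact he
  · rw [monIdeal, Ideal.span_le]
    rintro _ ⟨e, he, rfl⟩
    have h2 : mon x e = (∏ i with ¬ w i ≠ 0, x i ^ e i) *
        mon (fun i : {i // w i ≠ 0} => x i) (fun i => e i) := by
      rw [mon, mon, ← Finset.prod_filter_not_mul_prod_filter Finset.univ (fun i => w i ≠ 0),
        Finset.prod_subtype (Finset.univ.filter fun i => w i ≠ 0) (p := fun i => w i ≠ 0) (by simp)]
    rw [SetLike.mem_coe, h2]
    refine Ideal.mul_mem_left _ _ (mon_mem_monIdeal ?_)
    rw [mem_levelSet, hdeg]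
    exact he

theorem IsPrimeFamily.exists_monomialValuation [IsDomain R] [IsNoetherianRing R] (K : Type*)
    [Field K] [Algebra R K] [IsFractionRing R K] (hx : IsPrimeFamily x) {w : ι → ℕ} {u : ι → ℤ}
    (huw : ∑ i, u i * (w i : ℤ) = 1) :
    ∃ v : ValuationOver R K, IsDiscreteValuationRing v.ring ∧
      (∀ (n : ℕ) (r : R), (n : ℕ∞) ≤ v.baseVal r ↔ r ∈ monIdeal x (levelSet w n)) ∧
      v.IsEssFiniteType ∧ v.jacobianVal + 1 ≤ ((∑ i, w i : ℕ) : ℕ∞) := by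
  classical
  have h1 : ∑ i : {i // w i ≠ 0}, u i * (w i : ℤ) = 1 := by
    rw [← huw, ← Finset.sum_filter_of_ne (p := fun i => w i ≠ 0) (s := Finset.univ)
      (fun i _ h => by simpa using right_ne_zero_of_mul h), Finset.sum_subtype (Finset.univ.filter fun i => w i ≠ 0) (p := fun i => w i ≠ 0) (by simp)]
  have h2 : ∑ i : {i // w i ≠ 0}, w i = ∑ i, w i := by
    rw [← Finset.sum_filter_of_ne (p := fun i => w i ≠ 0) (s := Finset.univ)
      (fun i _ h => h), Finset.sum_subtype (Finset.univ.filter fun i => w i ≠ 0) (p := fun i => w i ≠ 0) (by simp)]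
  obtain ⟨v, hv1, hv2, hv3, hv4⟩ := (hx.comp (f := fun i : {i // w i ≠ 0} => (i : ι))
    Subtype.val_injective).exists_valuationOver K
      (w := fun i : {i // w i ≠ 0} => w i) (u := fun i => u i) (fun i => i.2) h1
  refine ⟨v, hv1, fun n r => ?_, hv3, h2 ▸ hv4⟩
  rw [hv2, monIdeal_levelSet_restrict]

end SubFamilies

/-! ### Generalized regular systems of parameters are prime families -/

section GeneralizedRSP

variable {R : Type*} [CommRing R] {d : ℕ} {x : Fin d → R}

/-- For `notMem`, permute `x i` to the last place: it is a nonzerodivisor modulo the other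
variables. If it were zero there, the quotient would be trivial, although it is a domain. -/
theorem IsGeneralizedRSP.isPrimeFamily (hx : IsGeneralizedRSP x) : IsPrimeFamily x where
  isPrime S := by
    have := hx.isDomain_quotient S
    exact (Ideal.Quotient.isDomain_iff_prime _).1 this
  notMem S i hi h := by
    have h0 : x i ∈ Ideal.span (x '' {i}ᶜ) :=
      Ideal.span_mono (Set.image_mono (Set.subset_compl_singleton_iff.2 hi)) h
    obtain ⟨d, rfl⟩ := Nat.exists_eq_succ_of_ne_zero (Nat.pos_iff_ne_zero.1 (Fin.pos i))
    have h1 := (hx.isRegular_perm (Equiv.swap i (Fin.last d))).toIsWeaklyRegular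
    rw [List.ofFn_succ', List.concat_eq_append, RingTheory.Sequence.isWeaklyRegular_append_iff,
      RingTheory.Sequence.isWeaklyRegular_singleton_iff, Equiv.swap_apply_right] at h1
    set L := List.ofFn fun j : Fin d => x (Equiv.swap i (Fin.last d) j.castSucc)
    have hL : Ideal.ofList L = Ideal.span (x '' {i}ᶜ) := by
      rw [Ideal.ofList]
      congr 1
      ext r
      simp only [L, List.mem_ofFn, Set.mem_image, Set.mem_compl_iff,
        Set.mem_singleton_iff, Set.mem_ofPred_eq]
      constructor
      · rintro ⟨j, rfl⟩
        refine ⟨_, ?_, rfl⟩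
        rw [Equiv.swap_apply_eq_iff, Equiv.swap_apply_left]
        exact (Fin.castSucc_lt_last j).ne
      · rintro ⟨k, hk, rfl⟩
        have : Equiv.swap i (Fin.last d) k ≠ Fin.last d := by
          rw [Ne, Equiv.swap_apply_eq_iff, Equiv.swap_apply_right]; exact hk
        obtain ⟨j, hj⟩ := Fin.exists_castSucc_eq.2 this
        exact ⟨j, by rw [hj, Equiv.swap_apply_self]⟩
    have hne : (Ideal.span (x '' {i}ᶜ)) ≠ ⊤ := by
      have := hx.isDomain_quotient {i}ᶜ
      exact ((Ideal.Quotient.isDomain_iff_prime _).1 this).ne_top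
    apply hne
    rw [Ideal.eq_top_iff_one]
    have h2 : (Submodule.Quotient.mk 1 : R ⧸ (Ideal.ofList L • ⊤ : Submodule R R)) = 0 := by
      apply h1.2
      simp only [smul_zero]
      rw [← Submodule.Quotient.mk_smul, Submodule.Quotient.mk_eq_zero, smul_eq_mul (Ideal.ofList L),
        Ideal.mul_top, hL, smul_eq_mul, mul_one]
      exact h0
    rwa [Submodule.Quotient.mk_eq_zero, smul_eq_mul, Ideal.mul_top, hL] at h2

end GeneralizedRSP

/-! ### Normalized valuations of elements and ideals, and the Jacobian inequality -/

namespace ValuationOver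

open IsLocalRing IsDiscreteValuationRing

section Ideals

variable {R K : Type*} [CommRing R] [Field K] [Algebra R K] (v : ValuationOver R K)

theorem baseVal_zero : v.baseVal 0 = ⊤ := by rw [baseVal, map_zero, val_zero]

theorem min_baseVal_le_baseVal_add (r s : R) :
    min (v.baseVal r) (v.baseVal s) ≤ v.baseVal (r + s) := by
  rw [baseVal, baseVal, baseVal, map_add]
  exact v.min_val_le_val_add _ _

theorem baseVal_le_baseVal_mul (r s : R) : v.baseVal s ≤ v.baseVal (r * s) := by
  rw [baseVal, baseVal, map_mul]
  exact v.val_le_val_mul _ _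

theorem le_idealVal_iff {I : Ideal R} {n : ℕ∞} : n ≤ v.idealVal I ↔ ∀ r ∈ I, n ≤ v.baseVal r := by
  rw [idealVal, le_iInf_iff]
  exact ⟨fun h r hr => h ⟨r, hr⟩, fun h r => h r r.2⟩

theorem idealVal_le {I : Ideal R} {r : R} (hr : r ∈ I) : v.idealVal I ≤ v.baseVal r :=
  v.le_idealVal_iff.1 le_rfl r hr

theorem le_idealVal_span_iff {S : Set R} {n : ℕ∞} :
    n ≤ v.idealVal (Ideal.span S) ↔ ∀ r ∈ S, n ≤ v.baseVal r := by
  rw [le_idealVal_iff]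
  refine ⟨fun h r hr => h r (Ideal.subset_span hr), fun h r hr => ?_⟩
  induction hr using Submodule.span_induction with
  | mem r hr => exact h r hr
  | zero => rw [baseVal_zero]; exact le_top
  | add r s _ _ hr hs => exact (le_min hr hs).trans (v.min_baseVal_le_baseVal_add r s)
  | smul c r _ hr => exact hr.trans (v.baseVal_le_baseVal_mul c r)

theorem exists_baseVal_eq_idealVal (I : Ideal R) : ∃ r ∈ I, v.baseVal r = v.idealVal I := by
  obtain ⟨r, hr⟩ := ENat.exists_eq_iInf (fun r : I => v.baseVal r)
  exact ⟨r, r.2, hr⟩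

theorem le_baseVal_sum {α : Type*} {s : Finset α} {f : α → R} {n : ℕ∞}
    (h : ∀ i ∈ s, n ≤ v.baseVal (f i)) : n ≤ v.baseVal (∑ i ∈ s, f i) := by
  classical
  induction s using Finset.induction_on with
  | empty => rw [Finset.sum_empty, baseVal_zero]; exact le_top
  | insert a s ha ih =>
    rw [Finset.sum_insert ha]
    exact (le_min (h a (Finset.mem_insert_self _ _)) (ih fun i hi =>
      h i (Finset.mem_insert_of_mem hi))).trans (v.min_baseVal_le_baseVal_add _ _)

theorem baseVal_neg (r : R) : v.baseVal (-r) = v.baseVal r := by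
  refine le_antisymm ?_ ?_
  · simpa using v.baseVal_le_baseVal_mul (-1) (-r)
  · simpa using v.baseVal_le_baseVal_mul (-1) r

theorem val_eq_zero_of_isField (h : IsField v.ring) {a : v.ring} (ha : a ≠ 0) : v.val a = 0 := by
  by_contra h1
  have h2 : ((1 : ℕ) : ℕ∞) ≤ v.val a := by
    rw [Nat.cast_one]; exact Order.one_le_iff_ne_zero.2 h1
  rw [le_val_iff, pow_one, IsLocalRing.isField_iff_maximalIdeal_eq.1 h] at h2
  exact ha h2

end Ideals

section Discrete

variable {R K : Type*} [CommRing R] [Field K] [Algebra R K] (v : ValuationOver R K)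
  [IsDiscreteValuationRing v.ring]

theorem val_eq_addVal (a : v.ring) : v.val a = addVal v.ring a := by
  obtain ⟨t, ht⟩ := exists_irreducible v.ring
  refine ENat.eq_of_forall_natCast_le_iff fun n => ?_
  rw [le_val_iff, ht.maximalIdeal_eq, Ideal.span_singleton_pow, Ideal.mem_span_singleton,
    ← addVal_le_iff_dvd, ht.addVal_pow]

theorem baseVal_mul (r s : R) : v.baseVal (r * s) = v.baseVal r + v.baseVal s := by
  simp only [baseVal, val_eq_addVal, map_mul, addVal_mul]

theorem baseVal_one : v.baseVal 1 = 0 := by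
  simp only [baseVal, val_eq_addVal, map_one, addVal_one]

theorem baseVal_pow (r : R) (n : ℕ) : v.baseVal (r ^ n) = n * v.baseVal r := by
  simp only [baseVal, val_eq_addVal, map_pow, addVal_pow, nsmul_eq_mul]

theorem baseVal_prod {α : Type*} (s : Finset α) (f : α → R) :
    v.baseVal (∏ i ∈ s, f i) = ∑ i ∈ s, v.baseVal (f i) := by
  classical
  induction s using Finset.induction_on with
  | empty => simp [baseVal_one]
  | insert a s ha ih => rw [Finset.prod_insert ha, Finset.sum_insert ha, baseVal_mul, ih]

theorem baseVal_eq_top_iff [IsDomain R] [IsFractionRing R K] {r : R} :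
    v.baseVal r = ⊤ ↔ r = 0 := by
  rw [baseVal, val_eq_addVal, addVal_eq_top_iff]
  constructor
  · intro h
    have h1 : algebraMap R K r = 0 := congrArg Subtype.val h
    exact (IsFractionRing.injective R K) (by rw [h1, map_zero])
  · rintro rfl; exact map_zero _

theorem idealVal_pow (I : Ideal R) (n : ℕ) : v.idealVal (I ^ n) = n * v.idealVal I := by
  refine le_antisymm ?_ ?_
  · obtain ⟨r, hr, h⟩ := v.exists_baseVal_eq_idealVal I
    rw [← h, ← baseVal_pow]
    exact v.idealVal_le (Ideal.pow_mem_pow hr n)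
  · induction n with
    | zero => simp
    | succ n ih =>
      rw [pow_succ, le_idealVal_iff]
      intro r hr
      induction hr using Submodule.mul_induction_on' with
      | mem_mul_mem a ha b hb =>
        rw [baseVal_mul, Nat.cast_succ, add_mul, one_mul]
        exact add_le_add (ih.trans (v.idealVal_le ha)) (v.idealVal_le hb)
      | add a _ b _ ha hb => exact (le_min ha hb).trans (v.min_baseVal_le_baseVal_add a b)

/-- If v(r) = ρ were smaller than v(I), every other term of the integral equation would have value
at least kρ + 1, and so would r^k. -/
theorem idealVal_le_baseVal_of_isIntegralOverIdeal {I : Ideal R} {r : R}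
    (hr : IsIntegralOverIdeal I r) : v.idealVal I ≤ v.baseVal r := by
  obtain ⟨k, a, hk, ha, h⟩ := hr
  by_contra hlt
  rw [not_le] at hlt
  obtain ⟨ρ, hρ⟩ := ENat.ne_top_iff_exists.1 hlt.ne_top
  have h1 : ((ρ + 1 : ℕ) : ℕ∞) ≤ v.idealVal I := by
    rw [← hρ] at hlt
    exact_mod_cast Order.add_one_le_of_lt hlt
  have h2 : ((k * ρ + 1 : ℕ) : ℕ∞) ≤ v.baseVal (r ^ k) := by
    rw [eq_neg_of_add_eq_zero_left h, baseVal_neg]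
    refine v.le_baseVal_sum fun i hi => ?_
    have h3 : ((i * (ρ + 1) : ℕ) : ℕ∞) ≤ v.baseVal (a i) := by
      refine le_trans ?_ (v.idealVal_le (ha i hi))
      rw [idealVal_pow, Nat.cast_mul]
      gcongr
    rw [baseVal_mul, baseVal_pow, ← hρ]
    refine le_trans ?_ (add_le_add_left h3 _)
    rw [Finset.mem_Icc] at hi
    norm_cast
    obtain ⟨j, rfl⟩ := Nat.exists_eq_add_of_le hi.2
    rw [Nat.add_sub_cancel_left]
    nlinarith [hi.1]
  rw [baseVal_pow, ← hρ] at h2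
  norm_cast at h2
  omega

theorem irreducible_pow_dvd_iff {t : v.ring} (ht : Irreducible t) (n : ℕ) (a : v.ring) :
    t ^ n ∣ a ↔ (n : ℕ∞) ≤ v.val a := by
  rw [val_eq_addVal, ← addVal_le_iff_dvd, ht.addVal_pow]

/-- The bound for essentially finite type rings is applied to the `x i` of positive value only; the
others are units and contribute nothing. The inequality has +1 on the right because subtraction is
truncated. -/
theorem baseVal_prod_le_jacobianVal [IsDomain R] [IsRegularRing R] [IsFractionRing R K]
    (hv : v.IsEssFiniteType) {d : ℕ} {x : Fin d → R} (hx : IsGeneralizedRSP x) :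
    v.baseVal (∏ i, x i) ≤ v.jacobianVal + 1 := by
  classical
  have : Algebra.EssFiniteType R v.ring := hv
  obtain ⟨t, ht⟩ := exists_irreducible v.ring
  have hne : ∀ i, v.baseVal (x i) ≠ ⊤ := fun i =>
    (v.baseVal_eq_top_iff).not.2 (hx.isPrimeFamily.ne_zero i)
  choose w hw using fun i => ENat.ne_top_iff_exists.1 (hne i)
  have hdvd : ∀ i, ∃ u : v.ring, algebraMap R v.ring (x i) = u * t ^ w i := fun i => by
    obtain ⟨u, hu⟩ := (v.irreducible_pow_dvd_iff ht (w i) _).2 (hw i).le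
    exact ⟨u, by rw [hu, mul_comm]⟩
  choose u hu using hdvd
  have hrange : Set.range (fun i : {i // w i ≠ 0} => x i) = x '' {i | w i ≠ 0} := by
    rw [Set.image_eq_range]; rfl
  have hreg : IsRegularRing (R ⧸ Ideal.span (Set.range (fun i : {i // w i ≠ 0} => x i))) := by
    rw [hrange]; exact hx.isRegularRing_quotient _
  have hinj : Function.Injective (algebraMap R v.ring) := fun a b h =>
    IsFractionRing.injective R K (congrArg Subtype.val h)
  have hfrac : ∀ z : v.ring, ∃ a b : R, b ≠ 0 ∧ z * algebraMap R v.ring b = algebraMap R v.ring a := by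
    intro z
    by_cases hz : (z : K) = 0
    · exact ⟨0, 1, one_ne_zero, by rw [show z = 0 from Subtype.ext hz]; simp⟩
    · obtain ⟨a, b, _, hb, h⟩ := exists_frac_rep (R := R) (z : K) hz
      exact ⟨a, b, hb, Subtype.ext h⟩
  have key := jacobianIdeal_le_of_essFiniteType hinj hfrac
    (hx.isPrimeFamily.comp (f := fun i : {i // w i ≠ 0} => (i : Fin d)) Subtype.val_injective)
    ht (fun i : {i // w i ≠ 0} => w i) (fun i => i.2) (fun i => u i) (fun i => hu i)
  have hsum : ∑ i : {i // w i ≠ 0}, w i = ∑ i, w i := by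
    rw [← Finset.sum_filter_of_ne (p := fun i => w i ≠ 0) (s := Finset.univ)
      (fun i _ h => h), Finset.sum_subtype (Finset.univ.filter fun i => w i ≠ 0)
        (p := fun i => w i ≠ 0) (by simp)]
  rw [hsum] at key
  have h1 : ((∑ i, w i - 1 : ℕ) : ℕ∞) ≤ v.jacobianVal := by
    rw [jacobianVal, le_iInf_iff]
    intro a
    rw [← v.irreducible_pow_dvd_iff ht, ← Ideal.mem_span_singleton]
    exact key a.2
  rw [baseVal_prod, ← Finset.sum_congr rfl fun i _ => hw i]
  refine le_trans ?_ (add_le_add_left h1 1)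
  norm_cast
  omega

end Discrete

section EssFiniteType

variable {R K : Type*} [CommRing R] [IsNoetherianRing R] [Field K] [Algebra R K]
  (v : ValuationOver R K)

/-- The ring is Noetherian, and a Noetherian valuation ring is discrete or a field. -/
theorem IsEssFiniteType.isDiscreteValuationRing_or_isField (hv : v.IsEssFiniteType) :
    IsDiscreteValuationRing v.ring ∨ IsField v.ring := by
  have : Algebra.EssFiniteType R v.ring := hv
  have h1 : IsNoetherianRing v.ring := Algebra.EssFiniteType.isNoetherianRing R v.ring
  have h2 : ValuationRing v.ring := inferInstanceAs (ValuationRing v.toValuationSubring)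
  by_cases h : IsField v.ring
  · exact Or.inr h
  · exact Or.inl (((IsDiscreteValuationRing.TFAE v.ring h).out 0 1).2 h2)

theorem IsEssFiniteType.isDiscreteValuationRing [IsDomain R] [IsFractionRing R K]
    (hv : v.IsEssFiniteType) {I : Ideal R} (hI : I ≠ ⊥) (h : v.idealVal I ≠ 0) :
    IsDiscreteValuationRing v.ring := by
  refine (hv.isDiscreteValuationRing_or_isField).resolve_right fun hf => h ?_
  obtain ⟨r, hr, hr0⟩ := Submodule.exists_mem_ne_zero_of_ne_bot hI
  refine le_antisymm ((v.idealVal_le hr).trans ?_) bot_le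
  rw [baseVal, v.val_eq_zero_of_isField hf]
  intro h
  have h1 : algebraMap R K r = 0 := congrArg Subtype.val h
  exact hr0 ((IsFractionRing.injective R K) (by rw [h1, map_zero]))

end EssFiniteType

end ValuationOver

/-! ### Integrality over ideals and the Rees algebra -/

section IntegralClosure

open Polynomial

variable {R : Type*} [CommRing R]

theorem isIntegralOverIdeal_of_pow_mem {I : Ideal R} {r : R} {N : ℕ} (hN : 1 ≤ N)
    (h : r ^ N ∈ I ^ N) : IsIntegralOverIdeal I r := by
  classical
  refine ⟨N, fun i => if i = N then -r ^ N else 0, hN, fun i _ => ?_, ?_⟩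
  · dsimp only
    split_ifs with hi
    · rw [hi]; exact neg_mem h
    · exact zero_mem _
  · rw [Finset.sum_eq_single N (fun i _ hi => by simp [hi])
      (fun h => absurd (Finset.mem_Icc.2 ⟨hN, le_rfl⟩) h)]
    simp

/-- The passage to rT over the Rees algebra makes integrality over an ideal a case of integrality
over a ring, so that closure under sums and multiples is inherited. -/
theorem IsIntegralOverIdeal.isIntegral_reesAlgebra {I : Ideal R} {r : R}
    (h : IsIntegralOverIdeal I r) : IsIntegral (reesAlgebra I) (monomial 1 r : R[X]) := by
  classical
  obtain ⟨k, a, hk, ha, h⟩ := h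
  have hmem : ∀ i, (if i ∈ Finset.Icc 1 k then monomial i (a i) else 0 : R[X]) ∈
      reesAlgebra I := by
    intro i
    split_ifs with hi
    · exact reesAlgebra.monomial_mem.2 (ha i hi)
    · exact zero_mem _
  set A : ℕ → reesAlgebra I := fun i => ⟨_, hmem i⟩ with hA
  refine ⟨X ^ k + ∑ i ∈ Finset.Icc 1 k, C (A i) * X ^ (k - i), ?_, ?_⟩
  · refine monic_X_pow_add ?_
    refine (degree_sum_le _ _).trans_lt ?_
    rw [Finset.sup_lt_iff (by exact WithBot.bot_lt_coe k)]
    intro i hi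
    rw [Finset.mem_Icc] at hi
    refine (degree_C_mul_X_pow_le _ _).trans_lt ?_
    exact_mod_cast (by omega : k - i < k)
  · rw [eval₂_add, eval₂_X_pow, eval₂_finsetSum]
    have h1 : ∀ i ∈ Finset.Icc 1 k, eval₂ (algebraMap (reesAlgebra I) R[X]) (monomial 1 r)
        (C (A i) * X ^ (k - i)) = monomial k (a i * r ^ (k - i)) := by
      intro i hi
      have h2 : algebraMap (reesAlgebra I) R[X] (A i) = monomial i (a i) := by
        change (A i : R[X]) = _
        simp only [hA, if_pos hi]
      rw [eval₂_mul, eval₂_C, eval₂_X_pow, h2, monomial_pow, monomial_mul_monomial, one_mul,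
        Nat.add_sub_cancel' (Finset.mem_Icc.1 hi).2]
    rw [Finset.sum_congr rfl h1, monomial_pow, one_mul, ← map_sum, ← map_add, h, map_zero]

/-- Comparing coefficients of degree `k` in the equation for rT, where `k` is its degree, gives the
homogeneous equation for `r`. -/
theorem isIntegralOverIdeal_of_isIntegral_reesAlgebra [Nontrivial R] {I : Ideal R} {r : R}
    (h : IsIntegral (reesAlgebra I) (monomial 1 r : R[X])) : IsIntegralOverIdeal I r := by
  obtain ⟨p, hp, h⟩ := h
  set k := p.natDegree with hk
  have hk1 : 1 ≤ k := by
    by_contra h0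
    have h1 : p = 1 := eq_one_of_monic_natDegree_zero hp (by omega)
    rw [h1, eval₂_one] at h
    exact one_ne_zero h
  refine ⟨k, fun i => (p.coeff (k - i) : R[X]).coeff i, hk1, fun i _ =>
    (mem_reesAlgebra_iff _ _).1 (p.coeff (k - i)).2 i, ?_⟩
  have h1 := congrArg (fun f => f.coeff k) h
  simp only [eval₂_eq_sum_range, finsetSum_coeff, coeff_zero, monomial_pow, one_mul] at h1
  rw [Finset.sum_range_succ, ← hk, hk, hp.coeff_natDegree, map_one, one_mul, ← hk,
    coeff_monomial, if_pos rfl, add_comm] at h1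
  rw [← h1]
  congr 1
  refine Finset.sum_nbij' (fun i => k - i) (fun j => k - j) ?_ ?_ ?_ ?_ ?_
  · intro i hi; rw [Finset.mem_Icc] at hi; rw [Finset.mem_range]; omega
  · intro j hj; rw [Finset.mem_range] at hj; rw [Finset.mem_Icc]; omega
  · intro i hi; rw [Finset.mem_Icc] at hi; omega
  · intro j hj; rw [Finset.mem_range] at hj; omega
  · intro i hi
    have h2 : k = i + (k - i) := by rw [Finset.mem_Icc] at hi; omega
    conv_rhs => rw [show ∀ q : R[X], q.coeff k = q.coeff (i + (k - i)) from fun q => by rw [← h2]]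
    rw [coeff_mul_monomial]
    rfl

theorem IsIntegralOverIdeal.add [Nontrivial R] {I : Ideal R} {r s : R}
    (hr : IsIntegralOverIdeal I r) (hs : IsIntegralOverIdeal I s) :
    IsIntegralOverIdeal I (r + s) := by
  refine isIntegralOverIdeal_of_isIntegral_reesAlgebra ?_
  rw [map_add]
  exact hr.isIntegral_reesAlgebra.add hs.isIntegral_reesAlgebra

theorem IsIntegralOverIdeal.mul_left [Nontrivial R] {I : Ideal R} {r : R}
    (hr : IsIntegralOverIdeal I r) (c : R) : IsIntegralOverIdeal I (c * r) := by
  refine isIntegralOverIdeal_of_isIntegral_reesAlgebra ?_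
  rw [← C_mul_monomial]
  exact (isIntegral_algebraMap (R := reesAlgebra I) (x := algebraMap R _ c)).mul
    hr.isIntegral_reesAlgebra

theorem isIntegralOverIdeal_of_mem_span [Nontrivial R] {I : Ideal R} {S : Set R}
    (hS : ∀ r ∈ S, IsIntegralOverIdeal I r) {r : R} (hr : r ∈ Ideal.span S) :
    IsIntegralOverIdeal I r := by
  induction hr using Submodule.span_induction with
  | mem r hr => exact hS r hr
  | zero => exact isIntegralOverIdeal_of_pow_mem le_rfl (by simp)
  | add r s _ _ hr hs => exact hr.add hs
  | smul c r _ hr => exact hr.mul_left c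

end IntegralClosure

/-! ### Irredundant valuations are determined up to proportionality -/

section Proportional

variable {α G : Type*} [CommMonoid G]

/-- Abstract uniqueness of Rees valuations: `N v` stands for the values of elements, `M v` for the
value of the ideal. The witness `r` violates only the condition at `s`, so multiplying by a large
power of it makes any element dominated by the condition at `s`. -/
theorem exists_proportional_of_forall_iff {N : α → G → ℕ}
    (hN : ∀ v f g, N v (f * g) = N v f + N v g) {M : α → ℕ} {S T : Set α} (hT : T.Finite)
    (hST : ∀ m f, (∀ v ∈ S, m * M v ≤ N v f) ↔ ∀ t ∈ T, m * M t ≤ N t f) {s : α}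
    (hs : s ∈ S) {n : ℕ} {r : G} (hr : ∀ v ∈ S, v ≠ s → n * M v ≤ N v r)
    (hsr : N s r < n * M s) : ∃ t ∈ T, 0 < M t ∧ ∀ f, M s * N t f = N s f * M t := by
  classical
  have h1 : ∀ v, N v 1 = 0 := fun v => by have := hN v 1 1; rw [mul_one] at this; omega
  have hpow : ∀ v f k, N v (f ^ k) = k * N v f := by
    intro v f k
    induction k with
    | zero => simp [h1]
    | succ k ih => rw [pow_succ, hN, ih]; ring
  have hprod : ∀ v (A : Finset α) (F : α → G), N v (∏ t ∈ A, F t) = ∑ t ∈ A, N v (F t) := by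
    intro v A F
    induction A using Finset.induction_on with
    | empty => simp [h1]
    | insert a A ha ih => rw [Finset.prod_insert ha, Finset.sum_insert ha, hN, ih]
  have hMs : 0 < M s := Nat.pos_of_ne_zero fun h => by rw [h, mul_zero] at hsr; omega
  -- an element whose order at `s` is exactly a multiple of that of `I` is sharp at some `t ∈ T`
  have hsharp : ∀ F m, (∀ t ∈ T, m * M t ≤ N t F) → N s F = m * M s →
      ∃ t ∈ T, 0 < M t ∧ N t F = m * M t := by
    intro F m hF hsF
    by_contra! hcon
    -- If all inequalities at `T` were strict, the `L`-th power would gain at least `M t`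
    -- everywhere, enough for one more multiple of the ideal. The transfer back to `s` then
    -- contradicts exactness there.
    obtain ⟨L, hL⟩ : ∃ L, ∀ t ∈ T, M t ≤ L := by
      obtain ⟨L, hL⟩ := (hT.image M).bddAbove
      exact ⟨L, fun t ht => hL ⟨t, ht, rfl⟩⟩
    have h2 : ∀ t ∈ T, (L * m + 1) * M t ≤ N t (F ^ L) := by
      intro t ht
      rw [hpow]
      rcases Nat.eq_zero_or_pos (M t) with h0 | h0
      · rw [h0, mul_zero]; exact Nat.zero_le _
      · have h3 : m * M t + 1 ≤ N t F := Nat.succ_le_of_lt (lt_of_le_of_ne (hF t ht)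
          (hcon t ht h0).symm)
        have h4 := Nat.mul_le_mul_left L h3
        have h5 := hL t ht
        nlinarith
    have h3 := (hST _ _).2 h2 s hs
    rw [hpow, hsF] at h3
    nlinarith
  -- One `t` serves all exact elements: otherwise the product of one counterexample for each `t`
  -- would be sharp at no `t`.
  have hgood : ∃ t ∈ T, 0 < M t ∧ ∀ F m, (∀ t ∈ T, m * M t ≤ N t F) → N s F = m * M s →
      N t F = m * M t := by
    by_contra! hcon
    choose! F m hF hsF hne using hcon
    set A := hT.toFinset.filter fun t => 0 < M t with hA
    have hAT : ∀ t ∈ A, t ∈ T ∧ 0 < M t := fun t ht => by simpa [hA] using ht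
    obtain ⟨t, ht, ht0, hteq⟩ := hsharp (∏ t ∈ A, F t) (∑ t ∈ A, m t) (fun t ht => by
        rw [hprod, Finset.sum_mul]
        exact Finset.sum_le_sum fun u hu => hF u (hAT u hu).1 (hAT u hu).2 t ht) (by
        rw [hprod, Finset.sum_mul]
        exact Finset.sum_congr rfl fun u hu => hsF u (hAT u hu).1 (hAT u hu).2)
    rw [hprod, Finset.sum_mul] at hteq
    have htA : t ∈ A := by simp [hA, ht, ht0]
    exact hne t ht ht0 (((Finset.sum_eq_sum_iff_of_le fun u hu =>
      hF u (hAT u hu).1 (hAT u hu).2 t ht).1 hteq.symm) t htA).symm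
  obtain ⟨t, ht, ht0, hgood⟩ := hgood
  -- The power `M s` makes the order at `s` a multiple of `M s`, and `k ≥ N s f` lets the surplus of
  -- `r ^ k` at the other valuations absorb `f`. Comparing two consecutive values of `k` later
  -- isolates the contributions of `r` and of `f`.
  have key : ∀ f k, N s f ≤ k → M s * (k * N t r + N t f) = (k * N s r + N s f) * M t := by
    intro f k hk
    have h2 := hgood ((r ^ k * f) ^ M s) (k * N s r + N s f) ((hST _ _).1 fun v hv => by
      rw [hpow, hN, hpow]
      by_cases hvs : v = s
      · rw [hvs, mul_comm]
      · have h3 := hr v hv hvs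
        have h4 : N s r + 1 ≤ n * M s := hsr
        calc (k * N s r + N s f) * M v ≤ (k * (N s r + 1)) * M v := by gcongr; nlinarith
          _ ≤ (k * (n * M s)) * M v := by gcongr
          _ = M s * (k * (n * M v)) := by ring
          _ ≤ M s * (k * N v r + N v f) := by gcongr; nlinarith [Nat.mul_le_mul_left k h3]) (by
      rw [hpow, hN, hpow, mul_comm])
    rwa [hpow, hN, hpow] at h2
  refine ⟨t, ht, ht0, fun f => ?_⟩
  have h2 := key f (N s f) le_rfl
  have h3 := key f (N s f + 1) (Nat.le_succ _)
  have h4 : M s * N t r = N s r * M t := by nlinarith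
  have h5 : M s * (N s f * N t r) = N s f * N s r * M t := by
    rw [mul_left_comm, h4]; ring
  nlinarith

end Proportional

/-! ### Finitely generated rational cones and primitive weights -/

section Polyhedra

variable {κ : Type*} [Fintype κ]

/-- Elimination of one nonnegative variable from a finite system of linear inequalities. -/
theorem exists_finset_forall_iff_exists_nonneg (F : Finset (κ → ℚ)) (g : κ → ℚ) :
    ∃ F' : Finset (κ → ℚ), ∀ z : κ → ℚ,
      (∃ t : ℚ, 0 ≤ t ∧ ∀ f ∈ F, 0 ≤ f ⬝ᵥ (z - t • g)) ↔ ∀ f ∈ F', 0 ≤ f ⬝ᵥ z := by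
  classical
  refine ⟨(F.filter fun f => 0 ≤ f ⬝ᵥ g) ∪ ((F.filter fun f => 0 < f ⬝ᵥ g) ×ˢ
    (F.filter fun f => f ⬝ᵥ g < 0)).image fun p => (p.1 ⬝ᵥ g) • p.2 - (p.2 ⬝ᵥ g) • p.1,
    fun z => ?_⟩
  simp only [dotProduct_sub, dotProduct_smul, smul_eq_mul, Finset.mem_union, Finset.mem_filter,
    Finset.mem_image, Finset.mem_product, Prod.exists]
  constructor
  · rintro ⟨t, ht, h⟩ f (⟨hf, hfg⟩ | ⟨p, q, ⟨⟨hp, hpg⟩, hq, hqg⟩, rfl⟩)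
    · have h1 := h f hf
      nlinarith [mul_nonneg ht hfg]
    · rw [sub_dotProduct, smul_dotProduct, smul_dotProduct, smul_eq_mul, smul_eq_mul]
      have h1 := mul_nonneg hpg.le (h q hq)
      have h2 := mul_nonneg (neg_nonneg.2 hqg.le) (h p hp)
      nlinarith
  · intro h
    -- The functionals negative on `g` give lower bounds for `t`, those positive on `g` upper
    -- bounds. The largest lower bound, with 0 included, works because the mixed combinations
    -- compare each pair of bounds.
    set L : Finset ℚ := insert 0 ((F.filter fun f => f ⬝ᵥ g < 0).image fun f =>
      (f ⬝ᵥ z) / (f ⬝ᵥ g)) with hL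
    have hLne : L.Nonempty := Finset.insert_nonempty _ _
    have h0 : 0 ≤ L.max' hLne := Finset.le_max' _ _ (Finset.mem_insert_self _ _)
    refine ⟨L.max' hLne, h0, fun f hf => ?_⟩
    rcases lt_trichotomy (f ⬝ᵥ g) 0 with hfg | hfg | hfg
    · have h1 : (f ⬝ᵥ z) / (f ⬝ᵥ g) ≤ L.max' hLne := by
        refine Finset.le_max' L _ (Finset.mem_insert_of_mem ?_)
        exact Finset.mem_image_of_mem (fun f => (f ⬝ᵥ z) / (f ⬝ᵥ g))
          (Finset.mem_filter.2 ⟨hf, hfg⟩)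
      rw [div_le_iff_of_neg hfg] at h1
      linarith
    · rw [hfg, mul_zero, sub_zero]
      exact h f (Or.inl ⟨hf, hfg.ge⟩)
    · have hfz := h f (Or.inl ⟨hf, hfg.le⟩)
      have h1 : L.max' hLne ≤ (f ⬝ᵥ z) / (f ⬝ᵥ g) := by
        refine Finset.max'_le _ _ _ fun y hy => ?_
        rw [hL, Finset.mem_insert, Finset.mem_image] at hy
        rcases hy with rfl | ⟨q, hq, rfl⟩
        · positivity
        · rw [Finset.mem_filter] at hq
          have h2 := h _ (Or.inr ⟨f, q, ⟨⟨hf, hfg⟩, hq⟩, rfl⟩)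
          rw [sub_dotProduct, smul_dotProduct, smul_dotProduct, smul_eq_mul, smul_eq_mul] at h2
          rw [div_le_iff_of_neg hq.2, div_mul_eq_mul_div, div_le_iff₀ hfg]
          linarith
      rw [le_div_iff₀ hfg] at h1
      linarith

/-- A finitely generated cone containing the positive orthant is an intersection of finitely many
half-spaces. -/
theorem exists_finset_forall_iff_mem_cone {α : Type*} (A : Finset α) (g : α → κ → ℚ) :
    ∃ F : Finset (κ → ℚ), ∀ z : κ → ℚ,
      (∃ c : α → ℚ, (∀ a ∈ A, 0 ≤ c a) ∧ ∀ i, ∑ a ∈ A, c a * g a i ≤ z i) ↔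
        ∀ f ∈ F, 0 ≤ f ⬝ᵥ z := by
  classical
  induction A using Finset.induction_on with
  | empty =>
    refine ⟨Finset.univ.image fun i => Pi.single i 1, fun z => ?_⟩
    simp
  | insert b A hb ih =>
    obtain ⟨F, hF⟩ := ih
    obtain ⟨F', hF'⟩ := exists_finset_forall_iff_exists_nonneg F (g b)
    refine ⟨F', fun z => ?_⟩
    rw [← hF']
    simp only [← hF]
    constructor
    · rintro ⟨c, hc, h⟩
      refine ⟨c b, hc b (Finset.mem_insert_self _ _), c,
        fun a ha => hc a (Finset.mem_insert_of_mem ha), fun i => ?_⟩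
      have := h i
      rw [Finset.sum_insert hb] at this
      simp only [Pi.sub_apply, Pi.smul_apply, smul_eq_mul]
      linarith
    · rintro ⟨t, ht, c, hc, h⟩
      have hne : ∀ a ∈ A, a ≠ b := fun a ha hab => hb (hab ▸ ha)
      refine ⟨Function.update c b t, fun a ha => ?_, fun i => ?_⟩
      · rw [Finset.mem_insert] at ha
        rcases ha with rfl | ha
        · simpa using ht
        · rw [Function.update_of_ne (hne a ha)]; exact hc a ha
      · rw [Finset.sum_insert hb, Function.update_self, Finset.sum_congr rfl fun a ha => by
          rw [Function.update_of_ne (hne a ha)]]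
        have := h i
        simp only [Pi.sub_apply, Pi.smul_apply, smul_eq_mul] at this
        linarith

variable {ι : Type*} [Fintype ι]

/-- Clear denominators and divide by a generator of the ideal of the entries; its expression through
the entries gives the Bézout coefficients. -/
theorem exists_primitive_nat_of_nonneg {w : ι → ℚ} (hw : ∀ i, 0 ≤ w i) (hw0 : w ≠ 0) :
    ∃ (w' : ι → ℕ) (u : ι → ℤ) (c : ℚ), 0 < c ∧ (∀ i, w i = c * w' i) ∧
      ∑ i, u i * (w' i : ℤ) = 1 := by
  classical
  obtain ⟨D, hD⟩ := IsLocalization.exist_integer_multiples_of_finite (nonZeroDivisors ℤ) w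
  choose m hm using hD
  have hD0 : ((D : ℤ) : ℚ) ≠ 0 := by exact_mod_cast nonZeroDivisors.coe_ne_zero D
  have hm' : ∀ i, (m i : ℚ) = (D : ℤ) * w i := fun i => by simpa [Algebra.smul_def] using hm i
  set g := Submodule.IsPrincipal.generator (Ideal.span (Set.range m)) with hg
  have hspan : Ideal.span {g} = Ideal.span (Set.range m) := Ideal.span_singleton_generator _
  have hdvd : ∀ i, g ∣ m i := fun i => by
    rw [← Ideal.mem_span_singleton, hspan]; exact Ideal.subset_span ⟨i, rfl⟩
  choose k hk using hdvd
  obtain ⟨u, hu⟩ := (Ideal.mem_span_range_iff_exists_fun).1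
    (show g ∈ Ideal.span (Set.range m) from hspan ▸ Ideal.mem_span_singleton_self g)
  have hg0 : g ≠ 0 := by
    intro h0
    apply hw0
    ext i
    have h1 := hm' i
    rw [hk, h0, zero_mul, Int.cast_zero] at h1
    simpa [hD0] using h1.symm
  have h1 : ∑ i, u i * k i = 1 := by
    apply mul_left_cancel₀ hg0
    rw [Finset.mul_sum, mul_one]
    conv_rhs => rw [← hu]
    exact Finset.sum_congr rfl fun i _ => by rw [hk i]; ring
  set c : ℚ := (g : ℚ) / (D : ℤ) with hc
  have hc0 : c ≠ 0 := div_ne_zero (by exact_mod_cast hg0) hD0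
  have hwk : ∀ i, w i = c * k i := by
    intro i
    have h2 := hm' i
    rw [hk] at h2
    rw [hc]
    field_simp
    push_cast at h2
    linarith
  -- The generator and the common denominator have arbitrary signs. A negative ratio is corrected by
  -- changing the signs of the weights and of the Bézout coefficients.
  rcases lt_or_gt_of_ne hc0 with hneg | hpos
  · refine ⟨fun i => (k i).natAbs, fun i => -u i, -c, by linarith, fun i => ?_, ?_⟩
    · have h2 : (k i : ℚ) ≤ 0 := by
        by_contra! h3
        have := hw i
        rw [hwk] at this
        nlinarith
      have h3 : k i ≤ 0 := by exact_mod_cast h2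
      have h4 : (((k i).natAbs : ℕ) : ℤ) = -k i := by omega
      have h5 : (((k i).natAbs : ℕ) : ℚ) = -k i := by
        rw [← Int.cast_natCast, h4, Int.cast_neg]
      rw [h5, hwk]; ring
    · rw [← h1]
      refine Finset.sum_congr rfl fun i _ => ?_
      have h2 : (k i : ℚ) ≤ 0 := by
        by_contra! h3
        have := hw i
        rw [hwk] at this
        nlinarith
      have h3 : k i ≤ 0 := by exact_mod_cast h2
      have h4 : (((k i).natAbs : ℕ) : ℤ) = -k i := by omega
      rw [h4]; ring
  · have hk0 : ∀ i, (((k i).natAbs : ℕ) : ℤ) = k i := by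
      intro i
      have h2 : (0 : ℚ) ≤ k i := by
        by_contra! h3
        have := hw i
        rw [hwk] at this
        nlinarith
      have h3 : 0 ≤ k i := by exact_mod_cast h2
      omega
    refine ⟨fun i => (k i).natAbs, u, c, hpos, fun i => ?_, ?_⟩
    · rw [hwk]
      congr 1
      rw [← Int.cast_natCast, hk0]
    · rw [← h1]
      exact Finset.sum_congr rfl fun i _ => by rw [hk0]

end Polyhedra

/-! ### Facets and interior of the Newton polyhedron -/

section NewtonPolyhedron

variable {d : ℕ}

theorem le_of_mem_newtonPolyhedron {A : Finset (Fin d → ℕ)} {z : Fin d → ℚ}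
    (hz : z ∈ newtonPolyhedron A) {w : Fin d → ℕ} {m : ℚ}
    (hm : ∀ a ∈ A, m ≤ (wdeg w a : ℚ)) : m ≤ ∑ i, (w i : ℚ) * z i := by
  obtain ⟨_, c, hc, hc1, h⟩ := hz
  calc m = ∑ a ∈ A, c a * m := by rw [← Finset.sum_mul, hc1, one_mul]
    _ ≤ ∑ a ∈ A, c a * (wdeg w a : ℚ) := Finset.sum_le_sum fun a ha =>
        mul_le_mul_of_nonneg_left (hm a ha) (hc a ha)
    _ = ∑ i, (w i : ℚ) * ∑ a ∈ A, c a * (a i : ℚ) := by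
        simp only [wdeg, Finset.mul_sum, Nat.cast_sum, Nat.cast_mul]
        rw [Finset.sum_comm]
        exact Finset.sum_congr rfl fun i _ => Finset.sum_congr rfl fun a _ => by ring
    _ ≤ _ := Finset.sum_le_sum fun i _ => mul_le_mul_of_nonneg_left (h i) (Nat.cast_nonneg _)

/-- The Newton polyhedron is cut out by finitely many primitive weights. -/
theorem exists_weights_newtonPolyhedron {A : Finset (Fin d → ℕ)} (hA : A.Nonempty) :
    ∃ W : Finset (Fin d → ℕ), (∀ w ∈ W, ∃ u : Fin d → ℤ, ∑ i, u i * (w i : ℤ) = 1) ∧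
      ∀ z : Fin d → ℚ, (∀ i, 0 ≤ z i) →
        (∀ w ∈ W, ∃ a ∈ A, (wdeg w a : ℚ) ≤ ∑ i, (w i : ℚ) * z i) → z ∈ newtonPolyhedron A := by
  classical
  -- Homogenization: the coordinate `none` carries -1, so that membership of (-1, z) in the cone
  -- encodes a sum of coefficients at least 1. The remaining coordinates of each functional become a
  -- weight after rescaling.
  obtain ⟨F, hF⟩ := exists_finset_forall_iff_mem_cone A
    (fun a (o : Option (Fin d)) => o.elim (-1 : ℚ) fun i => (a i : ℚ))
  have hcoord : ∀ f ∈ F, ∀ i, 0 ≤ f i := by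
    intro f hf i
    have := (hF (Pi.single i 1)).1 ⟨0, fun _ _ => le_rfl, fun j => by
      simp only [Pi.zero_apply, zero_mul, Finset.sum_const_zero]
      by_cases hij : j = i
      · rw [hij, Pi.single_eq_same]; exact zero_le_one
      · rw [Pi.single_eq_of_ne hij]⟩ f hf
    simpa using this
  have hgen : ∀ f ∈ F, ∀ a ∈ A, f none ≤ ∑ i, f (some i) * (a i : ℚ) := by
    intro f hf a ha
    have := (hF fun o => o.elim (-1 : ℚ) fun i => (a i : ℚ)).1 ⟨Pi.single a 1, fun b _ => by
      by_cases hab : b = a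
      · rw [hab, Pi.single_eq_same]; exact zero_le_one
      · rw [Pi.single_eq_of_ne hab], fun j => by
      rw [Finset.sum_eq_single a (fun b _ hb => by rw [Pi.single_eq_of_ne hb, zero_mul])
        (fun h => absurd ha h), Pi.single_eq_same, one_mul]⟩ f hf
    simp only [dotProduct, Fintype.sum_option, Option.elim] at this
    linarith
  have hprim : ∀ f ∈ F, (fun i => f (some i)) ≠ 0 → ∃ w' : Fin d → ℕ, (∃ u : Fin d → ℤ,
      ∑ i, u i * (w' i : ℤ) = 1) ∧ ∃ c : ℚ, 0 < c ∧ ∀ i, f (some i) = c * w' i := by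
    intro f hf hf0
    obtain ⟨w', u, c, hc, h, hu⟩ := exists_primitive_nat_of_nonneg
      (fun i => hcoord f hf (some i)) hf0
    exact ⟨w', ⟨u, hu⟩, c, hc, h⟩
  choose! φ hφ1 hφ2 using hprim
  refine ⟨(F.filter fun f => (fun i => f (some i)) ≠ 0).image φ, ?_, fun z hz0 hz => ?_⟩
  · intro w hw
    obtain ⟨f, hf, rfl⟩ := Finset.mem_image.1 hw
    rw [Finset.mem_filter] at hf
    exact hφ1 f hf.1 hf.2
  · have hmem : ∀ f ∈ F, 0 ≤ f ⬝ᵥ (fun o : Option (Fin d) => o.elim (-1 : ℚ) z) := by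
      intro f hf
      simp only [dotProduct, Fintype.sum_option, Option.elim]
      by_cases hf0 : (fun i => f (some i)) = 0
      · obtain ⟨a, ha⟩ := hA
        have h1 := hgen f hf a ha
        have h2 : ∀ i, f (some i) = 0 := fun i => congrFun hf0 i
        simp only [h2, zero_mul, Finset.sum_const_zero] at h1 ⊢
        linarith
      · obtain ⟨a, ha, h1⟩ := hz (φ f) (Finset.mem_image_of_mem _ (Finset.mem_filter.2 ⟨hf, hf0⟩))
        obtain ⟨c, hc, h2⟩ := hφ2 f hf hf0
        have h3 := hgen f hf a ha
        simp only [h2, wdeg, Nat.cast_sum, Nat.cast_mul, mul_assoc, ← Finset.mul_sum] at h1 h3 ⊢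
        have h4 : ∑ i, (a i : ℚ) * (φ f i : ℚ) = ∑ i, (φ f i : ℚ) * (a i : ℚ) :=
          Finset.sum_congr rfl fun i _ => mul_comm _ _
        rw [h4] at h1
        have := mul_le_mul_of_nonneg_left h1 hc.le
        linarith
    obtain ⟨c, hc, h⟩ := (hF _).2 hmem
    -- The sum need not equal 1. Dividing by it only decreases the coefficients, and the exponents
    -- are nonnegative, so the bounds by `z` survive.
    have hs : 1 ≤ ∑ a ∈ A, c a := by
      have := h none
      simp only [Option.elim, mul_neg, mul_one, Finset.sum_neg_distrib] at this
      linarith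
    have hs0 : 0 < ∑ a ∈ A, c a := by linarith
    refine ⟨hz0, fun a => c a / ∑ a ∈ A, c a, fun a ha => div_nonneg (hc a ha) hs0.le, ?_,
      fun i => ?_⟩
    · rw [← Finset.sum_div, div_self hs0.ne']
    · have h1 := h (some i)
      simp only [Option.elim] at h1
      refine le_trans (Finset.sum_le_sum fun a ha => ?_) h1
      exact mul_le_mul_of_nonneg_right (div_le_self (hc a ha) hs) (Nat.cast_nonneg _)

theorem exists_smul_mem_of_mem_interior {P : Set (Fin d → ℚ)} {z : Fin d → ℚ}
    (hz : z ∈ interior P) : ∃ t : ℚ, 0 < t ∧ t < 1 ∧ t • z ∈ P := by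
  have h1 : Filter.Tendsto (fun t : ℚ => t • z) (nhds 1) (nhds z) := by
    have : Continuous fun t : ℚ => t • z := by fun_prop
    simpa using this.tendsto 1
  have h2 := h1 (mem_interior_iff_mem_nhds.1 hz)
  obtain ⟨l, u, hlu, h3⟩ := mem_nhds_iff_exists_Ioo_subset.1 h2
  obtain ⟨t, ht1, ht2⟩ := exists_between (max_lt hlu.1 (zero_lt_one (α := ℚ)))
  exact ⟨t, (le_max_right _ _).trans_lt ht1, ht2,
    h3 ⟨(le_max_left _ _).trans_lt ht1, ht2.trans hlu.2⟩⟩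

theorem mem_interior_of_forall_lt {P : Set (Fin d → ℚ)} {α : Type*} {S : Set α} (hS : S.Finite)
    (w : α → Fin d → ℕ) (m : α → ℚ)
    (hP : ∀ z : Fin d → ℚ, (∀ i, 0 ≤ z i) → (∀ v ∈ S, m v ≤ ∑ i, (w v i : ℚ) * z i) → z ∈ P)
    {z : Fin d → ℚ} (hz : ∀ i, 0 < z i) (hzS : ∀ v ∈ S, m v < ∑ i, (w v i : ℚ) * z i) :
    z ∈ interior P := by
  refine mem_interior.2 ⟨(⋂ i, {y | 0 < y i}) ∩ ⋂ v ∈ S, {y | m v < ∑ i, (w v i : ℚ) * y i},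
    fun y hy => ?_, ?_, ?_⟩
  · simp only [Set.mem_inter_iff, Set.mem_iInter, Set.mem_ofPred_eq] at hy
    exact hP y (fun i => (hy.1 i).le) fun v hv => (hy.2 v hv).le
  · refine (isOpen_iInter_of_finite fun i => isOpen_lt (by fun_prop) (by fun_prop)).inter
      (hS.isOpen_biInter fun v _ => isOpen_lt (by fun_prop) (by fun_prop))
  · simpa using ⟨hz, hzS⟩

end NewtonPolyhedron

/-! ### Monomials integral over powers of a monomial ideal -/

theorem exists_nat_mul_eq_of_nonneg {α : Type*} (A : Finset α) {c : α → ℚ}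
    (hc : ∀ a ∈ A, 0 ≤ c a) :
    ∃ (N : ℕ) (k : α → ℕ), 1 ≤ N ∧ ∀ a ∈ A, (N : ℚ) * c a = k a := by
  classical
  obtain ⟨D, hD⟩ := IsLocalization.exist_integer_multiples (nonZeroDivisors ℤ) A c
  choose! m hm using hD
  have hD0 : (D : ℤ) ≠ 0 := nonZeroDivisors.coe_ne_zero D
  refine ⟨(D : ℤ).natAbs, fun a => (m a).natAbs, by omega, fun a ha => ?_⟩
  have h1 : (m a : ℚ) = (D : ℤ) * c a := by simpa [Algebra.smul_def] using hm a ha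
  rw [Nat.cast_natAbs, Nat.cast_natAbs, Int.cast_abs, Int.cast_abs, h1, abs_mul,
    abs_of_nonneg (hc a ha)]

section Closure

variable {R : Type*} [CommRing R] {d : ℕ} {x : Fin d → R}

theorem mon_sum_nsmul_mem {A : Finset (Fin d → ℕ)} (B : Finset (Fin d → ℕ)) (hB : B ⊆ A)
    (k : (Fin d → ℕ) → ℕ) :
    mon x (∑ a ∈ B, k a • a) ∈ monIdeal x (A : Set (Fin d → ℕ)) ^ (∑ a ∈ B, k a) := by
  classical
  induction B using Finset.induction_on with
  | empty => simp
  | insert b B hb ih =>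
    rw [Finset.sum_insert hb, Finset.sum_insert hb, mon_add, pow_add, mon_nsmul]
    exact Ideal.mul_mem_mul (Ideal.pow_mem_pow (mon_mem_monIdeal (hB (Finset.mem_insert_self _ _))) _)
      (ih fun a ha => hB (Finset.mem_insert_of_mem ha))

/-- With a common denominator N of the convex coefficients, x^{Ne} is a multiple of the n-th power
of a product of N generators, so the N-th power of x^e lies in the N-th power of Iⁿ. -/
theorem isIntegralOverIdeal_mon {A : Finset (Fin d → ℕ)} {n : ℕ} (hn : 1 ≤ n) {e : Fin d → ℕ}
    (he : (fun i => (e i : ℚ) / n) ∈ newtonPolyhedron A) :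
    IsIntegralOverIdeal (monIdeal x (A : Set (Fin d → ℕ)) ^ n) (mon x e) := by
  obtain ⟨_, c, hc, hc1, h⟩ := he
  obtain ⟨N, k, hN, hk⟩ := exists_nat_mul_eq_of_nonneg A hc
  refine isIntegralOverIdeal_of_pow_mem hN ?_
  have hkN : ∑ a ∈ A, k a = N := by
    have : ((∑ a ∈ A, k a : ℕ) : ℚ) = N := by
      push_cast
      rw [← Finset.sum_congr rfl hk, ← Finset.mul_sum, hc1, mul_one]
    exact_mod_cast this
  have hle : n • ∑ a ∈ A, k a • a ≤ N • e := by
    intro i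
    have hn0 : (0 : ℚ) < n := by exact_mod_cast hn
    have h1 := h i
    rw [le_div_iff₀ hn0] at h1
    have h2 := mul_le_mul_of_nonneg_left h1 (Nat.cast_nonneg (α := ℚ) N)
    have h3 : ((∑ a ∈ A, k a * a i : ℕ) : ℚ) = N * ∑ a ∈ A, c a * (a i : ℚ) := by
      push_cast
      rw [Finset.mul_sum]
      exact Finset.sum_congr rfl fun a ha => by rw [← hk a ha]; ring
    have h4 : ((n * ∑ a ∈ A, k a * a i : ℕ) : ℚ) ≤ ((N * e i : ℕ) : ℚ) := by
      rw [Nat.cast_mul, h3, Nat.cast_mul]; linarith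
    simpa [Finset.sum_apply] using (by exact_mod_cast h4 : n * ∑ a ∈ A, k a * a i ≤ N * e i)
  obtain ⟨f, hf⟩ := exists_add_of_le hle
  rw [← mon_nsmul, hf, mon_add, mon_nsmul, ← pow_mul, mul_comm n N, pow_mul]
  refine Ideal.mul_mem_right _ _ (Ideal.pow_mem_pow ?_ n)
  have := mon_sum_nsmul_mem (x := x) A subset_rfl k
  rwa [hkN] at this

end Closure

/-! ### Values of monomials and comparison of valuation rings -/

namespace ValuationOver

variable {R K : Type*} [CommRing R] [Field K] [Algebra R K] {d : ℕ}

/-- The values of the `x i`. -/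
def weight (v : ValuationOver R K) (x : Fin d → R) (i : Fin d) : ℕ := (v.baseVal (x i)).toNat

/-- `v` is a monomial valuation in `x`. -/
structure IsMonomial (v : ValuationOver R K) (x : Fin d → R) : Prop where
  isDiscreteValuationRing : IsDiscreteValuationRing v.ring
  le_baseVal_iff : ∀ (n : ℕ) (r : R),
    (n : ℕ∞) ≤ v.baseVal r ↔ r ∈ monIdeal x (levelSet (v.weight x) n)
  isEssFiniteType : v.IsEssFiniteType
  jacobianVal_le : v.jacobianVal + 1 ≤ ((∑ i, v.weight x i : ℕ) : ℕ∞)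

variable [IsDomain R] [IsFractionRing R K] (v : ValuationOver R K)

theorem coe_weight [IsDiscreteValuationRing v.ring] {x : Fin d → R} (hx : ∀ i, x i ≠ 0)
    (i : Fin d) : (v.weight x i : ℕ∞) = v.baseVal (x i) :=
  ENat.natCast_toNat (v.baseVal_eq_top_iff.not.2 (hx i))

theorem baseVal_mon [IsDiscreteValuationRing v.ring] {x : Fin d → R} (hx : ∀ i, x i ≠ 0)
    (e : Fin d → ℕ) : v.baseVal (mon x e) = (wdeg (v.weight x) e : ℕ) := by
  rw [mon, baseVal_prod, wdeg, Nat.cast_sum]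
  exact Finset.sum_congr rfl fun i _ => by rw [baseVal_pow, Nat.cast_mul, v.coe_weight hx]

theorem baseVal_prod_eq [IsDiscreteValuationRing v.ring] {x : Fin d → R} (hx : ∀ i, x i ≠ 0) :
    v.baseVal (∏ i, x i) = ((∑ i, v.weight x i : ℕ) : ℕ∞) := by
  rw [baseVal_prod, Nat.cast_sum]
  exact Finset.sum_congr rfl fun i _ => by rw [v.coe_weight hx]

theorem le_idealVal_monIdeal_iff [IsDiscreteValuationRing v.ring] {x : Fin d → R}
    (hx : ∀ i, x i ≠ 0) {E : Set (Fin d → ℕ)} {n : ℕ} :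
    (n : ℕ∞) ≤ v.idealVal (monIdeal x E) ↔ ∀ e ∈ E, n ≤ wdeg (v.weight x) e := by
  rw [monIdeal, le_idealVal_span_iff, Set.forall_mem_image]
  exact forall₂_congr fun e _ => by rw [v.baseVal_mon hx, Nat.cast_le]

theorem idealVal_ne_top [IsDiscreteValuationRing v.ring] {I : Ideal R} (hI : I ≠ ⊥) :
    v.idealVal I ≠ ⊤ := by
  obtain ⟨r, hr, hr0⟩ := Submodule.exists_mem_ne_zero_of_ne_bot hI
  exact ne_top_of_le_ne_top (v.baseVal_eq_top_iff.not.2 hr0) (v.idealVal_le hr)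

/-- Recovers the valuation ring from the values on `R`. For the converse, if z is not in the ring,
its inverse is a non-unit of the ring, which makes the denominator's value strictly larger. -/
theorem mem_ring_iff [IsDiscreteValuationRing v.ring] {z : K} {a b : R} (ha : a ≠ 0)
    (h : z * algebraMap R K b = algebraMap R K a) :
    z ∈ v.ring ↔ v.baseVal b ≤ v.baseVal a := by
  constructor
  · intro hz
    have h1 : algebraMap R v.ring a = ⟨z, hz⟩ * algebraMap R v.ring b := Subtype.ext h.symm
    rw [baseVal, baseVal, h1]
    exact v.val_le_val_mul _ _
  · intro hle
    by_contra hz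
    have hz' : z⁻¹ ∈ v.ring := (v.mem_or_inv_mem' z).resolve_left hz
    have hz0 : z ≠ 0 := fun h0 => hz (h0 ▸ v.ring.zero_mem)
    have h1 : algebraMap R v.ring b = ⟨z⁻¹, hz'⟩ * algebraMap R v.ring a := by
      refine Subtype.ext ?_
      change algebraMap R K b = z⁻¹ * algebraMap R K a
      rw [← h, inv_mul_cancel_left₀ hz0]
    have h2 : (⟨z⁻¹, hz'⟩ : v.ring) ∈ IsLocalRing.maximalIdeal v.ring := by
      rw [IsLocalRing.mem_maximalIdeal, mem_nonunits_iff]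
      rintro hu
      obtain ⟨y, hy⟩ := hu.exists_right_inv
      have h3 : z⁻¹ * (y : K) = 1 := congrArg Subtype.val hy
      have h4 : (y : K) = z := by
        rw [← mul_inv_cancel_left₀ hz0 (y : K), h3, mul_one]
      exact hz (h4 ▸ y.2)
    have h3 : ((1 : ℕ) : ℕ∞) ≤ v.val ⟨z⁻¹, hz'⟩ := by rwa [le_val_iff, pow_one]
    have h4 : v.baseVal b = v.val ⟨z⁻¹, hz'⟩ + v.baseVal a := by
      rw [baseVal, h1, val_eq_addVal, IsDiscreteValuationRing.addVal_mul, ← val_eq_addVal,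
        ← val_eq_addVal]; rfl
    obtain ⟨n, hn⟩ := ENat.ne_top_iff_exists.1 (v.baseVal_eq_top_iff.not.2 ha)
    have h5 : ((1 : ℕ) : ℕ∞) + v.baseVal a ≤ v.baseVal a := by
      refine le_trans ?_ hle
      rw [h4]
      exact add_le_add_left h3 _
    rw [← hn] at h5
    norm_cast at h5
    omega

theorem ext_of_ring_eq {R K : Type*} [CommRing R] [Field K] [Algebra R K]
    {v v' : ValuationOver R K} (h : ∀ z, z ∈ v.ring ↔ z ∈ v'.ring) : v = v' := by
  obtain ⟨A, hA⟩ := v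
  obtain ⟨A', hA'⟩ := v'
  have : A = A' := Subalgebra.ext h
  subst this
  rfl

theorem eq_of_proportional {s t : ValuationOver R K} [IsDiscreteValuationRing s.ring]
    [IsDiscreteValuationRing t.ring] {m n : ℕ} (hm : 0 < m) (hn : 0 < n)
    (h : ∀ f : R, f ≠ 0 → m * (t.baseVal f).toNat = (s.baseVal f).toNat * n) : s = t := by
  refine ext_of_ring_eq fun z => ?_
  by_cases hz : z = 0
  · rw [hz]; exact ⟨fun _ => zero_mem _, fun _ => zero_mem _⟩
  obtain ⟨a, b, ha, hb, hab⟩ := exists_frac_rep (R := R) z hz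
  rw [s.mem_ring_iff ha hab, t.mem_ring_iff ha hab,
    ← ENat.natCast_toNat (s.baseVal_eq_top_iff.not.2 ha),
    ← ENat.natCast_toNat (s.baseVal_eq_top_iff.not.2 hb),
    ← ENat.natCast_toNat (t.baseVal_eq_top_iff.not.2 ha),
    ← ENat.natCast_toNat (t.baseVal_eq_top_iff.not.2 hb), Nat.cast_le, Nat.cast_le]
  have h1 := h a ha
  have h2 := h b hb
  rw [← Nat.mul_le_mul_right_iff hn, ← h1, ← h2, Nat.mul_le_mul_left_iff hm]

end ValuationOver

/-! ### Existence and minimality of the Rees valuations -/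

section Rees

variable {R K : Type*} [CommRing R] [IsDomain R] [Field K] [Algebra R K] [IsFractionRing R K]

theorem DeterminesIntegralClosures.natCast_mul_idealVal_le {I : Ideal R} (v : ValuationOver R K)
    [IsDiscreteValuationRing v.ring] {n : ℕ} {r : R} (h : IsIntegralOverIdeal (I ^ n) r) :
    (n : ℕ∞) * v.idealVal I ≤ v.baseVal r := by
  rw [← v.idealVal_pow]
  exact v.idealVal_le_baseVal_of_isIntegralOverIdeal h

/-- By minimality each `s` has a witness satisfying all conditions except the one at `s`. The
proportionality lemma then yields a member of `T` with proportional values, hence with the same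
valuation ring. -/
theorem DeterminesIntegralClosures.subset_of_minimal {I : Ideal R} (hI : I ≠ ⊥)
    {S T : Set (ValuationOver R K)}
    (hS : Minimal (DeterminesIntegralClosures I) S)
    (hT : DeterminesIntegralClosures I T) : S ⊆ T := by
  intro s hs
  have hSd := hS.prop
  have hnot : ¬ DeterminesIntegralClosures I (S \ {s}) := fun h =>
    (hS.le_of_le h Set.sdiff_subset hs).2 rfl
  have hex : ∃ (n : ℕ) (r : R), 1 ≤ n ∧ (∀ v ∈ S \ {s}, (n : ℕ∞) * v.idealVal I ≤ v.baseVal r) ∧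
      ¬ IsIntegralOverIdeal (I ^ n) r := by
    by_contra! hcon
    refine hnot ⟨hSd.finite.subset Set.sdiff_subset, fun v hv => hSd.isDiscrete v hv.1,
      fun n hn r => ⟨fun h v hv => ?_, fun h => hcon n r hn h⟩⟩
    have := hSd.isDiscrete v hv.1
    exact DeterminesIntegralClosures.natCast_mul_idealVal_le v h
  obtain ⟨n, r, hn, hr, hrI⟩ := hex
  have hr0 : r ≠ 0 := by
    rintro rfl
    exact hrI (isIntegralOverIdeal_of_pow_mem le_rfl (by simp))
  -- values as natural numbers
  set α := {v : ValuationOver R K // IsDiscreteValuationRing v.ring}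
  set N : α → nonZeroDivisors R → ℕ := fun v f => (v.1.baseVal (f : R)).toNat with hN
  set M : α → ℕ := fun v => (v.1.idealVal I).toNat with hM
  have hNc : ∀ (v : α) (f : nonZeroDivisors R), (N v f : ℕ∞) = v.1.baseVal (f : R) := fun v f => by
    have := v.2
    exact ENat.natCast_toNat (v.1.baseVal_eq_top_iff.not.2 (nonZeroDivisors.coe_ne_zero f))
  have hMc : ∀ v : α, (M v : ℕ∞) = v.1.idealVal I := fun v => by
    have := v.2
    exact ENat.natCast_toNat (v.1.idealVal_ne_top hI)
  have hle : ∀ (v : α) (m : ℕ) (f : nonZeroDivisors R),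
      m * M v ≤ N v f ↔ (m : ℕ∞) * v.1.idealVal I ≤ v.1.baseVal (f : R) := fun v m f => by
    rw [← hNc, ← hMc]; norm_cast
  have hdet : ∀ U : Set (ValuationOver R K), DeterminesIntegralClosures I U → ∀ m, 1 ≤ m →
      ∀ f : nonZeroDivisors R, IsIntegralOverIdeal (I ^ m) (f : R) ↔
        ∀ v ∈ (Subtype.val ⁻¹' U : Set α), m * M v ≤ N v f := fun U hU m hm f => by
    rw [hU.isIntegralOverIdeal_iff m hm]
    constructor
    · intro h v hv
      exact (hle v m f).2 (h v hv)
    · intro h v hv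
      exact (hle ⟨v, hU.isDiscrete v hv⟩ m f).1 (h ⟨v, hU.isDiscrete v hv⟩ hv)
  obtain ⟨t, ht, ht0, h⟩ := exists_proportional_of_forall_iff (N := N) (fun v f g => by
      have := v.2
      have h1 := v.1.baseVal_mul (f : R) (g : R)
      have h2 := hNc v (f * g)
      rw [Submonoid.coe_mul, h1, ← hNc, ← hNc] at h2
      exact_mod_cast h2) (M := M) (S := (Subtype.val ⁻¹' S : Set α))
    (T := (Subtype.val ⁻¹' T : Set α))
    (hT.finite.preimage Subtype.val_injective.injOn) (fun m f => by
      rcases Nat.eq_zero_or_pos m with rfl | hm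
      · simp
      · rw [← hdet S hSd m hm f, ← hdet T hT m hm f])
    (s := ⟨s, hSd.isDiscrete s hs⟩) hs (n := n) (r := ⟨r, mem_nonZeroDivisors_of_ne_zero hr0⟩)
    (fun v hv hvs => (hle _ _ _).2 (hr v ⟨hv, fun h => hvs (Subtype.ext h)⟩)) (by
      by_contra! hcon
      apply hrI
      refine (hSd.isIntegralOverIdeal_iff n hn r).2 fun v hv => ?_
      by_cases hvs : v = s
      · subst hvs
        exact (hle ⟨v, hSd.isDiscrete v hs⟩ n ⟨r, mem_nonZeroDivisors_of_ne_zero hr0⟩).1 hcon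
      · exact hr v ⟨hv, hvs⟩)
  have hs0 : 0 < M ⟨s, hSd.isDiscrete s hs⟩ := by
    by_contra! h0
    have h1 : (s.idealVal I) = 0 := by
      rw [← hMc ⟨s, hSd.isDiscrete s hs⟩, Nat.le_zero.1 h0, Nat.cast_zero]
    apply hrI
    refine (hSd.isIntegralOverIdeal_iff n hn r).2 fun v hv => ?_
    by_cases hvs : v = s
    · rw [hvs, h1, mul_zero]; exact zero_le
    · exact hr v ⟨hv, hvs⟩
  have := hSd.isDiscrete s hs
  have := t.2
  have hst : s = t := ValuationOver.eq_of_proportional hs0 ht0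
    fun f hf => h ⟨f, mem_nonZeroDivisors_of_ne_zero hf⟩
  rw [hst]
  exact ht

/-- If some finite set of discrete valuations determines the integral closures of the powers of
`I`, then the Rees valuations of `I` form the smallest such set. -/
theorem DeterminesIntegralClosures.reesValuations {I : Ideal R} (hI : I ≠ ⊥)
    {S : Set (ValuationOver R K)} (hS : DeterminesIntegralClosures I S) :
    DeterminesIntegralClosures I (reesValuations K I) := by
  have hfin : {S' | S' ⊆ S ∧ DeterminesIntegralClosures I S'}.Finite :=
    hS.finite.finite_subsets.subset fun S' h => h.1
  obtain ⟨S', hS'⟩ := hfin.exists_minimal ⟨S, subset_rfl, hS⟩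
  have hmin : Minimal (DeterminesIntegralClosures I) S' :=
    ⟨hS'.prop.2, fun U hU hUS => hS'.le_of_le ⟨hUS.trans hS'.prop.1, hU⟩ hUS⟩
  have : _root_.reesValuations K I = S' := by
    refine subset_antisymm (Set.sInter_subset_of_mem hmin.prop) ?_
    exact Set.subset_sInter fun T hT => DeterminesIntegralClosures.subset_of_minimal hI hmin hT
  rw [this]
  exact hmin.prop

end Rees

/-! ### Monomial valuations determine integral closures -/

section MonomialValuations

variable {R K : Type*} [CommRing R] [IsDomain R] [Field K] [Algebra R K] [IsFractionRing R K]
  {d : ℕ} {x : Fin d → R}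

theorem IsPrimeFamily.exists_isMonomial [IsNoetherianRing R] (K : Type*) [Field K] [Algebra R K]
    [IsFractionRing R K] (hx : IsPrimeFamily x) {w : Fin d → ℕ} {u : Fin d → ℤ}
    (huw : ∑ i, u i * (w i : ℤ) = 1) :
    ∃ v : ValuationOver R K, v.IsMonomial x ∧ v.weight x = w := by
  obtain ⟨v, h1, h2, h3, h4⟩ := hx.exists_monomialValuation K huw
  have hw : v.weight x = w := by
    ext i
    have : v.baseVal (x i) = (w i : ℕ∞) := by
      refine ENat.eq_of_forall_natCast_le_iff fun n => ?_
      have h5 : x i = mon x (Pi.single i 1) := by rw [mon_single, pow_one]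
      rw [h2, h5, hx.mon_mem_levelSet, wdeg, Finset.sum_eq_single i
        (by intro j _ hj; simp [hj]) (by simp)]
      simp
    rw [ValuationOver.weight, this, ENat.toNat_natCast]
  exact ⟨v, ⟨h1, by rwa [hw], h3, by rwa [hw]⟩, hw⟩

theorem IsPrimeFamily.exists_valuations_newtonPolyhedron [IsNoetherianRing R] (K : Type*) [Field K]
    [Algebra R K] [IsFractionRing R K] (hx : IsPrimeFamily x) {A : Finset (Fin d → ℕ)}
    (hA : A.Nonempty) :
    ∃ S : Set (ValuationOver R K), S.Finite ∧ (∀ v ∈ S, v.IsMonomial x) ∧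
      ∀ z : Fin d → ℚ, (∀ i, 0 ≤ z i) →
        (∀ v ∈ S, ∃ a ∈ A, (wdeg (v.weight x) a : ℚ) ≤ ∑ i, (v.weight x i : ℚ) * z i) →
        z ∈ newtonPolyhedron A := by
  classical
  obtain ⟨W, hW, h⟩ := exists_weights_newtonPolyhedron hA
  have hex : ∀ w ∈ W, ∃ v : ValuationOver R K, v.IsMonomial x ∧ v.weight x = w := fun w hw => by
    obtain ⟨u, hu⟩ := hW w hw
    exact hx.exists_isMonomial K hu
  have : Nonempty (ValuationOver R K) := ⟨⟨⊤, fun z => Or.inl trivial⟩⟩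
  choose! φ hφ using hex
  refine ⟨φ '' W, W.finite_toSet.image φ, ?_, fun z hz0 hz => h z hz0 fun w hw => ?_⟩
  · rintro _ ⟨w, hw, rfl⟩
    exact (hφ w hw).1
  · have := hz (φ w) ⟨w, hw, rfl⟩
    rwa [(hφ w hw).2] at this

theorem IsPrimeFamily.monIdeal_ne_bot (hx : IsPrimeFamily x) {E : Set (Fin d → ℕ)}
    (hE : E.Nonempty) : monIdeal x E ≠ ⊥ := by
  obtain ⟨e, he⟩ := hE
  exact fun h => hx.mon_ne_zero e ((Submodule.mem_bot R).1 (h ▸ mon_mem_monIdeal he))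

theorem IsPrimeFamily.nonempty_of_monIdeal_ne_bot {E : Set (Fin d → ℕ)} (h : monIdeal x E ≠ ⊥) :
    E.Nonempty := by
  by_contra h0
  rw [Set.not_nonempty_iff_eq_empty] at h0
  exact h (by rw [h0, monIdeal, Set.image_empty, Ideal.span_empty])

theorem ValuationOver.exists_wdeg_le_idealVal (v : ValuationOver R K)
    [IsDiscreteValuationRing v.ring] (hx : ∀ i, x i ≠ 0) {A : Finset (Fin d → ℕ)}
    (hA : A.Nonempty) :
    ∃ a ∈ A, ((wdeg (v.weight x) a : ℕ) : ℕ∞) ≤ v.idealVal (monIdeal x (A : Set (Fin d → ℕ))) := by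
  obtain ⟨a, ha, h⟩ := A.exists_min_image (wdeg (v.weight x)) hA
  exact ⟨a, ha, (v.le_idealVal_monIdeal_iff hx).2 h⟩

/-- The conditions at monomial valuations cut out an intersection of monomial ideals, which is
generated by the monomials in it. Their exponents divided by n lie in the Newton polyhedron, so they
are integral over Iⁿ. -/
theorem IsPrimeFamily.determinesIntegralClosures (hx : IsPrimeFamily x) {A : Finset (Fin d → ℕ)}
    (hA : A.Nonempty) {S : Set (ValuationOver R K)} (hS : S.Finite)
    (hSm : ∀ v ∈ S, v.IsMonomial x)
    (h : ∀ z : Fin d → ℚ, (∀ i, 0 ≤ z i) →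
        (∀ v ∈ S, ∃ a ∈ A, (wdeg (v.weight x) a : ℚ) ≤ ∑ i, (v.weight x i : ℚ) * z i) →
        z ∈ newtonPolyhedron A) :
    DeterminesIntegralClosures (monIdeal x (A : Set (Fin d → ℕ))) S := by
  set I := monIdeal x (A : Set (Fin d → ℕ)) with hIdef
  have hI : I ≠ ⊥ := hx.monIdeal_ne_bot hA
  refine ⟨hS, fun v hv => (hSm v hv).isDiscreteValuationRing, fun n hn r => ⟨fun hr v hv => ?_,
    fun hr => ?_⟩⟩
  · have := (hSm v hv).isDiscreteValuationRing
    exact DeterminesIntegralClosures.natCast_mul_idealVal_le v hr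
  · have hcoe : ∀ v ∈ S, ((v.idealVal I).toNat : ℕ∞) = v.idealVal I := fun v hv => by
      have := (hSm v hv).isDiscreteValuationRing
      exact ENat.natCast_toNat (v.idealVal_ne_top hI)
    have h1 : r ∈ ⨅ v ∈ hS.toFinset,
        monIdeal x (levelSet (v.weight x) (n * (v.idealVal I).toNat)) := by
      simp only [Ideal.mem_iInf, Set.Finite.mem_toFinset]
      intro v hv
      rw [← (hSm v hv).le_baseVal_iff, Nat.cast_mul, hcoe v hv]
      exact hr v hv
    rw [hx.iInf_monIdeal _ _ fun v => isUpperSet_levelSet _ _] at h1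
    refine isIntegralOverIdeal_of_mem_span ?_ h1
    rintro _ ⟨e, he, rfl⟩
    refine isIntegralOverIdeal_mon hn (h _ (fun i => by positivity) fun v hv => ?_)
    have := (hSm v hv).isDiscreteValuationRing
    obtain ⟨a, ha, hle⟩ := v.exists_wdeg_le_idealVal hx.ne_zero hA
    rw [← hIdef, ← hcoe v hv, Nat.cast_le] at hle
    refine ⟨a, ha, ?_⟩
    have h2 : n * (v.idealVal I).toNat ≤ wdeg (v.weight x) e := by
      simp only [Set.mem_iInter, Set.Finite.mem_toFinset] at he
      exact he v hv
    have hn0 : (0 : ℚ) < n := by exact_mod_cast hn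
    have h3 : ∑ i, (v.weight x i : ℚ) * ((e i : ℚ) / n) = (wdeg (v.weight x) e : ℚ) / n := by
      rw [wdeg, Nat.cast_sum, Finset.sum_div]
      exact Finset.sum_congr rfl fun i _ => by rw [Nat.cast_mul]; ring
    rw [h3, le_div_iff₀ hn0]
    have h4 : n * wdeg (v.weight x) a ≤ wdeg (v.weight x) e :=
      (Nat.mul_le_mul_left n hle).trans h2
    rw [mul_comm]
    exact_mod_cast h4

theorem ValuationOver.IsMonomial.jacobianVal_add_one [IsRegularRing R] {v : ValuationOver R K}
    (hv : v.IsMonomial x) (hx : IsGeneralizedRSP x) :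
    v.jacobianVal + 1 = v.baseVal (∏ i, x i) := by
  have := hv.isDiscreteValuationRing
  refine le_antisymm ?_ (v.baseVal_prod_le_jacobianVal hv.isEssFiniteType hx)
  rw [v.baseVal_prod_eq hx.isPrimeFamily.ne_zero]
  exact hv.jacobianVal_le

end MonomialValuations

/-! ### The adjoint of a monomial ideal -/

section Adjoint

variable {R K : Type*} [CommRing R] [IsDomain R] [IsRegularRing R] [Field K] [Algebra R K]
  [IsFractionRing R K] {d : ℕ} {x : Fin d → R}

/-- Shrinking the interior point turns the weak inequality into a strict one when v(I) > 0.
Strictness for integers gains 1, which is exactly the loss in the Jacobian inequality. -/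
theorem IsGeneralizedRSP.monIdeal_interior_le_adjointIdeal (hx : IsGeneralizedRSP x)
    {B : Finset (Fin d → ℕ)} (hB : B.Nonempty) :
    monIdeal x {e | (fun i => (e i : ℚ) + 1) ∈ interior (newtonPolyhedron B)} ≤
      adjointIdeal K (monIdeal x (B : Set (Fin d → ℕ))) := by
  set I := monIdeal x (B : Set (Fin d → ℕ))
  rw [monIdeal_le_iff]
  intro e he v hv
  have hI : I ≠ ⊥ := hx.isPrimeFamily.monIdeal_ne_bot hB
  have hx0 := hx.isPrimeFamily.ne_zero
  -- This case also disposes of the trivial valuation; otherwise the valuation ring is discrete.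
  by_cases h0 : v.idealVal I = 0
  · rw [h0]; exact zero_le
  have := hv.isDiscreteValuationRing v hI h0
  obtain ⟨m, hm⟩ := ENat.ne_top_iff_exists.1 (v.idealVal_ne_top hI)
  obtain ⟨t, ht0, ht1, ht⟩ := exists_smul_mem_of_mem_interior he
  have h1 := le_of_mem_newtonPolyhedron ht (w := v.weight x) (m := m) fun a ha => by
    exact_mod_cast (v.le_idealVal_monIdeal_iff hx0).1 hm.le a ha
  have hm0 : 0 < m := Nat.pos_of_ne_zero fun h => h0 (by rw [← hm, h]; rfl)
  have h2 : ∑ i, (v.weight x i : ℚ) * (t • fun i => (e i : ℚ) + 1) i =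
      t * ((wdeg (v.weight x) e + ∑ i, v.weight x i : ℕ) : ℚ) := by
    push_cast [wdeg]
    rw [← Finset.sum_add_distrib, Finset.mul_sum]
    exact Finset.sum_congr rfl fun i _ => by simp only [Pi.smul_apply, smul_eq_mul]; ring
  rw [h2] at h1
  have h3 : m + 1 ≤ wdeg (v.weight x) e + ∑ i, v.weight x i := by
    have h4 : (0 : ℚ) < m := by exact_mod_cast hm0
    have h5 : (m : ℚ) < ((wdeg (v.weight x) e + ∑ i, v.weight x i : ℕ) : ℚ) := by
      by_contra! h6
      nlinarith
    exact_mod_cast h5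
  have h4 := v.baseVal_prod_le_jacobianVal hv hx
  rw [v.baseVal_prod_eq hx0] at h4
  change v.idealVal I ≤ v.baseVal (mon x e) + v.jacobianVal
  rw [v.baseVal_mon hx0, ← hm]
  have h5 : ((m : ℕ∞) + 1) ≤ (wdeg (v.weight x) e : ℕ) + v.jacobianVal + 1 := by
    rw [add_assoc]
    refine le_trans ?_ (add_le_add_right h4 _)
    exact_mod_cast h3
  exact (ENat.add_le_add_iff_right ENat.one_ne_top).1 h5

theorem ValuationOver.isUpperSet_le_baseVal {v : ValuationOver R K}
    (m : ℕ∞) : IsUpperSet {e : Fin d → ℕ | m ≤ v.baseVal (mon x e) + v.baseVal (∏ i, x i)} := by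
  intro e f hef he
  rw [Set.mem_ofPred_eq] at he ⊢
  refine le_trans he (add_le_add_left ?_ _)
  obtain ⟨c, hc⟩ := mon_dvd_mon (x := x) hef
  rw [hc, mul_comm]
  exact v.baseVal_le_baseVal_mul _ _

/-- For a monomial valuation the Jacobian value is known exactly, and elements of large value form a
monomial ideal, so the condition passes from elements to generating monomials. -/
theorem ValuationOver.IsMonomial.adjointIdeal_le (hx : IsGeneralizedRSP x) {v : ValuationOver R K}
    (hv : v.IsMonomial x) {J : Ideal R} (hJ : J ≠ ⊥) :
    adjointIdeal K J ≤
      monIdeal x {e | v.idealVal J + 1 ≤ v.baseVal (mon x e) + v.baseVal (∏ i, x i)} := by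
  have := hv.isDiscreteValuationRing
  intro r hr
  have hx0 := hx.isPrimeFamily.ne_zero
  have h1 : v.idealVal J ≤ v.baseVal r + v.jacobianVal := hr v hv.isEssFiniteType
  have h2 : v.idealVal J + 1 ≤ v.baseVal r + v.baseVal (∏ i, x i) := by
    rw [← hv.jacobianVal_add_one hx, ← add_assoc]
    exact add_le_add_left h1 1
  obtain ⟨m, hm⟩ := ENat.ne_top_iff_exists.1 (v.idealVal_ne_top hJ)
  rw [v.baseVal_prod_eq hx0, ← hm] at h2 ⊢
  have h3 : ((m + 1 - ∑ i, v.weight x i : ℕ) : ℕ∞) ≤ v.baseVal r := by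
    cases hρ : v.baseVal r with
    | top => exact le_top
    | coe ρ =>
      rw [hρ] at h2
      norm_cast at h2 ⊢
      omega
  refine monIdeal_mono ?_ ((hv.le_baseVal_iff _ _).1 h3)
  intro e he
  rw [mem_levelSet] at he
  simp only [Set.mem_ofPred_eq]
  rw [v.baseVal_mon hx0]
  norm_cast
  omega

/-- Here `S` is any determining set, not necessarily monomial. A multiple of `z` is the exponent of
a monomial that `S` shows to be integral over a power of `I`; integrality then gives the
inequalities at the monomial valuations cutting out the polyhedron. -/
theorem IsGeneralizedRSP.mem_newtonPolyhedron_of_forall_le (hx : IsGeneralizedRSP x) {I : Ideal R}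
    (hI : I ≠ ⊥) {S : Set (ValuationOver R K)} (hS : DeterminesIntegralClosures I S) {n : ℕ}
    (hn : 1 ≤ n) {B : Finset (Fin d → ℕ)} (hB : I ^ n = monIdeal x (B : Set (Fin d → ℕ)))
    {z : Fin d → ℚ} (hz0 : ∀ i, 0 ≤ z i)
    (hz : ∀ v ∈ S, ((v.idealVal (I ^ n)).toNat : ℚ) ≤ ∑ i, (v.weight x i : ℚ) * z i) :
    z ∈ newtonPolyhedron B := by
  have hx0 := hx.isPrimeFamily.ne_zero
  have hIn : I ^ n ≠ ⊥ := pow_ne_zero n hI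
  have hBne : B.Nonempty := by
    rw [← Finset.coe_nonempty]
    exact IsPrimeFamily.nonempty_of_monIdeal_ne_bot (hB ▸ hIn)
  obtain ⟨T, _, hTm, hT⟩ := hx.isPrimeFamily.exists_valuations_newtonPolyhedron K hBne
  obtain ⟨N, k, hN, hk⟩ := exists_nat_mul_eq_of_nonneg Finset.univ fun i _ => hz0 i
  have hN0 : (0 : ℚ) < N := by exact_mod_cast hN
  have hsum : ∀ w : Fin d → ℕ, (wdeg w k : ℚ) = N * ∑ i, (w i : ℚ) * z i := fun w => by
    rw [wdeg, Nat.cast_sum, Finset.mul_sum]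
    exact Finset.sum_congr rfl fun i hi => by rw [Nat.cast_mul, ← hk i hi]; ring
  have hcoe : ∀ v : ValuationOver R K, IsDiscreteValuationRing v.ring →
      ((v.idealVal (I ^ n)).toNat : ℕ∞) = v.idealVal (I ^ n) := fun v hv =>
    ENat.natCast_toNat (v.idealVal_ne_top hIn)
  have hint : IsIntegralOverIdeal (I ^ (N * n)) (mon x k) := by
    refine (hS.isIntegralOverIdeal_iff _ (Nat.mul_pos hN hn) _).2 fun v hv => ?_
    have hvd := hS.isDiscrete v hv
    rw [Nat.cast_mul, mul_assoc, ← v.idealVal_pow, ← hcoe v hvd, v.baseVal_mon hx0]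
    have h1 : (N : ℚ) * ((v.idealVal (I ^ n)).toNat : ℚ) ≤ (wdeg (v.weight x) k : ℚ) := by
      rw [hsum]
      exact mul_le_mul_of_nonneg_left (hz v hv) hN0.le
    exact_mod_cast h1
  refine hT z hz0 fun u hu => ?_
  have hud := (hTm u hu).isDiscreteValuationRing
  obtain ⟨b, hb, hle⟩ := u.exists_wdeg_le_idealVal hx0 hBne
  refine ⟨b, hb, ?_⟩
  have h1 := DeterminesIntegralClosures.natCast_mul_idealVal_le u hint
  rw [Nat.cast_mul, mul_assoc, ← u.idealVal_pow, u.baseVal_mon hx0] at h1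
  rw [← hB] at hle
  have h2 : ((N * wdeg (u.weight x) b : ℕ) : ℕ∞) ≤ (wdeg (u.weight x) k : ℕ) := by
    rw [Nat.cast_mul]
    exact (mul_le_mul_right hle _).trans h1
  have h3 : (N : ℚ) * (wdeg (u.weight x) b : ℚ) ≤ (wdeg (u.weight x) k : ℚ) := by
    exact_mod_cast h2
  rw [hsum] at h3
  exact le_of_mul_le_mul_left h3 hN0

theorem IsGeneralizedRSP.iInf_le_monIdeal_interior (hx : IsGeneralizedRSP x) {I : Ideal R}
    (hI : I ≠ ⊥) {S : Set (ValuationOver R K)} (hS : DeterminesIntegralClosures I S) {n : ℕ}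
    (hn : 1 ≤ n) {B : Finset (Fin d → ℕ)} (hB : I ^ n = monIdeal x (B : Set (Fin d → ℕ))) :
    ⨅ v ∈ S, monIdeal x
        {e | v.idealVal (I ^ n) + 1 ≤ v.baseVal (mon x e) + v.baseVal (∏ i, x i)} ≤
      monIdeal x {e | (fun i => (e i : ℚ) + 1) ∈ interior (newtonPolyhedron B)} := by
  have hx0 := hx.isPrimeFamily.ne_zero
  have hIn : I ^ n ≠ ⊥ := pow_ne_zero n hI
  have h1 : ∀ E : ValuationOver R K → Set (Fin d → ℕ),
      ⨅ v ∈ S, monIdeal x (E v) = ⨅ v ∈ hS.finite.toFinset, monIdeal x (E v) := fun E => by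
    simp only [Set.Finite.mem_toFinset]
  rw [h1, hx.isPrimeFamily.iInf_monIdeal _ _ fun v =>
    ValuationOver.isUpperSet_le_baseVal _]
  refine monIdeal_mono fun e he => ?_
  simp only [Set.mem_iInter, Set.Finite.mem_toFinset, Set.mem_ofPred_eq] at he
  -- The strict inequalities at finitely many valuations, together with positivity of all
  -- coordinates of e + 1, define an open neighbourhood inside the polyhedron.
  refine mem_interior_of_forall_lt hS.finite (fun v => v.weight x)
    (fun v => ((v.idealVal (I ^ n)).toNat : ℚ))
    (fun z hz0 hz => hx.mem_newtonPolyhedron_of_forall_le hI hS hn hB hz0 hz)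
    (fun i => by positivity) fun v hv => ?_
  have := hS.isDiscrete v hv
  have h2 := he v hv
  rw [v.baseVal_mon hx0, v.baseVal_prod_eq hx0,
    ← ENat.natCast_toNat (v.idealVal_ne_top hIn)] at h2
  have h3 : (v.idealVal (I ^ n)).toNat < wdeg (v.weight x) e + ∑ i, v.weight x i := by
    exact_mod_cast h2
  have h4 : ∑ i, (v.weight x i : ℚ) * ((e i : ℚ) + 1) =
      ((wdeg (v.weight x) e + ∑ i, v.weight x i : ℕ) : ℚ) := by
    push_cast [wdeg]
    rw [← Finset.sum_add_distrib]
    exact Finset.sum_congr rfl fun i _ => by ring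
  rw [h4]
  exact_mod_cast h3

end Adjoint

/-! ### The zero ideal -/

section Bot

variable {R K : Type*} [CommRing R] [IsDomain R] [Field K] [Algebra R K] [IsFractionRing R K]

/-- The trivial valuation. -/
def trivialValuation (R K : Type*) [CommRing R] [Field K] [Algebra R K] : ValuationOver R K where
  toSubalgebra := ⊤
  mem_or_inv_mem' _ := Or.inl trivial

theorem trivialValuation_exists_denominator (z : (trivialValuation R K).ring) :
    ∃ t ∈ Algebra.adjoin R (∅ : Set (trivialValuation R K).ring), IsUnit t ∧
      z * t ∈ Algebra.adjoin R (∅ : Set (trivialValuation R K).ring) := by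
  by_cases hz : (z : K) = 0
  · exact ⟨1, one_mem _, isUnit_one, by
      rw [show z = 0 from Subtype.ext hz, zero_mul]; exact zero_mem _⟩
  obtain ⟨a, b, _, hb, hab⟩ := exists_frac_rep (R := R) (z : K) hz
  have hb0 : algebraMap R K b ≠ 0 := by simpa using (IsFractionRing.injective R K).ne hb
  refine ⟨algebraMap R _ b, Subalgebra.algebraMap_mem _ _, ?_, ?_⟩
  · refine IsUnit.of_mul_eq_one (⟨(algebraMap R K b)⁻¹, trivial⟩ : (trivialValuation R K).ring) ?_
    exact Subtype.ext (mul_inv_cancel₀ hb0)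
  · rw [show z * algebraMap R _ b = algebraMap R _ a from Subtype.ext hab]
    exact Subalgebra.algebraMap_mem _ _

theorem isField_trivialValuation : IsField (trivialValuation R K).ring where
  exists_pair_ne := exists_pair_ne _
  mul_comm := mul_comm
  mul_inv_cancel {z} hz := ⟨⟨(z : K)⁻¹, trivial⟩, Subtype.ext (mul_inv_cancel₀ fun h =>
    hz (Subtype.ext h))⟩

theorem one_mem_jacobianIdeal {A : Type*} [CommRing A] [Algebra R A]
    (h : (⊥ : Submodule A (Ω[A⁄R])) = ⊤) : (1 : A) ∈ jacobianIdeal R A := by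
  rw [← Matrix.det_one (n := Fin 0)]
  refine det_mem_fittingIdealZero (fun i : Fin 0 => (0 : Ω[A⁄R])) ?_ _ fun i => i.elim0
  rw [Set.range_eq_empty, Submodule.span_empty, h]

theorem ValuationOver.jacobianVal_le (v : ValuationOver R K) {a : v.ring}
    (ha : a ∈ jacobianIdeal R v.ring) : v.jacobianVal ≤ v.val a :=
  iInf_le (fun a : jacobianIdeal R v.ring => v.val (a : v.ring)) ⟨a, ha⟩

theorem jacobianVal_eq_zero_of_isField {v : ValuationOver R K} (hv : IsField v.ring)
    (h : (⊥ : Submodule v.ring (Ω[v.ring⁄R])) = ⊤) : v.jacobianVal = 0 := by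
  have h1 : v.jacobianVal ≤ v.val 1 := v.jacobianVal_le (one_mem_jacobianIdeal h)
  rw [v.val_eq_zero_of_isField hv one_ne_zero] at h1
  exact le_antisymm h1 bot_le

theorem exists_trivial_valuation (R K : Type*) [CommRing R] [IsDomain R] [Field K] [Algebra R K]
    [IsFractionRing R K] :
    ∃ v : ValuationOver R K, IsField v.ring ∧ v.IsEssFiniteType ∧ v.jacobianVal = 0 := by
  obtain ⟨v, hv, h⟩ : ∃ v : ValuationOver R K, IsField v.ring ∧ ∀ z : v.ring,
      ∃ t ∈ Algebra.adjoin R (∅ : Set v.ring), IsUnit t ∧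
        z * t ∈ Algebra.adjoin R (∅ : Set v.ring) :=
    ⟨trivialValuation R K, isField_trivialValuation, trivialValuation_exists_denominator⟩
  refine ⟨v, hv, (Algebra.essFiniteType_iff R v.ring).2 ⟨∅, ?_⟩,
    jacobianVal_eq_zero_of_isField hv (span_kaehler_eq_top ∅ h _ (by simp))⟩
  rwa [Finset.coe_empty]

/-- The trivial valuation is admitted, since K is a localization of R and has no differentials over
it. Its condition is ∞ ≤ v(r), which only r = 0 satisfies. -/
theorem adjointIdeal_bot : adjointIdeal K (⊥ : Ideal R) = ⊥ := by
  refine eq_bot_iff.2 fun r hr => ?_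
  obtain ⟨v, hv, hfin, hJ⟩ := exists_trivial_valuation R K
  have h := hr v hfin
  rw [hJ, add_zero] at h
  have h1 : (⊤ : ℕ∞) ≤ v.idealVal ⊥ := by
    rw [ValuationOver.le_idealVal_iff]
    intro r hr
    rw [(Submodule.mem_bot R).1 hr, ValuationOver.baseVal_zero]
  have h2 := h1.trans h
  by_contra hr0
  rw [Submodule.mem_bot] at hr0
  rw [ValuationOver.baseVal, v.val_eq_zero_of_isField hv] at h2
  · exact absurd h2 (by simp)
  · intro h3
    have h4 : algebraMap R K r = 0 := congrArg Subtype.val h3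
    exact hr0 ((IsFractionRing.injective R K) (by rw [h4, map_zero]))

end Bot

/-! ### Generators of powers of monomial ideals -/

section Generators

variable {R : Type*} [CommRing R] {d : ℕ} {x : Fin d → R}

theorem exists_finset_monIdeal_eq [IsNoetherianRing R] (E : Set (Fin d → ℕ)) :
    ∃ A : Finset (Fin d → ℕ), monIdeal x E = monIdeal x (A : Set (Fin d → ℕ)) := by
  classical
  obtain ⟨s, hs, h⟩ := Submodule.fg_span_iff_fg_span_finset_subset (R := R) (mon x '' E) |>.1
    (IsNoetherian.noetherian (monIdeal x E))
  obtain ⟨A, _, rfl⟩ := Finset.subset_set_image_iff.1 hs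
  refine ⟨A, ?_⟩
  rw [monIdeal, monIdeal, ← Finset.coe_image]
  exact h

theorem exists_monIdeal_pow_eq (E : Set (Fin d → ℕ)) (n : ℕ) :
    ∃ F : Set (Fin d → ℕ), monIdeal x E ^ n = monIdeal x F := by
  induction n with
  | zero =>
    refine ⟨{0}, ?_⟩
    rw [monIdeal, monIdeal, Set.image_singleton, mon_zero, Ideal.span_singleton_one, pow_zero,
      Ideal.one_eq_top]
  | succ n ih =>
    obtain ⟨F, hF⟩ := ih
    refine ⟨Set.image2 (· + ·) F E, ?_⟩
    rw [pow_succ, hF, monIdeal, monIdeal, monIdeal, Ideal.span_mul_span', ← Set.image2_mul,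
      Set.image2_image_left, Set.image2_image_right, Set.image_image2]
    simp only [mon_add]

end Generators

end

/-! ### The main theorem -/

theorem theorem4p1 {R K : Type*} [CommRing R] [IsDomain R] [IsRegularRing R]
    [Field K] [Algebra R K] [IsFractionRing R K]
    {d : ℕ} (x : Fin d → R) (hx : IsGeneralizedRSP x)
    (I : Ideal R) (hI : IsMonomialIdeal x I) (n : ℕ) (hn : 1 ≤ n) :
    -- the adjoint is a monomial ideal
    IsMonomialIdeal x (adjointIdeal K (I ^ n)) ∧
    -- the adjoint is given by the interior of the Newton polyhedron of `I ^ n`,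
    -- computed from any finite set of monomial generators of `I ^ n`
    (∃ B : Finset (Fin d → ℕ), I ^ n = monomialIdeal x B) ∧
    (∀ B : Finset (Fin d → ℕ), I ^ n = monomialIdeal x B →
      adjointIdeal K (I ^ n) =
        monomialIdeal x {e | (fun i => (e i : ℚ) + 1) ∈ interior (newtonPolyhedron B)}) ∧
    (I ≠ ⊥ →
      -- the Rees valuations of `I` exist
      DeterminesIntegralClosures I (reesValuations K I) ∧
      -- `v (x^e) ≥ v (I^n) - v (x₁ ⋯ x_d) + 1`
      adjointIdeal K (I ^ n) =
        ⨅ v ∈ reesValuations K I, monomialIdeal x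
          {e | v.idealVal (I ^ n) + 1 ≤ v.baseVal (xMonomial x e) + v.baseVal (∏ i, x i)} ∧
      -- `v (x^e) ≥ v (I^n) - v (J_{R_v/R})`
      adjointIdeal K (I ^ n) =
        ⨅ v ∈ reesValuations K I, monomialIdeal x
          {e | v.idealVal (I ^ n) ≤ v.baseVal (xMonomial x e) + v.jacobianVal} ∧
      ∀ v ∈ reesValuations K I, v.jacobianVal + 1 = v.baseVal (∏ i, x i)) := by
  obtain ⟨E, rfl⟩ := hI
  obtain ⟨B, hB⟩ : ∃ B : Finset (Fin d → ℕ), monIdeal x E ^ n = monIdeal x (B : Set (Fin d → ℕ)) := by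
    obtain ⟨F, hF⟩ := exists_monIdeal_pow_eq (x := x) E n
    rw [hF]
    exact exists_finset_monIdeal_eq F
  by_cases hbot : monIdeal x E = ⊥
  · have key : ∀ B : Finset (Fin d → ℕ), monomialIdeal x E ^ n = monomialIdeal x B →
        adjointIdeal K (monomialIdeal x E ^ n) =
          monomialIdeal x {e | (fun i => (e i : ℚ) + 1) ∈ interior (newtonPolyhedron B)} := by
      intro B hB
      change monIdeal x E ^ n = monIdeal x _ at hB
      change adjointIdeal K (monIdeal x E ^ n) = monIdeal x _
      rw [hbot, ← Ideal.zero_eq_bot, zero_pow (by omega), Ideal.zero_eq_bot] at hB ⊢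
      have hB0 : B = ∅ := by
        rw [← Finset.not_nonempty_iff_eq_empty]
        exact fun h => hx.isPrimeFamily.monIdeal_ne_bot (E := B) h hB.symm
      -- The empty sum of coefficients cannot be 1, so the polyhedron of the zero ideal is empty and
      -- both sides vanish.
      have hNP : newtonPolyhedron (∅ : Finset (Fin d → ℕ)) = ∅ := by
        refine Set.eq_empty_of_forall_notMem fun z hz => ?_
        obtain ⟨_, c, _, h, _⟩ := hz
        simp at h
      rw [adjointIdeal_bot, hB0, hNP, interior_empty, monIdeal]
      simp
    exact ⟨⟨_, key B hB⟩, ⟨B, hB⟩, key, fun h => absurd hbot h⟩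
  · obtain ⟨A, hA⟩ := exists_finset_monIdeal_eq (x := x) E
    have hAne : A.Nonempty := by
      rw [← Finset.coe_nonempty]
      exact IsPrimeFamily.nonempty_of_monIdeal_ne_bot (hA ▸ hbot)
    have hbotn : monIdeal x E ^ n ≠ ⊥ := pow_ne_zero n hbot
    obtain ⟨S, hSfin, hSm, hSc⟩ := hx.isPrimeFamily.exists_valuations_newtonPolyhedron K hAne
    have hS : DeterminesIntegralClosures (monIdeal x E) S :=
      hA ▸ hx.isPrimeFamily.determinesIntegralClosures hAne hSfin hSm hSc
    have hRV := hS.reesValuations hbot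
    -- The Rees valuations lie in every determining set, in particular in the set of monomial
    -- valuations just constructed.
    have hRVm : ∀ v ∈ reesValuations K (monIdeal x E), v.IsMonomial x := fun v hv =>
      hSm v (Set.sInter_subset_of_mem hS hv)
    have hJ : ∀ v ∈ reesValuations K (monIdeal x E), v.jacobianVal + 1 = v.baseVal (∏ i, x i) :=
      fun v hv => (hRVm v hv).jacobianVal_add_one hx
    have hle : adjointIdeal K (monIdeal x E ^ n) ≤ ⨅ v ∈ reesValuations K (monIdeal x E),
        monIdeal x {e | v.idealVal (monIdeal x E ^ n) + 1 ≤
          v.baseVal (mon x e) + v.baseVal (∏ i, x i)} :=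
      le_iInf₂ fun v hv => (hRVm v hv).adjointIdeal_le hx hbotn
    have hge : ∀ B : Finset (Fin d → ℕ), monIdeal x E ^ n = monIdeal x (B : Set (Fin d → ℕ)) →
        monIdeal x {e | (fun i => (e i : ℚ) + 1) ∈ interior (newtonPolyhedron B)} ≤
          adjointIdeal K (monIdeal x E ^ n) := fun B hB => by
      rw [hB]
      refine hx.monIdeal_interior_le_adjointIdeal ?_
      rw [← Finset.coe_nonempty]
      exact IsPrimeFamily.nonempty_of_monIdeal_ne_bot (hB ▸ hbotn)
    have key : ∀ B : Finset (Fin d → ℕ), monIdeal x E ^ n = monIdeal x (B : Set (Fin d → ℕ)) →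
        adjointIdeal K (monIdeal x E ^ n) =
          monIdeal x {e | (fun i => (e i : ℚ) + 1) ∈ interior (newtonPolyhedron B)} :=
      fun B hB => le_antisymm (hle.trans (hx.iInf_le_monIdeal_interior hbot hRV hn hB)) (hge B hB)
    have hRees : adjointIdeal K (monIdeal x E ^ n) = ⨅ v ∈ reesValuations K (monIdeal x E),
        monIdeal x {e | v.idealVal (monIdeal x E ^ n) + 1 ≤
          v.baseVal (mon x e) + v.baseVal (∏ i, x i)} :=
      le_antisymm hle ((hx.iInf_le_monIdeal_interior hbot hRV hn hB).trans (hge B hB))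
    refine ⟨⟨_, key B hB⟩, ⟨B, hB⟩, key, fun _ => ⟨hRV, hRees, ?_, hJ⟩⟩
    -- The two conditions differ by the finite summand 1 on both sides, by the formula for the
    -- Jacobian value.
    refine hRees.trans (iInf_congr fun v => iInf_congr fun hv => ?_)
    change monIdeal x _ = monIdeal x _
    congr 1
    ext e
    rw [Set.mem_ofPred_eq, Set.mem_ofPred_eq, ← hJ v hv, ← add_assoc]
    exact ENat.add_le_add_iff_right ENat.one_ne_top
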